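/- Let $-\infty\le a<b\le\infty$, let $f:(a,b)\to(0,\infty)$ be a $C^\infty$ function without critical points, and let $S=(a,b)\times S^1$ be the surface with the metric $ds^2=dr^2+f(r)^2d\varphi^2$ (an abstract surface of revolution without equators). Suppose that $f''f-(f')^2=-\xi^2$ on $(a,b)$ with $\xi>0$ rational. A central potential is a $C^\infty$ function $V$ on $(a,b)$. A trajectory is a solution $(r(t),\varphi(t)\bmod 2\pi)$ of the Euler–Lagrange equations of $L=\frac12(\dot r^2+f(r)^2\dot\varphi^2)-V(r)$; the angular momentum $K=f(r)^2\dot\varphi$ is constant along it. It is nonsingular if $K\ne0$; bounded if it is defined for all $t\in\mathbb R$ and stays in a compact ring $[r_1,r_2]\times S^1\subset S$; circular if its orbit (image in $S$) is a circle $\{r_0\}\times S^1$; its orbit is closed if the motion on $S$ is periodic in time. A circular orbit $\{r_0\}\times S^1$ with momentum $K_0\neq0$ is strongly stable if $V+K_0^2/(2f^2)$ has a nondegenerate local minimum at $r_0$; it is orbitally stable if its phase orbit is Lyapunov stable (as a set) for the system restricted to the level set $\{K=K_0\}$. Say that $V$ satisfies $(\forall)^{\rm loc}$ at $(r_0,K_0)$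 if for some $\varepsilon>0$ every nonsingular bounded orbit in $[r_0-\varepsilon,r_0+\varepsilon]\times S^1$ with momentum in $(K_0-\varepsilon,K_0+\varepsilon)$ is closed. The potential $V$ is - closing, if there is a nonsingular bounded noncircular orbit and every nonsingular bounded orbit is closed; - locally closing, if a strongly stable circular orbit exists and $(\forall)^{\rm loc}$ holds at every strongly stable circular orbit; - semilocally closing, if $(\forall)^{\rm loc}$ holds at every strongly stable circular orbit and there is a nonsingular bounded noncircular orbit $\gamma$ with momentum $\hat K$ such that every bounded orbit with momentum $\hat K$ in the ring $[\inf r|_\gamma,\sup r|_\gamma]\times S^1$ is closed; - strongly (resp. weakly) closing, if every circle $\{r\}\times S^1$, $r\in(a,b)$, is a strongly (resp. orbitally) stable circular orbit for some value of the momentum and $(\forall)^{\rm loc}$ holds at every strongly (resp. orbitally) stable circular orbit. Put $\theta=-f'/f$. Then: 1. The curvature $c=-f''/f$ is constant, and for some $r_0\in\mathbb R$ one has $f(r)=\pm\xi(r-r_0)$ if $c=0$, $f(r)=\frac{\xi}{\sqrt c}\sin(\sqrt c(r-r_0))$ if $c>0$, $f(r)=\pm\frac{\xi}{\sqrt{-c}}\sinh(\sqrt{-c}(r-r_0))$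 if $c<0$, with a fixed sign on $(a,b)$. Moreover $\theta=\pm\sqrt{\xi^2/f^2-c}$ with a fixed sign on $(a,b)$. 2. Up to additive and (positive) multiplicative constants there are exactly two closing central potentials on $S$, and likewise exactly two, the same ones, for each of the notions semilocally, locally, strongly and weakly closing. Namely, $V$ belongs to any one of these five classes if and only if $V=V_i$ on $(a,b)$ for some $i\in\{1,2\}$, where $$V_i=(-1)^i\frac{A}{i}|\theta|^{2-i^2}+B,\qquad A>0,\ B\in\mathbb R;$$ all these functions are $C^\infty$, and no $V_2$ is of the form $\alpha V_1+\beta$ with constants $\alpha,\beta$. 3. For every potential $V_i$ as above, $i=1,2$: - every nonsingular noncircular bounded orbit is given by a periodic function $r=r(\varphi)$, $\varphi\in\mathbb R$, with minimal positive period $2\pi/(i\xi)$ ($\varphi$ being a bijective function of time, after lifting to $\mathbb R$); - every circle $\{r\}\times S^1$, $r\in(a,b)$, is a circular orbit, and the values of the angular momentum on the corresponding trajectories are exactly $K=\pm\xi\sqrt{A/|\theta(r)|^{i^2}}$; - there is exactly one end $\hat r\in\{a,b\}$ at which $f$ tends to $\inf f$. An end is this one if and only if $|\theta|$ tends to $\sup|\theta|$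 there, and at this end $V_i$ tends to $\inf V_i$ (possibly $-\infty$): it is the attracting centre. -/

import Mathlib

open scoped ContDiff Topology
open Filter

noncomputable section

/-- An abstract surface of revolution: `(a, b) × S¹`, `-∞ ≤ a < b ≤ ∞`, with coordinates
`(r, φ mod 2π)` and the Riemannian metric `ds² = dr² + f(r)² dφ²`, where `f` is a positive `C^∞`
function on `(a, b)`. The values of `f` outside `(a, b)` play no role. -/
structure RevolutionSurface where
  a : EReal
  b : EReal
  f : ℝ → ℝ
  a_lt_b : a < b
  f_smooth : ContDiffOn ℝ ∞ f {r : ℝ | a < (r : EReal) ∧ (r : EReal) < b}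
  f_pos : ∀ r : ℝ, a < (r : EReal) → (r : EReal) < b → 0 < f r

namespace RevolutionSurface

variable (S : RevolutionSurface)

/-- The interval `(a, b)` of values of the coordinate `r`. -/
def I : Set ℝ := {r : ℝ | S.a < (r : EReal) ∧ (r : EReal) < S.b}

/-- The surface has no equators, i.e. no circles `{r} × S¹` with `f'(r) = 0`. -/
def NoEquators : Prop := ∀ r ∈ S.I, deriv S.f r ≠ 0

/-- Half of the scalar curvature (the Gaussian curvature) of `dr² + f² dφ²`. -/
def curvature (r : ℝ) : ℝ := -deriv (deriv S.f) r / S.f r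

/-- A central potential: a `C^∞` function of `r ∈ (a, b)`. -/
def IsPotential (V : ℝ → ℝ) : Prop := ContDiffOn ℝ ∞ V S.I

/-! ### Motion in a central field -/

/-- `t ↦ (r t, φ t)` solves, for `t` in the open set `J`, the Euler–Lagrange equations of
`L = (ṙ² + f(r)² φ̇²) / 2 - V(r)` on the surface; `φ` is a lift of the angle to `ℝ`. -/
structure IsSolutionOn (V : ℝ → ℝ) (J : Set ℝ) (r φ : ℝ → ℝ) : Prop where
  mem : ∀ t ∈ J, r t ∈ S.I
  diff_r : ∀ t ∈ J, DifferentiableAt ℝ r t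
  diff_φ : ∀ t ∈ J, DifferentiableAt ℝ φ t
  radial : ∀ t ∈ J, HasDerivAt (deriv r)
    (S.f (r t) * deriv S.f (r t) * (deriv φ t) ^ 2 - deriv V (r t)) t
  angular : ∀ t ∈ J, HasDerivAt (fun s => S.f (r s) ^ 2 * deriv φ s) 0 t

/-- The integral of angular momentum `f(r)² φ̇` has the value `K` along the motion. -/
def HasMomentumOn (J : Set ℝ) (r φ : ℝ → ℝ) (K : ℝ) : Prop :=
  ∀ t ∈ J, S.f (r t) ^ 2 * deriv φ t = K

/-- The orbit of a motion defined for all times, as a subset of `ℝ × S¹`. -/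
def orbit (r φ : ℝ → ℝ) : Set (ℝ × Real.Angle) :=
  Set.range fun t => (r t, (φ t : Real.Angle))

/-- The orbit is an orbit `{r₀} × S¹` of the rotation group. -/
def IsCircular (r φ : ℝ → ℝ) : Prop :=
  ∃ r₀ : ℝ, orbit r φ = {r₀} ×ˢ (Set.univ : Set Real.Angle)

/-- A bounded trajectory with angular momentum `K`: it is defined on the whole time axis, and
its image lies in a compact ring `[r₁, r₂] × S¹ ⊂ (a, b) × S¹`. -/
structure IsBoundedTrajectory (V : ℝ → ℝ) (r φ : ℝ → ℝ) (K : ℝ) : Prop where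
  sol : S.IsSolutionOn V Set.univ r φ
  momentum : S.HasMomentumOn Set.univ r φ K
  bounded : ∃ r₁ r₂ : ℝ, S.a < (r₁ : EReal) ∧ (r₂ : EReal) < S.b ∧ ∀ t, r₁ ≤ r t ∧ r t ≤ r₂

/-- The orbit is a closed curve: the motion on the surface is periodic in time. -/
def IsClosedOrbit (r φ : ℝ → ℝ) : Prop :=
  ∃ T : ℝ, 0 < T ∧ ∀ t, r (t + T) = r t ∧ (φ (t + T) : Real.Angle) = (φ t : Real.Angle)

/-- The circle `{r₀} × S¹` is a circular orbit, the value of the angular momentum on a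
corresponding trajectory being `K₀`. -/
def IsCircularOrbit (V : ℝ → ℝ) (r₀ K₀ : ℝ) : Prop :=
  ∃ r φ : ℝ → ℝ, S.IsSolutionOn V Set.univ r φ ∧ S.HasMomentumOn Set.univ r φ K₀ ∧
    orbit r φ = {r₀} ×ˢ (Set.univ : Set Real.Angle)

/-- The effective potential `V + K² / (2 f²)`. -/
def effPotential (V : ℝ → ℝ) (K : ℝ) (r : ℝ) : ℝ := V r + K ^ 2 / (2 * S.f r ^ 2)

/-- The circular orbit `{r₀} × S¹` with momentum `K₀ ≠ 0` is strongly stable: the effective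
potential has a nondegenerate local minimum at `r₀`. -/
def IsStronglyStable (V : ℝ → ℝ) (r₀ K₀ : ℝ) : Prop :=
  K₀ ≠ 0 ∧ S.IsCircularOrbit V r₀ K₀ ∧ IsLocalMin (S.effPotential V K₀) r₀ ∧
    deriv (deriv (S.effPotential V K₀)) r₀ ≠ 0

/-- The circular orbit `{r₀} × S¹` with momentum `K₀` is orbitally stable: motions on the same
level set of the angular momentum which start close to the phase orbit
`{r = r₀, ṙ = 0, φ̇ = K₀ / f(r₀)²}` (with `φ` arbitrary) stay close to it at all later times.
The distance of a phase point `(r, φ, ṙ, φ̇)` to this set is the maximum of the three numbers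
below. (For small `ε` the solution stays in a compact set, so it extends to all `t ≥ 0`.) -/
def IsOrbitallyStable (V : ℝ → ℝ) (r₀ K₀ : ℝ) : Prop :=
  S.IsCircularOrbit V r₀ K₀ ∧
    ∀ ε > 0, ∃ δ > 0, ∀ (t₀ t₁ : ℝ) (r φ : ℝ → ℝ), t₀ < 0 → 0 < t₁ →
      S.IsSolutionOn V (Set.Ioo t₀ t₁) r φ → S.HasMomentumOn (Set.Ioo t₀ t₁) r φ K₀ →
      |r 0 - r₀| < δ → |deriv r 0| < δ → |deriv φ 0 - K₀ / S.f r₀ ^ 2| < δ →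
      ∀ t, 0 ≤ t → t < t₁ →
        |r t - r₀| < ε ∧ |deriv r t| < ε ∧ |deriv φ t - K₀ / S.f r₀ ^ 2| < ε

/-! ### The five classes of closing potentials -/

/-- All nonsingular (`K ≠ 0`) bounded orbits which lie in a sufficiently small ring
`[r₀ - ε, r₀ + ε] × S¹` and have momentum in `(K₀ - ε, K₀ + ε)` are closed. -/
def ClosedNear (V : ℝ → ℝ) (r₀ K₀ : ℝ) : Prop :=
  ∃ ε > 0, ∀ (r φ : ℝ → ℝ) (K : ℝ), K ≠ 0 → S.IsBoundedTrajectory V r φ K →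
    (∀ t, r₀ - ε ≤ r t ∧ r t ≤ r₀ + ε) → K₀ - ε < K → K < K₀ + ε → IsClosedOrbit r φ

/-- The condition `(∀)^loc`. -/
def ForallLoc (V : ℝ → ℝ) : Prop :=
  ∀ r₀ K₀ : ℝ, S.IsStronglyStable V r₀ K₀ → S.ClosedNear V r₀ K₀

/-- Closing potentials: there is a nonsingular bounded noncircular orbit, and every nonsingular
bounded orbit is closed. -/
def IsClosing (V : ℝ → ℝ) : Prop :=
  (∃ (r φ : ℝ → ℝ) (K : ℝ), K ≠ 0 ∧ S.IsBoundedTrajectory V r φ K ∧ ¬ IsCircular r φ) ∧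
  (∀ (r φ : ℝ → ℝ) (K : ℝ), K ≠ 0 → S.IsBoundedTrajectory V r φ K → IsClosedOrbit r φ)

/-- Locally closing potentials. -/
def IsLocallyClosing (V : ℝ → ℝ) : Prop :=
  (∃ r₀ K₀ : ℝ, S.IsStronglyStable V r₀ K₀) ∧ S.ForallLoc V

/-- Semilocally closing potentials: `(∀)^loc` holds and there is a nonsingular bounded
noncircular orbit `γ = (r, φ)` with momentum `K` such that every bounded orbit with the same
momentum in the ring `inf r|_γ ≤ r' ≤ sup r|_γ` is closed. -/
def IsSemilocallyClosing (V : ℝ → ℝ) : Prop :=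
  S.ForallLoc V ∧
  ∃ (r φ : ℝ → ℝ) (K : ℝ), K ≠ 0 ∧ S.IsBoundedTrajectory V r φ K ∧ ¬ IsCircular r φ ∧
    ∀ r' φ' : ℝ → ℝ, S.IsBoundedTrajectory V r' φ' K →
      (∀ t, sInf (Set.range r) ≤ r' t ∧ r' t ≤ sSup (Set.range r)) → IsClosedOrbit r' φ'

/-- Strongly closing potentials. -/
def IsStronglyClosing (V : ℝ → ℝ) : Prop :=
  (∀ r₀ ∈ S.I, ∃ K₀ : ℝ, S.IsStronglyStable V r₀ K₀) ∧ S.ForallLoc V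

/-- Weakly closing potentials: as strongly closing, with orbital stability in place of strong
stability. -/
def IsWeaklyClosing (V : ℝ → ℝ) : Prop :=
  (∀ r₀ ∈ S.I, ∃ K₀ : ℝ, S.IsOrbitallyStable V r₀ K₀) ∧
  (∀ r₀ K₀ : ℝ, S.IsOrbitallyStable V r₀ K₀ → S.ClosedNear V r₀ K₀)

/-! ### Generalized gravitational and oscillator potentials -/

/-- `θ = -f' / f`. -/
def θ (r : ℝ) : ℝ := -deriv S.f r / S.f r

/-- `V_i = (-1)^i A |θ|^(2 - i²) / i + B`: the generalized gravitational potential for `i = 1`,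
the generalized oscillator potential for `i = 2`. -/
def Vpot (i : ℕ) (A B : ℝ) (r : ℝ) : ℝ :=
  (-1) ^ i * A * |S.θ r| ^ (2 - (i : ℤ) ^ 2) / i + B

/-! ### Boundary circles -/

/-- The filter of approach, inside `(a, b)`, to the boundary value `e ∈ {a, b}` of `r`. -/
def endFilter (e : EReal) : Filter ℝ :=
  comap (fun r : ℝ => (r : EReal)) (𝓝[Set.Ioo S.a S.b] e)

/-- The infimum of `g` over `(a, b)` (possibly `-∞`) is the limit of `g` at the end `e`. -/
def InfAtEnd (g : ℝ → ℝ) (e : EReal) : Prop :=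
  Tendsto (fun r => (g r : EReal)) (S.endFilter e) (𝓝 (⨅ r ∈ S.I, (g r : EReal)))

/-- The supremum of `g` over `(a, b)` (possibly `+∞`) is the limit of `g` at the end `e`. -/
def SupAtEnd (g : ℝ → ℝ) (e : EReal) : Prop :=
  Tendsto (fun r => (g r : EReal)) (S.endFilter e) (𝓝 (⨆ r ∈ S.I, (g r : EReal)))

end RevolutionSurface

/-- The profile of constant curvature `c`: `x`, `sin (√c x) / √c` or `sinh (√(-c) x) / √(-c)`
for `c = 0`, `c > 0` or `c < 0`. -/
def constCurvProfile (c x : ℝ) : ℝ :=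
  if c = 0 then x
  else if 0 < c then Real.sin (√c * x) / √c
  else Real.sinh (√(-c) * x) / √(-c)

end

/-! ### Auxiliary facts of real analysis -/

/-! Take `u = |θ|` as radial coordinate. The hypothesis on `f` gives `u' = ±(u² + c)` and `f² (u² +
c) = ξ²`, so the centrifugal term is quadratic in `u`. Up to a positive factor and a constant, the
effective potential at momentum `K` is `P(u) = ξ² u² / 2 + (ξ⁴ / K²) W(u)`, where `W` is the
potential as a function of `u`. With the angle as time the orbit equation becomes `d²u/dφ² =
-P'(u)`, Newton's equation on a line, as in Binet's treatment of the plane. A noncircular bounded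
orbit that is closed therefore has a `φ`-period commensurable with `2π`.

Closing forces the form `V_i`. The numbers commensurable with `2π` are countable, and a continuous
function on a connected set with countably many values is constant. This principle is applied twice
near a strongly stable circular orbit. Along neighbouring circular orbits the limit period `2π /
√P''` is constant; there `P'' = ξ² (1 - u W'' / W')`, so `W'` is locally a multiple of `u^(1 - q)`.
At fixed momentum the period is constant in the amplitude, so its second-order coefficient vanishes:
`3 P'' P'''' = 5 P'''²`. Together these give `(1 - q)(q - 4) = 0`, that is, `q = i²` with `i = 1, 2`
(`exists_local_power_law`). An open-closed argument spreads the law over the whole interval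
(`hasClosingForm_of_locallyClosing`).

It remains to find a strongly stable circular orbit under the other definitions. A closing potential
is semilocally closing. In the semilocal case the given noncircular orbit sweeps a well of `P`, and
the period of oscillations in the smaller wells is constant. It would diverge as the level falls to
the highest critical level inside, unless the wells shrink to a nondegenerate minimum
(`IsWell.exists_nondegenerate`). In the weak case, if no circular orbit were strongly stable, `W' /
u` would be nonincreasing, each circular orbit would sit at a global maximum of its `P`, and none
would be orbitally stable (`isLocallyClosing_of_weaklyClosing`).

Conversely, in the field of `V_i` the function `u^i` is a harmonic oscillator in `φ` of frequency
`iξ` (`exists_harmonic`). Hence `r` has `φ`-period `2π / (iξ)`, and all nonsingular bounded orbits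
close because `ξ` is rational. -/

theorem IsPreconnected.eq_of_countable_image {X : Type*} [TopologicalSpace X] {s : Set X}
    (hs : IsPreconnected s) {g : X → ℝ} (hg : ContinuousOn g s) {D : Set ℝ} (hD : D.Countable)
    (hgD : ∀ x ∈ s, g x ∈ D) {x y : X} (hx : x ∈ s) (hy : y ∈ s) : g x = g y :=
  hD.isTotallyDisconnected (g '' s) (by rintro _ ⟨z, hz, rfl⟩; exact hgD z hz)
    (hs.image g hg) ⟨x, hx, rfl⟩ ⟨y, hy, rfl⟩

/-- Differentiation under the integral turns the weight `w t` into `w t * t` and `p` into `p'`.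
Keeping the weight arbitrary lets the induction close. -/
theorem contDiff_integral_comp_mul (n : ℕ) : ∀ (w p : ℝ → ℝ), Continuous w → ContDiff ℝ ∞ p →
    ContDiff ℝ n (fun x => ∫ t in (0:ℝ)..1, w t * p (t * x)) := by
  induction n with
  | zero =>
    intro w p hw hp
    simp only [Nat.cast_zero, contDiff_zero]
    have := hp.continuous
    apply intervalIntegral.continuous_parametric_intervalIntegral_of_continuous'
    fun_prop
  | succ n ih =>
    intro w p hw hp
    have hpc := hp.continuous
    have hp' : ContDiff ℝ ∞ (deriv p) := (contDiff_infty_iff_deriv.1 hp).2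
    have hpc' := hp'.continuous
    have key : ∀ x, HasDerivAt (fun x => ∫ t in (0:ℝ)..1, w t * p (t * x))
        (∫ t in (0:ℝ)..1, (w t * t) * deriv p (t * x)) x := by
      intro x
      obtain ⟨M, hM⟩ := (((isCompact_Icc (a := (0:ℝ)) (b := 1)).prod
        (isCompact_closedBall x 1)).bddAbove_image
        (f := fun z : ℝ × ℝ => |(w z.1 * z.1) * deriv p (z.1 * z.2)|)
        (Continuous.continuousOn (by fun_prop)))
      refine (intervalIntegral.hasDerivAt_integral_of_dominated_loc_of_deriv_le
        (F := fun x t => w t * p (t * x)) (F' := fun x t => (w t * t) * deriv p (t * x))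
        (bound := fun _ => M) (Metric.closedBall_mem_nhds x one_pos) ?_ ?_ ?_ ?_ ?_ ?_).2
      · exact Eventually.of_forall fun y =>
          (Continuous.aestronglyMeasurable (by fun_prop))
      · exact Continuous.intervalIntegrable (by fun_prop) _ _
      · exact Continuous.aestronglyMeasurable (by fun_prop)
      · refine Eventually.of_forall fun t ht y hy => ?_
        rw [Set.uIoc_of_le zero_le_one] at ht
        exact hM ⟨(t, y), ⟨⟨ht.1.le, ht.2⟩, hy⟩, rfl⟩
      · exact intervalIntegrable_const
      · refine Eventually.of_forall fun t _ y _ => ?_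
        have h1 : HasDerivAt p (deriv p (t * y)) (t * y) :=
          (hp.differentiable (by simp)).differentiableAt.hasDerivAt
        have h2 : HasDerivAt (fun y => t * y) t y := by
          simpa using (hasDerivAt_id y).const_mul t
        exact ((h1.comp y h2).const_mul (w t)).congr_deriv (by ring)
    rw [show ((n + 1 : ℕ) : ℕ∞ω) = (n : ℕ∞ω) + 1 by norm_cast, contDiff_succ_iff_deriv]
    refine ⟨fun x => (key x).differentiableAt, by simp, ?_⟩
    rw [show deriv (fun x => ∫ t in (0:ℝ)..1, w t * p (t * x)) =
      fun x => ∫ t in (0:ℝ)..1, (w t * t) * deriv p (t * x) from funext fun x => (key x).deriv]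
    exact ih _ _ (by fun_prop) hp'

/-- Hadamard's lemma. -/
theorem exists_contDiff_eq_mul {p : ℝ → ℝ} (hp : ContDiff ℝ ∞ p) (hp0 : p 0 = 0) :
    ∃ q : ℝ → ℝ, ContDiff ℝ ∞ q ∧ ∀ x, p x = x * q x := by
  have hp' : ContDiff ℝ ∞ (deriv p) := (contDiff_infty_iff_deriv.1 hp).2
  refine ⟨fun x => ∫ t in (0:ℝ)..1, 1 * deriv p (t * x),
    contDiff_infty.2 fun n => contDiff_integral_comp_mul n (fun _ => 1) _ continuous_const hp', ?_⟩
  intro x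
  have hd : ∀ y, HasDerivAt p (deriv p y) y := fun y =>
    (hp.differentiable (by simp)).differentiableAt.hasDerivAt
  have h1 : ∫ t in (0:ℝ)..1, deriv p (t * x) * x = p (1 * x) - p (0 * x) := by
    apply intervalIntegral.integral_eq_sub_of_hasDerivAt (f := fun t => p (t * x))
    · intro t _
      have h2 : HasDerivAt (fun t => t * x) x t := by simpa using (hasDerivAt_id t).mul_const x
      exact (hd (t * x)).comp t h2
    · have := hp'.continuous
      exact Continuous.intervalIntegrable (by fun_prop) _ _
  rw [intervalIntegral.integral_mul_const] at h1
  simp only [one_mul, zero_mul, hp0, sub_zero] at h1 ⊢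
  linarith

/-- Multiplication by a bump function. It lets Hadamard's lemma, stated for functions smooth on the
whole line, be applied to a germ. -/
theorem ContDiffOn.exists_contDiff_eventuallyEq {P : ℝ → ℝ} {J : Set ℝ} (hJ : IsOpen J)
    (hP : ContDiffOn ℝ ∞ P J) {x : ℝ} (hx : x ∈ J) :
    ∃ Q : ℝ → ℝ, ContDiff ℝ ∞ Q ∧ Q =ᶠ[𝓝 x] P := by
  obtain ⟨ε, hε, hεJ⟩ := Metric.isOpen_iff.1 hJ x hx
  let χ : ContDiffBump x := ⟨ε / 4, ε / 2, by positivity, by linarith⟩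
  refine ⟨fun y => χ y * P y, ?_, ?_⟩
  · rw [contDiff_iff_contDiffAt]
    intro y
    by_cases hy : y ∈ Metric.ball x ε
    · exact (χ.contDiff.contDiffAt).mul (hP.contDiffAt (hJ.mem_nhds (hεJ hy)))
    · have : (fun y => χ y * P y) =ᶠ[𝓝 y] fun _ => 0 := by
        have hy2 : y ∈ (Metric.closedBall x (ε / 2))ᶜ := by
          simp only [Set.mem_compl_iff, Metric.mem_closedBall, Metric.mem_ball] at hy ⊢
          linarith
        filter_upwards [Metric.isClosed_closedBall.isOpen_compl.mem_nhds hy2] with z hz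
        rw [χ.zero_of_le_dist, zero_mul]
        simp only [Set.mem_compl_iff, Metric.mem_closedBall, not_le] at hz
        exact hz.le
      exact contDiffAt_const.congr_of_eventuallyEq this
  · filter_upwards [χ.eventuallyEq_one] with y hy
    simp [hy]

/-- The Taylor expansion of `g` at `0` gives `2π g(0) + (π / 2) g₂ h² + o(h²)` for the integral,
since `sin` has mean zero and `sin²` integrates to `π`. In the application `g` is the derivative of
an inverse Morse coordinate and the integral is the period at amplitude `h`. -/
theorem hasDerivAt_quadratic_integral_sin {g g₁ : ℝ → ℝ} {h₀ g₂ c : ℝ} (hh₀ : 0 < h₀)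
    (hg : ∀ x, |x| < h₀ → HasDerivAt g (g₁ x) x) (hg₁ : HasDerivAt g₁ g₂ 0)
    (hc : ∀ h, 0 < h → h < h₀ → ∫ τ in (0:ℝ)..(2 * Real.pi), g (h * Real.sin τ) = c) :
    c = 2 * Real.pi * g 0 ∧ g₂ = 0 := by
  have est : ∀ ε > 0, ∃ δ > 0, ∀ x, |x| < δ →
      |g x - g 0 - g₁ 0 * x - g₂ / 2 * x ^ 2| ≤ ε * x ^ 2 := by
    intro ε hε
    have h1 := (hasDerivAt_iff_isLittleO.1 hg₁).def hε
    obtain ⟨δ, hδ, hδ2⟩ := Metric.eventually_nhds_iff.1 h1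
    refine ⟨min δ h₀, lt_min hδ hh₀, fun x hx => ?_⟩
    have hmv := (convex_uIcc (0:ℝ) x).norm_image_sub_le_of_norm_hasDerivWithin_le
      (f := fun x => g x - g 0 - g₁ 0 * x - g₂ / 2 * x ^ 2)
      (f' := fun x => g₁ x - g₁ 0 - g₂ * x) (C := ε * |x|) (x := 0) (y := x) ?_ ?_
      (by simp) (by simp)
    · simp only [Real.norm_eq_abs, sub_zero, mul_zero, sub_self] at hmv
      norm_num at hmv
      calc _ ≤ _ := hmv
        _ = ε * x ^ 2 := by rw [mul_assoc, ← sq, sq_abs]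
    · intro y hy
      have hyx : |y| ≤ |x| := by simpa using Set.abs_sub_left_of_mem_uIcc hy
      have hyh : |y| < h₀ := hyx.trans_lt (hx.trans_le (min_le_right _ _))
      exact ((((hg y hyh).sub_const (g 0)).sub ((hasDerivAt_id y).const_mul (g₁ 0))).sub
        ((hasDerivAt_pow 2 y).const_mul (g₂ / 2))).congr_deriv
        (by simp; ring) |>.hasDerivWithinAt
    · intro y hy
      have hyx : |y| ≤ |x| := by simpa using Set.abs_sub_left_of_mem_uIcc hy
      have := hδ2 (y := y) (by
        rw [Real.dist_eq, sub_zero]; exact hyx.trans_lt (hx.trans_le (min_le_left _ _)))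
      simp only [sub_zero, smul_eq_mul, Real.norm_eq_abs] at this ⊢
      rw [mul_comm g₂ y]
      exact this.trans (mul_le_mul_of_nonneg_left hyx hε.le)
  have hs1 : ∫ τ in (0:ℝ)..(2 * Real.pi), Real.sin τ = 0 := by simp
  have hs2 : ∫ τ in (0:ℝ)..(2 * Real.pi), Real.sin τ ^ 2 = Real.pi := by
    rw [integral_sin_sq]; simp
  have main : ∀ ε > 0, ∃ δ > 0, ∀ h, 0 < h → h < δ →
      |c - 2 * Real.pi * g 0 - g₂ / 2 * Real.pi * h ^ 2| ≤ ε * h ^ 2 * (2 * Real.pi) := by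
    intro ε hε
    obtain ⟨δ, hδ, hδ2⟩ := est ε hε
    refine ⟨min δ h₀, lt_min hδ hh₀, fun h h0 hh => ?_⟩
    have hsin : ∀ τ, |h * Real.sin τ| ≤ h := fun τ => by
      rw [abs_mul, abs_of_pos h0]
      exact mul_le_of_le_one_right h0.le (Real.abs_sin_le_one τ)
    have hcont : Continuous fun τ => g (h * Real.sin τ) := by
      rw [continuous_iff_continuousAt]
      intro τ
      have h1 : ContinuousAt g (h * Real.sin τ) :=
        (hg _ ((hsin τ).trans_lt (hh.trans_le (min_le_right _ _)))).continuousAt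
      exact ContinuousAt.comp (f := fun τ => h * Real.sin τ) h1
        (Continuous.continuousAt (by fun_prop))
    have h2 := intervalIntegral.norm_integral_le_of_norm_le_const (a := 0) (b := 2 * Real.pi)
      (C := ε * h ^ 2)
      (f := fun τ => g (h * Real.sin τ) - g 0 - g₁ 0 * (h * Real.sin τ)
        - g₂ / 2 * (h * Real.sin τ) ^ 2) (fun τ _ => ?_)
    · have h3 : ∫ τ in (0:ℝ)..(2 * Real.pi), (g (h * Real.sin τ) - g 0
          - g₁ 0 * (h * Real.sin τ) - g₂ / 2 * (h * Real.sin τ) ^ 2)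
          = c - 2 * Real.pi * g 0 - g₂ / 2 * Real.pi * h ^ 2 := by
        rw [intervalIntegral.integral_sub, intervalIntegral.integral_sub,
          intervalIntegral.integral_sub, hc h h0 (hh.trans_le (min_le_right _ _))]
        · simp only [mul_pow, intervalIntegral.integral_const_mul, hs1, hs2,
            intervalIntegral.integral_const, smul_eq_mul]
          ring
        all_goals first
          | exact hcont.intervalIntegrable _ _
          | exact (hcont.sub continuous_const).intervalIntegrable _ _
          | exact ((hcont.sub continuous_const).sub (by fun_prop)).intervalIntegrable _ _
          | exact Continuous.intervalIntegrable (by fun_prop) _ _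
      rw [h3, sub_zero, abs_of_pos Real.two_pi_pos] at h2
      exact h2
    · refine (hδ2 _ ((hsin τ).trans_lt (hh.trans_le (min_le_left _ _)))).trans ?_
      refine mul_le_mul_of_nonneg_left ?_ hε.le
      rw [← sq_abs]
      exact pow_le_pow_left₀ (abs_nonneg _) (hsin τ) 2
  have hpi := Real.pi_pos
  have hc0 : c - 2 * Real.pi * g 0 = 0 := by
    obtain ⟨δ, hδ, h1⟩ := main 1 one_pos
    have lim : Tendsto (fun h : ℝ => |c - 2 * Real.pi * g 0 - g₂ / 2 * Real.pi * h ^ 2|)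
        (𝓝[>] 0) (𝓝 |c - 2 * Real.pi * g 0 - g₂ / 2 * Real.pi * 0 ^ 2|) :=
      (Continuous.tendsto (by fun_prop) 0).mono_left nhdsWithin_le_nhds
    have lim2 : Tendsto (fun h : ℝ => 1 * h ^ 2 * (2 * Real.pi)) (𝓝[>] 0)
        (𝓝 (1 * 0 ^ 2 * (2 * Real.pi))) :=
      (Continuous.tendsto (by fun_prop) 0).mono_left nhdsWithin_le_nhds
    have := le_of_tendsto_of_tendsto lim lim2 (by
      filter_upwards [Ioo_mem_nhdsGT hδ] with h hh using h1 h hh.1 hh.2)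
    simpa using this
  refine ⟨by linarith, ?_⟩
  by_contra hne
  have hpos : 0 < |g₂| := abs_pos.2 hne
  -- With this choice the error term is half of the quadratic term that it would have to dominate.
  obtain ⟨δ, hδ, h1⟩ := main (|g₂| / 8) (by positivity)
  have h2 := h1 (δ / 2) (by positivity) (by linarith)
  rw [hc0, zero_sub, abs_neg, abs_mul, abs_mul, abs_div, abs_of_pos hpi,
    abs_of_pos (a := (δ / 2) ^ 2) (by positivity), abs_of_pos (a := (2:ℝ)) (by norm_num)] at h2
  have : 0 < |g₂| * Real.pi * (δ / 2) ^ 2 := by positivity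
  nlinarith

/-- Near a nondegenerate critical point, `P` is the sum of a constant and `s² / 2` for a local
coordinate `s`. -/
theorem exists_morse_coordinate {P : ℝ → ℝ} {J : Set ℝ} (hJ : IsOpen J)
    (hP : ContDiffOn ℝ ∞ P J) {x₀ : ℝ} (hx : x₀ ∈ J) (h1 : deriv P x₀ = 0)
    (h2 : 0 < deriv (deriv P) x₀) :
    ∃ s : ℝ → ℝ, ContDiffAt ℝ ∞ s x₀ ∧ s x₀ = 0 ∧ 0 < deriv s x₀ ∧
      ∀ᶠ x in 𝓝 x₀, P x = P x₀ + s x ^ 2 / 2 := by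
  obtain ⟨Q, hQ, hQP⟩ := hP.exists_contDiff_eventuallyEq hJ hx
  have hQ0 : Q x₀ = P x₀ := hQP.eq_of_nhds
  have hQ1 : deriv Q x₀ = 0 := by rw [hQP.deriv_eq, h1]
  have hQ2 : 0 < deriv (deriv Q) x₀ := by rwa [hQP.deriv.deriv_eq]
  -- Hadamard's lemma is used twice to write the difference as `x² k(x)` with `2 k(0) = Q''(x₀) >
  -- 0`. Then `s = x √(2k)` is the coordinate.
  obtain ⟨q, hq, hpq⟩ := exists_contDiff_eq_mul (p := fun x => Q (x₀ + x) - Q x₀)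
    (by fun_prop) (by simp)
  have hqd : Differentiable ℝ q := hq.differentiable (by simp)
  have dq : ∀ x, HasDerivAt (fun x => Q (x₀ + x) - Q x₀) (q x + x * deriv q x) x := by
    intro x
    rw [show (fun x => Q (x₀ + x) - Q x₀) = fun x => x * q x from funext hpq]
    exact ((hasDerivAt_id x).mul (hqd x).hasDerivAt).congr_deriv (by simp)
  have dQ : ∀ x, deriv Q (x₀ + x) = q x + x * deriv q x := by
    intro x
    have := (hQ.differentiable (by simp) (x₀ + x)).hasDerivAt.comp_const_add x₀ x
    exact (this.sub_const (Q x₀)).unique (dq x)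
  have hq0 : q 0 = 0 := by simpa [hQ1] using (dQ 0).symm
  obtain ⟨k, hk, hqk⟩ := exists_contDiff_eq_mul hq hq0
  have hkd : Differentiable ℝ k := hk.differentiable (by simp)
  have hk' : Differentiable ℝ (deriv k) :=
    (contDiff_infty_iff_deriv.1 hk).2.differentiable (by simp)
  have dq' : ∀ x, deriv q x = k x + x * deriv k x := by
    intro x
    rw [show q = fun x => x * k x from funext hqk]
    exact (((hasDerivAt_id x).mul (hkd x).hasDerivAt).congr_deriv (by simp)).deriv
  have hk0 : deriv (deriv Q) x₀ = 2 * k 0 := by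
    have e1 : (fun x => deriv Q (x₀ + x)) = fun x => 2 * x * k x + x ^ 2 * deriv k x := by
      funext x
      rw [dQ, dq', hqk]; ring
    have d1 : HasDerivAt (fun x => 2 * x * k x + x ^ 2 * deriv k x) (2 * k 0) 0 :=
      ((((hasDerivAt_id (0:ℝ)).const_mul 2).mul (hkd 0).hasDerivAt).add
        ((hasDerivAt_pow 2 (0:ℝ)).mul (hk' 0).hasDerivAt)).congr_deriv (by simp)
    rw [← e1] at d1
    have d2 := deriv_comp_const_add (f := deriv Q) x₀ 0
    rw [add_zero] at d2
    rw [← d2, d1.deriv]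
  have hk00 : 0 < k 0 := by linarith
  have sm : ContDiffAt ℝ ∞ (fun x => √(2 * k (x - x₀))) x₀ :=
    ContDiffAt.sqrt (by fun_prop) (by simpa using hk00.ne')
  refine ⟨fun x => (x - x₀) * √(2 * k (x - x₀)), ?_, by simp, ?_, ?_⟩
  · exact ContDiffAt.mul (by fun_prop) sm
  · have h3 := ((hasDerivAt_id x₀).sub_const x₀).mul
      (sm.differentiableAt (by simp)).hasDerivAt
    have h4 : deriv (fun x => (x - x₀) * √(2 * k (x - x₀))) x₀ = √(2 * k 0) := by
      refine (h3.congr_deriv ?_).deriv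
      simp
    rw [h4]; positivity
  · have hcont : ContinuousAt (fun x => k (x - x₀)) x₀ :=
      Continuous.continuousAt (by have := hk.continuous; fun_prop)
    have hpos : ∀ᶠ x in 𝓝 x₀, 0 < k (x - x₀) :=
      hcont.eventually (lt_mem_nhds (by simpa using hk00))
    filter_upwards [hpos, hQP] with x hx1 hx2
    rw [mul_pow, Real.sq_sqrt (by positivity), ← hx2, ← hQ0]
    have h5 := hpq (x - x₀)
    rw [hqk] at h5
    simp only [add_sub_cancel] at h5
    linarith

theorem ContDiffAt.deriv_infty {s : ℝ → ℝ} {x : ℝ} (h : ContDiffAt ℝ ∞ s x) :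
    ContDiffAt ℝ ∞ (deriv s) x :=
  (h.fderiv_right (m := ∞) (by simp)).clm_apply contDiffAt_const

theorem ContDiffAt.eventually_hasDerivAt {s : ℝ → ℝ} {x : ℝ} (h : ContDiffAt ℝ ∞ s x) :
    ∀ᶠ y in 𝓝 x, HasDerivAt s (deriv s y) y := by
  filter_upwards [(h.of_le (m := 1) (by exact_mod_cast le_top)).eventually (by simp)] with y hy
  exact (hy.differentiableAt (by simp)).hasDerivAt

/-- The inverse of a Morse coordinate, with the relation between its third derivative and the
derivatives of `P`. -/
theorem exists_morse_inverse {P : ℝ → ℝ} {J : Set ℝ} (hJ : IsOpen J)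
    (hP : ContDiffOn ℝ ∞ P J) {x₀ : ℝ} (hx : x₀ ∈ J) (h1 : deriv P x₀ = 0)
    (h2 : 0 < deriv (deriv P) x₀) {N : Set ℝ} (hN : N ∈ 𝓝 x₀) :
    ∃ (y g g₁ : ℝ → ℝ) (g₂ h₀ : ℝ), 0 < h₀ ∧ y 0 = x₀ ∧
      (∀ x, |x| < h₀ → y x ∈ N ∧ HasDerivAt y (g x) x ∧ 0 < g x ∧ HasDerivAt g (g₁ x) x ∧
        P (y x) = P x₀ + x ^ 2 / 2 ∧ deriv P (y x) * g x = x) ∧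
      HasDerivAt g₁ g₂ 0 ∧ g 0 ^ 2 * deriv (deriv P) x₀ = 1 ∧
      (g₂ = 0 → 3 * deriv (deriv P) x₀ * deriv (deriv (deriv (deriv P))) x₀ =
        5 * deriv (deriv (deriv P)) x₀ ^ 2) := by
  obtain ⟨s, hs, hs0, hs1, hPs⟩ := exists_morse_coordinate hJ hP hx h1 h2
  have e0 := hs.eventually_hasDerivAt
  have e1 := hs.deriv_infty.eventually_hasDerivAt
  have e2 := hs.deriv_infty.deriv_infty.eventually_hasDerivAt
  have e3 := hs.deriv_infty.deriv_infty.deriv_infty.eventually_hasDerivAt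
  have epos : ∀ᶠ x in 𝓝 x₀, 0 < deriv s x :=
    hs.deriv_infty.continuousAt.eventually (lt_mem_nhds hs1)
  -- derivatives of `P`
  have p1 : deriv P =ᶠ[𝓝 x₀] fun x => s x * deriv s x := by
    have : deriv P =ᶠ[𝓝 x₀] deriv (fun x => P x₀ + s x ^ 2 / 2) := EventuallyEq.deriv hPs
    filter_upwards [this, e0] with x hx hx0
    rw [hx]
    exact (((hx0.pow 2).div_const 2).const_add (P x₀)).congr_deriv (by simp; ring) |>.deriv
  have p2 : deriv (deriv P) =ᶠ[𝓝 x₀] fun x => deriv s x ^ 2 + s x * deriv (deriv s) x := by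
    filter_upwards [p1.deriv, e0, e1] with x hx hx0 hx1
    rw [hx]
    exact (hx0.mul hx1).congr_deriv (by ring) |>.deriv
  have p3 : deriv (deriv (deriv P)) =ᶠ[𝓝 x₀]
      fun x => 3 * deriv s x * deriv (deriv s) x + s x * deriv (deriv (deriv s)) x := by
    filter_upwards [p2.deriv, e0, e1, e2] with x hx hx0 hx1 hx2
    rw [hx]
    exact ((hx1.pow 2).add (hx0.mul hx2)).congr_deriv (by simp; ring) |>.deriv
  have p4 : deriv (deriv (deriv (deriv P))) x₀ =
      3 * deriv (deriv s) x₀ ^ 2 + 4 * deriv s x₀ * deriv (deriv (deriv s)) x₀ := by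
    rw [p3.deriv.eq_of_nhds]
    exact (((e1.self_of_nhds.const_mul 3).mul e2.self_of_nhds).add
      (e0.self_of_nhds.mul e3.self_of_nhds)).congr_deriv (by rw [hs0]; ring) |>.deriv
  -- the inverse
  have hsd : HasFDerivAt s
      ((ContinuousLinearEquiv.unitsEquivAut ℝ (Units.mk0 _ hs1.ne') : ℝ ≃L[ℝ] ℝ) : ℝ →L[ℝ] ℝ) x₀ :=
    e0.self_of_nhds.hasFDerivAt_equiv hs1.ne'
  let e := hs.toOpenPartialHomeomorph s hsd (by simp)
  have es : (e : ℝ → ℝ) = s := rfl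
  have hx₀ : x₀ ∈ e.source := hs.mem_toOpenPartialHomeomorph_source hsd (by simp)
  have h0t : (0:ℝ) ∈ e.target := by
    have := e.map_source hx₀; rwa [es, hs0] at this
  have hy0 : e.symm 0 = x₀ := by
    have := e.left_inv hx₀; rwa [es, hs0] at this
  have hyc : ContinuousAt e.symm 0 := e.symm.continuousAt h0t
  have all : ∀ᶠ x in 𝓝 (0:ℝ), x ∈ e.target ∧ e.symm x ∈ N ∧
      HasDerivAt s (deriv s (e.symm x)) (e.symm x) ∧
      HasDerivAt (deriv s) (deriv (deriv s) (e.symm x)) (e.symm x) ∧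
      0 < deriv s (e.symm x) ∧ P (e.symm x) = P x₀ + s (e.symm x) ^ 2 / 2 ∧
      deriv P (e.symm x) = s (e.symm x) * deriv s (e.symm x) := by
    have h3 : ∀ᶠ z in 𝓝 (e.symm 0), z ∈ N ∧ HasDerivAt s (deriv s z) z ∧
      HasDerivAt (deriv s) (deriv (deriv s) z) z ∧ 0 < deriv s z ∧ P z = P x₀ + s z ^ 2 / 2 ∧
      deriv P z = s z * deriv s z := by
      rw [hy0]
      filter_upwards [hN, e0, e1, epos, hPs, p1] with z a b c d f g using ⟨a, b, c, d, f, g⟩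
    filter_upwards [e.open_target.mem_nhds h0t, hyc.eventually h3] with z a b using ⟨a, b⟩
  obtain ⟨h₀, hh₀, hall⟩ := Metric.eventually_nhds_iff.1 all
  have dy : ∀ x, |x| < h₀ → HasDerivAt e.symm (deriv s (e.symm x))⁻¹ x := by
    intro x hx
    obtain ⟨a, -, b, -, d, -⟩ := hall (y := x) (by simpa using hx)
    exact e.hasDerivAt_symm a d.ne' b
  -- These are the derivatives of the inverse `y` of `s`: `y' = 1 / s'`, `y'' = -s'' / s'³`, and
  -- `y'''(0) = 3 s''² / s'⁵ - s''' / s'⁴`.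
  refine ⟨e.symm, fun x => (deriv s (e.symm x))⁻¹,
    fun x => -deriv (deriv s) (e.symm x) * ((deriv s (e.symm x)) ^ 3)⁻¹,
    3 * deriv (deriv s) x₀ ^ 2 / deriv s x₀ ^ 5 - deriv (deriv (deriv s)) x₀ / deriv s x₀ ^ 4,
    h₀, hh₀, hy0, ?_, ?_, ?_, ?_⟩
  · intro x hx
    obtain ⟨a, b, c, d, f, i, j⟩ := hall (y := x) (by simpa using hx)
    have hsx : s (e.symm x) = x := e.right_inv a
    refine ⟨b, dy x hx, by positivity, ?_, ?_, ?_⟩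
    · exact ((d.comp x (dy x hx)).inv f.ne').congr_deriv
        (by simp only [Function.comp_apply]; field_simp)
    · rw [i, hsx]
    · rw [j, hsx]; field_simp
  · have d0 := dy 0 (by simpa using hh₀)
    have b1 := (e2.self_of_nhds.congr_of_eventuallyEq EventuallyEq.rfl)
    rw [← hy0] at b1
    have b2 := e1.self_of_nhds
    rw [← hy0] at b2
    have hne : deriv s (e.symm 0) ≠ 0 := by rw [hy0]; exact hs1.ne'
    refine ((b1.comp 0 d0).neg.mul (((b2.comp 0 d0).pow 3).inv (pow_ne_zero 3 hne))).congr_deriv ?_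
    simp only [Function.comp_apply, Pi.neg_apply, Pi.pow_apply, Pi.inv_apply]
    rw [hy0]
    have := hs1.ne'
    field_simp
    ring
  · change (deriv s (e.symm 0))⁻¹ ^ 2 * _ = 1
    rw [hy0, p2.eq_of_nhds, hs0]
    have := hs1.ne'
    field_simp
    ring
  · intro h
    rw [p2.eq_of_nhds, p3.eq_of_nhds, p4, hs0]
    have hne := hs1.ne'
    -- At `x₀`, `P'' = s'²`, `P''' = 3 s' s''` and `P'''' = 3 s''² + 4 s' s'''`. With `s' s''' = 3
    -- s''²` both sides of the relation are `45 s'² s''²`.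
    have h5 : deriv (deriv (deriv s)) x₀ * deriv s x₀ = 3 * deriv (deriv s) x₀ ^ 2 := by
      field_simp at h
      linarith
    linear_combination 12 * deriv s x₀ ^ 2 * h5

/-! ### Second divided differences -/

/-- The second divided difference `P[α, β, x]` of a function with second derivative `p`. -/
noncomputable def dividedDiff (p : ℝ → ℝ) (α β x : ℝ) : ℝ :=
  ∫ t in (0:ℝ)..1, ∫ t' in (0:ℝ)..1, t * p (α + t * (β + t' * (x - β) - α))

/-- Continuity jointly in the end points is what makes the period depend continuously on the well.
-/
theorem continuous_dividedDiff {p : ℝ → ℝ} (hp : Continuous p) :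
    Continuous fun z : ℝ × ℝ × ℝ => dividedDiff p z.1 z.2.1 z.2.2 := by
  unfold dividedDiff
  apply intervalIntegral.continuous_parametric_intervalIntegral_of_continuous'
  apply intervalIntegral.continuous_parametric_intervalIntegral_of_continuous'
  fun_prop

/-- Newton's interpolation formula at `α, β`: since the two values agree, the linear interpolant is
constant and only the remainder is left. The integral form of the divided difference still makes
sense at `x = α` and `x = β`, the turning points of an oscillation. -/
theorem dividedDiff_spec {P P₁ p : ℝ → ℝ} {a b α β x : ℝ} (hp : Continuous p)
    (hα : α ∈ Set.Icc a b) (hβ : β ∈ Set.Icc a b) (hx : x ∈ Set.Icc a b) (hαβ : α ≠ β)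
    (hP : ∀ y ∈ Set.Icc a b, HasDerivAt P (P₁ y) y)
    (hP₁ : ∀ y ∈ Set.Icc a b, HasDerivAt P₁ (p y) y) (hE : P α = P β) :
    P α - P x = (x - α) * (β - x) * dividedDiff p α β x := by
  have hconv : Convex ℝ (Set.Icc a b) := convex_Icc a b
  have seg : ∀ {y z t : ℝ}, y ∈ Set.Icc a b → z ∈ Set.Icc a b → t ∈ Set.uIcc (0:ℝ) 1 →
      y + t * (z - y) ∈ Set.Icc a b := by
    intro y z t hy hz ht
    rw [Set.uIcc_of_le zero_le_one] at ht
    simpa using hconv.add_smul_sub_mem hy hz ht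
  have lin : ∀ y z t : ℝ, HasDerivAt (fun t => y + t * (z - y)) (z - y) t := fun y z t => by
    simpa using ((hasDerivAt_id t).mul_const (z - y)).const_add y
  have hP₁c : ContinuousOn P₁ (Set.Icc a b) := fun y hy => (hP₁ y hy).continuousAt.continuousWithinAt
  -- first divided difference
  have first : ∀ z ∈ Set.Icc a b,
      (∫ t in (0:ℝ)..1, P₁ (α + t * (z - α))) * (z - α) = P z - P α := by
    intro z hz
    rw [← intervalIntegral.integral_mul_const]
    have := intervalIntegral.integral_eq_sub_of_hasDerivAt (a := 0) (b := 1)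
      (f := fun t => P (α + t * (z - α))) (f' := fun t => P₁ (α + t * (z - α)) * (z - α))
      (fun t ht => (hP _ (seg hα hz ht)).comp t (lin α z t)) ?_
    · rw [this]; simp
    · apply ContinuousOn.intervalIntegrable
      exact (hP₁c.comp (Continuous.continuousOn (by fun_prop))
        (fun t ht => seg hα hz ht)).mul continuousOn_const
  have second : ∀ t ∈ Set.uIcc (0:ℝ) 1,
      (∫ t' in (0:ℝ)..1, t * p (α + t * (β + t' * (x - β) - α))) * (x - β) =
        P₁ (α + t * (x - α)) - P₁ (α + t * (β - α)) := by
    intro t ht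
    rw [← intervalIntegral.integral_mul_const]
    have := intervalIntegral.integral_eq_sub_of_hasDerivAt (a := 0) (b := 1)
      (f := fun t' => P₁ (α + t * (β + t' * (x - β) - α)))
      (f' := fun t' => t * p (α + t * (β + t' * (x - β) - α)) * (x - β))
      (fun t' ht' => ?_) ?_
    · rw [this]; simp
    · refine ((hP₁ _ (seg hα (seg hβ hx ht') ht)).comp t'
        ((((lin β x t').sub_const α).const_mul t).const_add α)).congr_deriv (by ring)
    · exact Continuous.intervalIntegrable (by fun_prop) _ _
  have hI : dividedDiff p α β x * (x - β) = (∫ t in (0:ℝ)..1, P₁ (α + t * (x - α))) -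
      ∫ t in (0:ℝ)..1, P₁ (α + t * (β - α)) := by
    unfold dividedDiff
    rw [← intervalIntegral.integral_mul_const, ← intervalIntegral.integral_sub]
    · exact intervalIntegral.integral_congr second
    · apply ContinuousOn.intervalIntegrable
      exact hP₁c.comp (Continuous.continuousOn (by fun_prop)) (fun t ht => seg hα hx ht)
    · apply ContinuousOn.intervalIntegrable
      exact hP₁c.comp (Continuous.continuousOn (by fun_prop)) (fun t ht => seg hα hβ ht)
  have h0 : ∫ t in (0:ℝ)..1, P₁ (α + t * (β - α)) = 0 := by
    have := first β hβ
    rw [hE, sub_self] at this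
    exact (mul_eq_zero.1 this).resolve_right (sub_ne_zero.2 hαβ.symm)
  rw [h0, sub_zero] at hI
  have := first x hx
  rw [← hI] at this
  linarith

namespace RevolutionSurface

/-! ### The coordinate `|θ|` -/

variable {S : RevolutionSurface}

theorem isOpen_I (S : RevolutionSurface) : IsOpen S.I :=
  isOpen_Ioo.preimage continuous_coe_real_ereal

theorem ordConnected_I (S : RevolutionSurface) : S.I.OrdConnected :=
  ⟨fun _ hx _ hy _ hz => ⟨hx.1.trans_le (EReal.coe_le_coe_iff.2 hz.1),
    (EReal.coe_le_coe_iff.2 hz.2).trans_lt hy.2⟩⟩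

theorem convex_I (S : RevolutionSurface) : Convex ℝ S.I := S.ordConnected_I.convex

theorem nonempty_I (S : RevolutionSurface) : S.I.Nonempty := by
  obtain ⟨r, h1, h2⟩ := EReal.lt_iff_exists_real_btwn.1 S.a_lt_b
  exact ⟨r, h1, h2⟩

theorem f_pos' {r : ℝ} (hr : r ∈ S.I) : 0 < S.f r := S.f_pos r hr.1 hr.2

theorem f_contDiffAt {r : ℝ} (hr : r ∈ S.I) : ContDiffAt ℝ ∞ S.f r :=
  S.f_smooth.contDiffAt (S.isOpen_I.mem_nhds hr)

theorem hasDerivAt_f {r : ℝ} (hr : r ∈ S.I) : HasDerivAt S.f (deriv S.f r) r :=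
  (f_contDiffAt hr).eventually_hasDerivAt.self_of_nhds

theorem hasDerivAt_deriv_f {r : ℝ} (hr : r ∈ S.I) :
    HasDerivAt (deriv S.f) (deriv (deriv S.f) r) r :=
  (f_contDiffAt hr).deriv_infty.eventually_hasDerivAt.self_of_nhds

theorem θ_contDiffAt {r : ℝ} (hr : r ∈ S.I) : ContDiffAt ℝ ∞ S.θ r :=
  ((f_contDiffAt hr).deriv_infty.neg).div (f_contDiffAt hr) (f_pos' hr).ne'

/-- Differentiating `f'' f - f'² = -ξ²` gives `f''' f = f'' f'`, which says that `f'' / f` has zero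
derivative. -/
theorem exists_curvature_eq {ξ : ℝ}
    (hf : ∀ r ∈ S.I, deriv (deriv S.f) r * S.f r - (deriv S.f r) ^ 2 = -ξ ^ 2) :
    ∃ c : ℝ, ∀ r ∈ S.I, S.curvature r = c := by
  have key : ∀ r ∈ S.I, HasDerivAt S.curvature 0 r := by
    intro r hr
    have h0 := hasDerivAt_f hr
    have h1 := hasDerivAt_deriv_f hr
    have h2 := (f_contDiffAt hr).deriv_infty.deriv_infty.eventually_hasDerivAt.self_of_nhds
    have h3 : HasDerivAt (fun r => deriv (deriv S.f) r * S.f r - (deriv S.f r) ^ 2) 0 r :=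
      (hasDerivAt_const r (-ξ ^ 2)).congr_of_eventuallyEq
        (by filter_upwards [S.isOpen_I.mem_nhds hr] with x hx using hf x hx)
    have h4 := h3.unique ((h2.mul h0).sub (h1.pow 2))
    have hpos := (f_pos' hr).ne'
    refine (h2.neg.div h0 hpos).congr_deriv ?_
    simp only [Pi.neg_apply] at *
    rw [div_eq_zero_iff]
    left
    simp at h4
    linarith
  obtain ⟨c, hc⟩ := S.isOpen_I.exists_is_const_of_deriv_eq_zero (f := S.curvature)
    S.convex_I.isPreconnected
    (fun r hr => (key r hr).differentiableAt.differentiableWithinAt)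
    (fun r hr => (key r hr).deriv)
  exact ⟨c, hc⟩

theorem θ_sq_add {ξ c : ℝ}
    (hf : ∀ r ∈ S.I, deriv (deriv S.f) r * S.f r - (deriv S.f r) ^ 2 = -ξ ^ 2)
    (hc : ∀ r ∈ S.I, S.curvature r = c) {r : ℝ} (hr : r ∈ S.I) :
    S.f r ^ 2 * (S.θ r ^ 2 + c) = ξ ^ 2 := by
  have := (f_pos' hr).ne'
  rw [← hc r hr, curvature, θ]
  field_simp
  linarith [hf r hr]

theorem θ_pos_or_neg (hS : S.NoEquators) :
    (∀ r ∈ S.I, 0 < S.θ r) ∨ (∀ r ∈ S.I, S.θ r < 0) := by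
  have hne : ∀ r ∈ S.I, S.θ r ≠ 0 := fun r hr =>
    div_ne_zero (neg_ne_zero.2 (hS r hr)) (f_pos' hr).ne'
  have hcont : ContinuousOn S.θ S.I := fun r hr =>
    (θ_contDiffAt hr).continuousAt.continuousWithinAt
  by_contra! h
  obtain ⟨⟨r₁, h1, h1'⟩, r₂, h2, h2'⟩ := h
  obtain ⟨r, hr, hr0⟩ := S.convex_I.isPreconnected.intermediate_value h1 h2 hcont ⟨h1', h2'⟩
  exact hne r hr hr0

/-- On a surface without equators with `f f'' - f'² = -ξ²`, the function `|θ|` is a coordinate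
on the interval `(a, b)`. -/
structure Chart (S : RevolutionSurface) where
  ξ : ℝ
  c : ℝ
  s : ℝ
  ξ_pos : 0 < ξ
  s_mul_s : s * s = 1
  abs_θ : ∀ r ∈ S.I, |S.θ r| = s * S.θ r
  abs_θ_pos : ∀ r ∈ S.I, 0 < |S.θ r|
  f_sq_mul : ∀ r ∈ S.I, S.f r ^ 2 * (S.θ r ^ 2 + c) = ξ ^ 2
  curvature_eq : ∀ r ∈ S.I, S.curvature r = c

theorem exists_chart (hS : S.NoEquators) {ξ : ℝ} (hξ : 0 < ξ)
    (hf : ∀ r ∈ S.I, deriv (deriv S.f) r * S.f r - (deriv S.f r) ^ 2 = -ξ ^ 2) :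
    ∃ C : Chart S, C.ξ = ξ := by
  obtain ⟨c, hc⟩ := exists_curvature_eq hf
  obtain h | h := θ_pos_or_neg hS
  · exact ⟨⟨ξ, c, 1, hξ, by norm_num, fun r hr => by rw [one_mul, abs_of_pos (h r hr)],
      fun r hr => abs_pos.2 (h r hr).ne', fun r hr => θ_sq_add hf hc hr, hc⟩, rfl⟩
  · exact ⟨⟨ξ, c, -1, hξ, by norm_num, fun r hr => by rw [neg_one_mul, abs_of_neg (h r hr)],
      fun r hr => abs_pos.2 (h r hr).ne, fun r hr => θ_sq_add hf hc hr, hc⟩, rfl⟩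

namespace Chart

variable (C : Chart S)

/-- The coordinate `|θ|`. -/
noncomputable def u (_ : Chart S) (r : ℝ) : ℝ := |S.θ r|

/-- The range of the coordinate `|θ|`. -/
def J : Set ℝ := C.u '' S.I

/-- The inverse of the coordinate `|θ|`. -/
noncomputable def R : ℝ → ℝ := Function.invFunOn C.u S.I

variable {C} {r x : ℝ}

theorem s_ne : C.s ≠ 0 := fun h => by simpa [h] using C.s_mul_s

theorem u_sq (r : ℝ) : C.u r ^ 2 = S.θ r ^ 2 := sq_abs _

theorem u_pos (hr : r ∈ S.I) : 0 < C.u r := C.abs_θ_pos r hr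

theorem θ_eq (hr : r ∈ S.I) : S.θ r = C.s * C.u r := by
  rw [u, C.abs_θ r hr, ← mul_assoc, C.s_mul_s, one_mul]

theorem f_sq (hr : r ∈ S.I) : S.f r ^ 2 * (C.u r ^ 2 + C.c) = C.ξ ^ 2 := by
  rw [u_sq, C.f_sq_mul r hr]

theorem u_sq_add_pos (hr : r ∈ S.I) : 0 < C.u r ^ 2 + C.c := by
  have h1 := C.f_sq hr
  have h2 : 0 < S.f r ^ 2 := pow_pos (f_pos' hr) 2
  have h3 : 0 < S.f r ^ 2 * (C.u r ^ 2 + C.c) := by rw [h1]; exact pow_pos C.ξ_pos 2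
  exact (pos_iff_pos_of_mul_pos h3).1 h2

theorem deriv_f (hr : r ∈ S.I) : deriv S.f r = -(C.s * C.u r * S.f r) := by
  rw [← θ_eq hr, θ]
  have := (f_pos' hr).ne'
  field_simp

theorem u_contDiffAt (hr : r ∈ S.I) : ContDiffAt ℝ ∞ C.u r := by
  refine ((contDiffAt_const (c := C.s)).mul (θ_contDiffAt hr)).congr_of_eventuallyEq ?_
  filter_upwards [S.isOpen_I.mem_nhds hr] with x hx using C.abs_θ x hx

/-- The logarithmic derivative satisfies the Riccati equation `θ' = -f''/f + (f'/f)² = c + θ²`, and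
`s` is the constant sign of `θ`. -/
theorem hasDerivAt_u (hr : r ∈ S.I) : HasDerivAt C.u (C.s * (C.u r ^ 2 + C.c)) r := by
  have h1 : HasDerivAt (fun x => C.s * S.θ x) _ r :=
    (((hasDerivAt_deriv_f hr).neg.div (hasDerivAt_f hr) (f_pos' hr).ne')).const_mul C.s
  refine (h1.congr_of_eventuallyEq ?_).congr_deriv ?_
  · filter_upwards [S.isOpen_I.mem_nhds hr] with x hx using C.abs_θ x hx
  · rw [u_sq, ← C.curvature_eq r hr, θ, curvature]
    have := (f_pos' hr).ne'
    simp only [Pi.neg_apply]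
    field_simp
    ring

theorem strictMonoOn_s_mul_u (C : Chart S) : StrictMonoOn (fun r => C.s * C.u r) S.I := by
  refine strictMonoOn_of_deriv_pos S.convex_I
    (fun r hr => ((hasDerivAt_u hr).const_mul C.s).continuousAt.continuousWithinAt) ?_
  intro r hr
  have hr := interior_subset hr
  rw [((hasDerivAt_u hr).const_mul C.s).deriv, ← mul_assoc, C.s_mul_s, one_mul]
  exact u_sq_add_pos hr

theorem injOn_u (C : Chart S) : Set.InjOn C.u S.I := fun r hr r' hr' h =>
  C.strictMonoOn_s_mul_u.injOn hr hr' (by simp only [h])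

theorem u_mem (hr : r ∈ S.I) : C.u r ∈ C.J := ⟨r, hr, rfl⟩

theorem R_u (hr : r ∈ S.I) : C.R (C.u r) = r :=
  C.injOn_u.leftInvOn_invFunOn hr

theorem R_mem (hx : x ∈ C.J) : C.R x ∈ S.I := by
  obtain ⟨r, hr, rfl⟩ := hx
  rwa [R_u hr]

theorem u_R (hx : x ∈ C.J) : C.u (C.R x) = x := by
  obtain ⟨r, hr, rfl⟩ := hx
  rw [R_u hr]

theorem J_pos (hx : x ∈ C.J) : 0 < x := by
  rw [← u_R hx]; exact u_pos (R_mem hx)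

theorem sq_add_pos (hx : x ∈ C.J) : 0 < x ^ 2 + C.c := by
  have := u_sq_add_pos (C := C) (R_mem hx); rwa [u_R hx] at this

theorem continuousOn_u : ContinuousOn C.u S.I := fun _ hr =>
  (hasDerivAt_u hr).continuousAt.continuousWithinAt

theorem map_u_nhds (hr : r ∈ S.I) : map C.u (𝓝 r) = 𝓝 (C.u r) := by
  have h := (u_contDiffAt (C := C) hr).hasStrictDerivAt' (hasDerivAt_u hr) (by simp)
  exact h.map_nhds_eq (mul_ne_zero s_ne (u_sq_add_pos hr).ne')

theorem isOpen_J (C : Chart S) : IsOpen C.J := by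
  rw [isOpen_iff_mem_nhds]
  rintro _ ⟨r, hr, rfl⟩
  rw [← map_u_nhds hr]
  exact image_mem_map (S.isOpen_I.mem_nhds hr)

theorem isPreconnected_J (C : Chart S) : IsPreconnected C.J :=
  S.convex_I.isPreconnected.image _ continuousOn_u

theorem ordConnected_J (C : Chart S) : C.J.OrdConnected := C.isPreconnected_J.ordConnected

theorem convex_J (C : Chart S) : Convex ℝ C.J := C.ordConnected_J.convex

theorem continuousAt_R (hx : x ∈ C.J) : ContinuousAt C.R x := by
  obtain ⟨r, hr, rfl⟩ := hx
  rw [ContinuousAt, R_u hr, ← map_u_nhds hr, tendsto_map'_iff]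
  refine tendsto_id.congr' ?_
  filter_upwards [S.isOpen_I.mem_nhds hr] with y hy using (R_u hy).symm

theorem hasDerivAt_R (hx : x ∈ C.J) : HasDerivAt C.R (C.s / (x ^ 2 + C.c)) x := by
  have h := hasDerivAt_u (C := C) (R_mem hx)
  have hne : C.s * (C.u (C.R x) ^ 2 + C.c) ≠ 0 :=
    mul_ne_zero s_ne (u_sq_add_pos (R_mem hx)).ne'
  refine (h.of_local_left_inverse (continuousAt_R hx) hne ?_).congr_deriv ?_
  · filter_upwards [C.isOpen_J.mem_nhds hx] with y hy using u_R hy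
  · have h1 := (sq_add_pos hx).ne'
    have h2 := s_ne (C := C)
    have h3 := C.s_mul_s
    rw [u_R hx]
    field_simp
    linarith

theorem contDiffOn_R (C : Chart S) : ContDiffOn ℝ ∞ C.R C.J := by
  rw [contDiffOn_infty_iff_deriv_of_isOpen C.isOpen_J]
  refine ⟨fun x hx => (hasDerivAt_R hx).differentiableAt.differentiableWithinAt, ?_⟩
  refine ContDiffOn.congr (f := fun x => C.s / (x ^ 2 + C.c)) ?_
    (fun x hx => (hasDerivAt_R hx).deriv)
  exact ContDiffOn.div contDiffOn_const (by fun_prop) (fun x hx => (sq_add_pos hx).ne')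

/-- The potential as a function of `|θ|`. -/
noncomputable def W (C : Chart S) (V : ℝ → ℝ) (x : ℝ) : ℝ := V (C.R x)

/-- The potential of the motion `φ ↦ |θ|`, in which the angle plays the role of time. -/
noncomputable def P (C : Chart S) (V : ℝ → ℝ) (K : ℝ) (x : ℝ) : ℝ :=
  C.ξ ^ 2 / 2 * x ^ 2 + C.ξ ^ 4 / K ^ 2 * C.W V x

variable {V : ℝ → ℝ} {K : ℝ}

theorem W_contDiffOn (hV : S.IsPotential V) : ContDiffOn ℝ ∞ (C.W V) C.J :=
  ContDiffOn.comp hV C.contDiffOn_R fun _ hx => R_mem hx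

theorem W_contDiffAt (hV : S.IsPotential V) (hx : x ∈ C.J) : ContDiffAt ℝ ∞ (C.W V) x :=
  (W_contDiffOn hV).contDiffAt (C.isOpen_J.mem_nhds hx)

theorem V_contDiffAt (hV : S.IsPotential V) (hr : r ∈ S.I) : ContDiffAt ℝ ∞ V r :=
  ContDiffOn.contDiffAt hV (S.isOpen_I.mem_nhds hr)

theorem P_contDiffOn (hV : S.IsPotential V) : ContDiffOn ℝ ∞ (C.P V K) C.J :=
  ContDiffOn.add (by fun_prop) (contDiffOn_const.mul (W_contDiffOn hV))

theorem P_contDiffAt (hV : S.IsPotential V) (hx : x ∈ C.J) : ContDiffAt ℝ ∞ (C.P V K) x :=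
  (P_contDiffOn hV).contDiffAt (C.isOpen_J.mem_nhds hx)

theorem hasDerivAt_W (hV : S.IsPotential V) (hx : x ∈ C.J) :
    HasDerivAt (C.W V) (deriv (C.W V) x) x :=
  (W_contDiffAt hV hx).eventually_hasDerivAt.self_of_nhds

theorem hasDerivAt_deriv_W (hV : S.IsPotential V) (hx : x ∈ C.J) :
    HasDerivAt (deriv (C.W V)) (deriv (deriv (C.W V)) x) x :=
  (W_contDiffAt hV hx).deriv_infty.eventually_hasDerivAt.self_of_nhds

theorem hasDerivAt_P (hV : S.IsPotential V) (hx : x ∈ C.J) :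
    HasDerivAt (C.P V K) (deriv (C.P V K) x) x :=
  (P_contDiffAt hV hx).eventually_hasDerivAt.self_of_nhds

theorem hasDerivAt_deriv_P (hV : S.IsPotential V) (hx : x ∈ C.J) :
    HasDerivAt (deriv (C.P V K)) (deriv (deriv (C.P V K)) x) x :=
  (P_contDiffAt hV hx).deriv_infty.eventually_hasDerivAt.self_of_nhds

theorem deriv_P (hV : S.IsPotential V) (hx : x ∈ C.J) :
    deriv (C.P V K) x = C.ξ ^ 2 * x + C.ξ ^ 4 / K ^ 2 * deriv (C.W V) x :=
  (((hasDerivAt_pow 2 x).const_mul (C.ξ ^ 2 / 2)).add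
    ((hasDerivAt_W hV hx).const_mul (C.ξ ^ 4 / K ^ 2))).congr_deriv (by simp; ring) |>.deriv

theorem deriv_deriv_P (hV : S.IsPotential V) (hx : x ∈ C.J) :
    deriv (deriv (C.P V K)) x = C.ξ ^ 2 + C.ξ ^ 4 / K ^ 2 * deriv (deriv (C.W V)) x := by
  have h : deriv (C.P V K) =ᶠ[𝓝 x] fun x => C.ξ ^ 2 * x + C.ξ ^ 4 / K ^ 2 * deriv (C.W V) x := by
    filter_upwards [C.isOpen_J.mem_nhds hx] with y hy using deriv_P hV hy
  rw [h.deriv_eq]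
  exact (((hasDerivAt_id x).const_mul (C.ξ ^ 2)).add
    ((hasDerivAt_deriv_W hV hx).const_mul (C.ξ ^ 4 / K ^ 2))).congr_deriv (by simp) |>.deriv

theorem W_u (hr : r ∈ S.I) : C.W V (C.u r) = V r := by rw [W, R_u hr]

theorem deriv_V (hV : S.IsPotential V) (hr : r ∈ S.I) :
    deriv V r = deriv (C.W V) (C.u r) * (C.s * (C.u r ^ 2 + C.c)) := by
  have h := (hasDerivAt_W hV (u_mem (C := C) hr)).comp r (hasDerivAt_u hr)
  refine (h.congr_of_eventuallyEq ?_).deriv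
  filter_upwards [S.isOpen_I.mem_nhds hr] with y hy using (W_u hy).symm

/-- The radial force at momentum `K` in terms of the reduced potential. -/
theorem force_eq (hV : S.IsPotential V) (hr : r ∈ S.I) (hK : K ≠ 0) :
    S.f r * deriv S.f r * (K / S.f r ^ 2) ^ 2 - deriv V r =
      -(C.s * (C.u r ^ 2 + C.c) * K ^ 2 / C.ξ ^ 4 * deriv (C.P V K) (C.u r)) := by
  have h1 := f_sq (C := C) hr
  have h2 := (f_pos' hr).ne'
  have h3 := C.ξ_pos.ne'
  have h4 : S.f r * deriv S.f r * (K / S.f r ^ 2) ^ 2 =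
      -(C.s * (C.u r ^ 2 + C.c) * K ^ 2 / C.ξ ^ 2 * C.u r) := by
    rw [deriv_f (C := C) hr, ← h1]
    have := (u_sq_add_pos (C := C) hr).ne'
    field_simp
  rw [deriv_V (C := C) hV hr, deriv_P hV (u_mem hr), h4]
  field_simp
  ring

/-- The angular velocity. -/
theorem div_f_sq (hr : r ∈ S.I) : K / S.f r ^ 2 = K * (C.u r ^ 2 + C.c) / C.ξ ^ 2 := by
  have h1 := f_sq (C := C) hr
  have h2 := (f_pos' hr).ne'
  have h3 := C.ξ_pos.ne'
  have := (u_sq_add_pos (C := C) hr).ne'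
  rw [← h1]
  field_simp

end Chart

end RevolutionSurface

/-! ### Motions obtained from solutions of the reduced equation -/

theorem exists_inverse_of_deriv_ge {f f' : ℝ → ℝ} {m : ℝ} (hm : 0 < m)
    (hf : ∀ x, HasDerivAt f (f' x) x) (hf' : ∀ x, m ≤ f' x) :
    ∃ g : ℝ → ℝ, StrictMono g ∧ Continuous g ∧ (∀ t, f (g t) = t) ∧ (∀ x, g (f x) = x) ∧
      ∀ t, HasDerivAt g (f' (g t))⁻¹ t := by
  have hmono : StrictMono f := strictMono_of_deriv_pos fun x => by
    rw [(hf x).deriv]; exact hm.trans_le (hf' x)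
  have hcont : Continuous f := continuous_iff_continuousAt.2 fun x => (hf x).continuousAt
  -- Comparison with a line of slope `m` makes `f` tend to `±∞`, hence surjective.
  have hlin : Monotone fun x => f x - m * x := by
    have hd : ∀ x, HasDerivAt (fun x => f x - m * x) (f' x - m) x := fun x =>
      ((hf x).sub ((hasDerivAt_id x).const_mul m)).congr_deriv (by simp)
    refine monotone_of_deriv_nonneg (fun x => (hd x).differentiableAt) fun x => ?_
    rw [(hd x).deriv]
    exact sub_nonneg.2 (hf' x)
  have hsurj : Function.Surjective f := by
    refine hcont.surjective ?_ ?_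
    · refine tendsto_atTop_mono' _ (f₁ := fun x => m * x + f 0) ?_
        (tendsto_atTop_add_const_right _ _ (tendsto_id.const_mul_atTop hm))
      filter_upwards [eventually_ge_atTop 0] with x hx
      have := hlin hx
      simp only [mul_zero, sub_zero] at this
      linarith
    · refine tendsto_atBot_mono' _ (f₁ := fun x => m * x + f 0) ?_
        (tendsto_atBot_add_const_right _ _ (tendsto_id.const_mul_atBot hm))
      filter_upwards [eventually_le_atBot 0] with x hx
      have := hlin hx
      simp only [mul_zero, sub_zero] at this
      linarith
  let e := hmono.orderIsoOfSurjective f hsurj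
  have h1 : ∀ t, f (e.symm t) = t := fun t => e.apply_symm_apply t
  refine ⟨e.symm, e.symm.strictMono, e.symm.continuous, h1, fun x => e.symm_apply_apply x, ?_⟩
  intro t
  exact (hf _).of_local_left_inverse e.symm.continuous.continuousAt
    (hm.trans_le (hf' _)).ne' (Eventually.of_forall h1)

namespace RevolutionSurface

/-- The numbers commensurable with `2π`. -/
def piRational : Set ℝ := {x | ∃ n m : ℤ, n ≠ 0 ∧ n * x = 2 * Real.pi * m}

theorem countable_piRational : piRational.Countable := by
  refine (Set.countable_range fun z : ℤ × ℤ => 2 * Real.pi * z.2 / (z.1 : ℝ)).mono ?_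
  rintro x ⟨n, m, hn, h⟩
  refine ⟨(n, m), ?_⟩
  have : (n : ℝ) ≠ 0 := by exact_mod_cast hn
  simp only
  rw [← h]
  field_simp

namespace Chart

variable {S : RevolutionSurface} {C : Chart S} {V : ℝ → ℝ} {K : ℝ}

/-- A solution of the reduced equation `d²|θ|/dφ² = -P'(|θ|)`, given in an arbitrary
parametrization with `dφ = G dτ`, yields a motion. -/
theorem exists_solution (hV : S.IsPotential V) (hK : K ≠ 0) {υ v G : ℝ → ℝ} {O : Set ℝ}
    (hO : IsOpen O) (hυ : Continuous υ) (hG : Continuous G) (hυJ : ∀ x, υ x ∈ C.J)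
    {m : ℝ} (hm : 0 < m) (hmG : ∀ x, m ≤ G x * C.ξ ^ 2 / (K * (υ x ^ 2 + C.c)))
    (h1 : ∀ x ∈ O, HasDerivAt υ (v x * G x) x)
    (h2 : ∀ x ∈ O, HasDerivAt v (-deriv (C.P V K) (υ x) * G x) x) :
    ∃ τ : ℝ → ℝ, StrictMono τ ∧ Continuous τ ∧ Function.Surjective τ ∧ τ 0 = 0 ∧
      S.IsSolutionOn V (τ ⁻¹' O) (fun t => C.R (υ (τ t))) (fun t => ∫ x in (0:ℝ)..τ t, G x) ∧
      S.HasMomentumOn Set.univ (fun t => C.R (υ (τ t))) (fun t => ∫ x in (0:ℝ)..τ t, G x) K ∧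
      ∀ t ∈ τ ⁻¹' O, deriv (fun t => C.R (υ (τ t))) t = C.s * K / C.ξ ^ 2 * v (τ t) := by
  have hξ := C.ξ_pos.ne'
  have hpos : ∀ x, 0 < υ x ^ 2 + C.c := fun x => sq_add_pos (hυJ x)
  -- This is `dt/dx`: momentum conservation gives `dt = (f² / K) dφ`, with `f² = ξ² / (υ² + c)` and
  -- `dφ = G dx`. The lower bound `m` makes the time a global parameter.
  have hFc : Continuous fun x => G x * C.ξ ^ 2 / (K * (υ x ^ 2 + C.c)) :=
    Continuous.div (by fun_prop) (by fun_prop) fun x => mul_ne_zero hK (hpos x).ne'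
  have hT : ∀ x, HasDerivAt (fun x => ∫ y in (0:ℝ)..x, G y * C.ξ ^ 2 / (K * (υ y ^ 2 + C.c)))
      (G x * C.ξ ^ 2 / (K * (υ x ^ 2 + C.c))) x := fun x =>
    intervalIntegral.integral_hasDerivAt_right (hFc.intervalIntegrable _ _)
      (hFc.stronglyMeasurableAtFilter _ _) hFc.continuousAt
  obtain ⟨τ, hτm, hτc, hTτ, hτT, hτd⟩ := exists_inverse_of_deriv_ge hm hT hmG
  have hGne : ∀ x, G x ≠ 0 := fun x h => by
    have := hmG x
    rw [h, zero_mul, zero_div] at this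
    linarith
  have dφ : ∀ t, HasDerivAt (fun t => ∫ x in (0:ℝ)..τ t, G x)
      (K * (υ (τ t) ^ 2 + C.c) / C.ξ ^ 2) t := by
    intro t
    have h3 : HasDerivAt (fun x => ∫ y in (0:ℝ)..x, G y) (G (τ t)) (τ t) :=
      intervalIntegral.integral_hasDerivAt_right (hG.intervalIntegrable _ _)
      (hG.stronglyMeasurableAtFilter _ _) hG.continuousAt
    refine (h3.comp t (hτd t)).congr_deriv ?_
    have := hGne (τ t); have := (hpos (τ t)).ne'
    field_simp
  have hRI : ∀ t, C.R (υ (τ t)) ∈ S.I := fun t => R_mem (hυJ _)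
  have dφ' : ∀ t, deriv (fun t => ∫ x in (0:ℝ)..τ t, G x) t = K / S.f (C.R (υ (τ t))) ^ 2 := by
    intro t
    rw [(dφ t).deriv, div_f_sq (C := C) (hRI t), u_R (hυJ _)]
  have mom : S.HasMomentumOn Set.univ (fun t => C.R (υ (τ t)))
      (fun t => ∫ x in (0:ℝ)..τ t, G x) K := by
    intro t _
    rw [dφ' t]
    have := (f_pos' (hRI t)).ne'
    field_simp
  have dr : ∀ t ∈ τ ⁻¹' O, HasDerivAt (fun t => C.R (υ (τ t)))
      (C.s * K / C.ξ ^ 2 * v (τ t)) t := by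
    intro t ht
    refine ((hasDerivAt_R (hυJ (τ t))).comp t ((h1 _ ht).comp t (hτd t))).congr_deriv ?_
    have := hGne (τ t); have := (hpos (τ t)).ne'
    field_simp
  refine ⟨τ, hτm, hτc, fun x => ⟨_, hτT x⟩, ?_, ?_, mom, fun t ht => (dr t ht).deriv⟩
  · have := hτT 0
    simpa using this
  · refine ⟨fun t _ => hRI t, fun t ht => (dr t ht).differentiableAt,
      fun t _ => (dφ t).differentiableAt, fun t ht => ?_, fun t _ => ?_⟩
    · have e1 : deriv (fun t => C.R (υ (τ t))) =ᶠ[𝓝 t] fun t => C.s * K / C.ξ ^ 2 * v (τ t) := by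
        filter_upwards [(hO.preimage hτc).mem_nhds ht] with t' ht' using (dr t' ht').deriv
      refine ((((h2 _ ht).comp t (hτd t)).const_mul
        (C.s * K / C.ξ ^ 2)).congr_of_eventuallyEq e1).congr_deriv ?_
      rw [dφ' t, force_eq (C := C) hV (hRI t) hK, u_R (hυJ _)]
      have := hGne (τ t); have := (hpos (τ t)).ne'
      field_simp
    · refine (hasDerivAt_const t K).congr_of_eventuallyEq (Eventually.of_forall fun t' => ?_)
      exact mom t' trivial

theorem exists_ring (C : Chart S) {α β : ℝ} (hα : α ∈ C.J) (hβ : β ∈ C.J) (hαβ : α ≤ β) :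
    ∃ r₁ ∈ S.I, ∃ r₂ ∈ S.I, ∀ x ∈ Set.Icc α β, r₁ ≤ C.R x ∧ C.R x ≤ r₂ := by
  have hsub : Set.Icc α β ⊆ C.J := C.ordConnected_J.out hα hβ
  have hc : ContinuousOn C.R (Set.Icc α β) := fun x hx =>
    (continuousAt_R (hsub hx)).continuousWithinAt
  have hne : (Set.Icc α β).Nonempty := ⟨α, le_rfl, hαβ⟩
  obtain ⟨x₁, hx₁, h1⟩ := isCompact_Icc.exists_isMinOn hne hc
  obtain ⟨x₂, hx₂, h2⟩ := isCompact_Icc.exists_isMaxOn hne hc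
  exact ⟨C.R x₁, R_mem (hsub hx₁), C.R x₂, R_mem (hsub hx₂), fun x hx => ⟨h1 hx, h2 hx⟩⟩

/-- If the motion repeats after a time `T > 0`, then `υ` and `v` return to their initial values at
the parameter `τ T`. By `hinj` this parameter is `2πn` with `n ≠ 0`. The angle has then grown by `±n
∫ G`, which has to be a multiple of `2π`. -/
theorem exists_periodic_solution (hV : S.IsPotential V) (hK : K ≠ 0) {υ v G : ℝ → ℝ} {α β : ℝ}
    (hα : α ∈ C.J) (hβ : β ∈ C.J)
    (hυ : Continuous υ) (hG : Continuous G) (hυJ : ∀ x, υ x ∈ Set.Icc α β)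
    (hG0 : ∀ x, 0 < G x)
    (h1 : ∀ x, HasDerivAt υ (v x * G x) x)
    (h2 : ∀ x, HasDerivAt v (-deriv (C.P V K) (υ x) * G x) x)
    (hυp : Function.Periodic υ (2 * Real.pi)) (hGp : Function.Periodic G (2 * Real.pi))
    (hinj : ∀ x, υ x = υ 0 → v x = v 0 → ∃ n : ℤ, x = n * (2 * Real.pi)) :
    ∃ r φ : ℝ → ℝ, S.IsBoundedTrajectory V r φ K ∧ (∀ t, ∃ x, r t = C.R (υ x)) ∧
      (∀ x, ∃ t, r t = C.R (υ x)) ∧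
      (IsClosedOrbit r φ → ∫ x in (0:ℝ)..2 * Real.pi, G x ∈ piRational) := by
  have hαβ : α ≤ β := (hυJ 0).1.trans (hυJ 0).2
  have hsub : Set.Icc α β ⊆ C.J := C.ordConnected_J.out hα hβ
  have hpos : ∀ x, 0 < υ x ^ 2 + C.c := fun x => sq_add_pos (hsub (hυJ x))
  have hξ := C.ξ_pos
  -- `σ` is the sign of `K`. Passing from `(v, G)` to `(σ v, σ G)` preserves the reduced equation
  -- and makes time increase with the parameter.
  obtain ⟨σ, hσ, hσK⟩ : ∃ σ : ℝ, σ * σ = 1 ∧ σ / K = |K|⁻¹ := by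
    rcases lt_or_gt_of_ne hK with h | h
    · exact ⟨-1, by norm_num, by rw [abs_of_neg h]; field_simp⟩
    · exact ⟨1, by norm_num, by rw [abs_of_pos h]; field_simp⟩
  have hFeq : ∀ x, (σ * G x) * C.ξ ^ 2 / (K * (υ x ^ 2 + C.c)) =
      G x * C.ξ ^ 2 / (|K| * (υ x ^ 2 + C.c)) := by
    intro x
    have : (σ * G x) * C.ξ ^ 2 / (K * (υ x ^ 2 + C.c)) =
      (σ / K) * (G x * C.ξ ^ 2 / (υ x ^ 2 + C.c)) := by
      have := (hpos x).ne'
      field_simp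
    rw [this, hσK]
    have := (hpos x).ne'
    have := abs_ne_zero.2 hK
    field_simp
  obtain ⟨m, hm, hmF⟩ : ∃ m > 0, ∀ x, m ≤ (σ * G x) * C.ξ ^ 2 / (K * (υ x ^ 2 + C.c)) := by
    have hFc : Continuous fun x => G x * C.ξ ^ 2 / (|K| * (υ x ^ 2 + C.c)) :=
      Continuous.div (by fun_prop) (by fun_prop) fun x =>
        mul_ne_zero (abs_ne_zero.2 hK) (hpos x).ne'
    obtain ⟨x₀, -, hx₀⟩ := isCompact_Icc.exists_isMinOn
      (Set.nonempty_Icc.2 Real.two_pi_pos.le) hFc.continuousOn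
    refine ⟨G x₀ * C.ξ ^ 2 / (|K| * (υ x₀ ^ 2 + C.c)), ?_, fun x => ?_⟩
    · have := hG0 x₀; have := hpos x₀; have := abs_pos.2 hK
      positivity
    · have hp : Function.Periodic (fun x => G x * C.ξ ^ 2 / (|K| * (υ x ^ 2 + C.c)))
          (2 * Real.pi) := fun y => by simp only [hGp y, hυp y]
      obtain ⟨y, hy, hxy⟩ := hp.exists_mem_Ico₀ Real.two_pi_pos x
      rw [hFeq, hxy]
      exact hx₀ ⟨hy.1, hy.2.le⟩
  obtain ⟨τ, hτm, hτc, hτs, hτ0, sol, mom, dr⟩ := exists_solution (C := C) (v := fun x => σ * v x)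
    (G := fun x => σ * G x) (O := Set.univ) hV hK isOpen_univ hυ (by fun_prop)
    (fun x => hsub (hυJ x)) hm hmF
    (fun x _ => (h1 x).congr_deriv (by linear_combination -(v x * G x) * hσ))
    (fun x _ => ((h2 x).const_mul σ).congr_deriv (by ring))
  refine ⟨_, _, ⟨sol, mom, ?_⟩, fun t => ⟨τ t, rfl⟩, fun x => ?_, ?_⟩
  · obtain ⟨r₁, hr₁, r₂, hr₂, h⟩ := C.exists_ring hα hβ hαβ
    exact ⟨r₁, r₂, hr₁.1, hr₂.2, fun t => h _ (hυJ _)⟩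
  · obtain ⟨t, rfl⟩ := hτs x
    exact ⟨t, rfl⟩
  · rintro ⟨T, hT, hper⟩
    have hr : (fun t => C.R (υ (τ (t + T)))) = fun t => C.R (υ (τ t)) :=
      funext fun t => (hper t).1
    have e1 : υ (τ T) = υ 0 := by
      have := congrArg C.u (congrFun hr 0)
      simp only [zero_add, hτ0] at this
      rwa [u_R (hsub (hυJ _)), u_R (hsub (hυJ _))] at this
    have e2 : v (τ T) = v 0 := by
      have h3 := deriv_comp_add_const (f := fun t => C.R (υ (τ t))) T 0
      simp only [hr] at h3
      rw [dr _ trivial, dr _ trivial, zero_add, hτ0] at h3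
      have hσ0 : σ ≠ 0 := fun h => by simp [h] at hσ
      have h4 : C.s * K / C.ξ ^ 2 ≠ 0 :=
        div_ne_zero (mul_ne_zero s_ne hK) (pow_ne_zero _ hξ.ne')
      exact (mul_left_cancel₀ hσ0 (mul_left_cancel₀ h4 h3)).symm
    obtain ⟨n, hn⟩ := hinj _ e1 e2
    have hn0 : n ≠ 0 := by
      rintro rfl
      have : τ 0 < τ T := hτm hT
      rw [hτ0, hn] at this
      simp at this
    have h5 := (hper 0).2
    rw [Real.Angle.angle_eq_iff_two_pi_dvd_sub] at h5
    obtain ⟨k, hk⟩ := h5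
    have h6 := hGp.intervalIntegral_add_zsmul_eq n 0
      (fun a b => hG.intervalIntegrable a b)
    simp only [zero_add, zsmul_eq_mul, hτ0, intervalIntegral.integral_same, sub_zero,
      intervalIntegral.integral_const_mul] at h6 hk
    rw [hn, h6] at hk
    rcases mul_self_eq_one_iff.1 hσ with h | h
    · exact ⟨n, k, hn0, by rw [← hk, h, one_mul]⟩
    · exact ⟨n, -k, hn0, by push_cast; rw [h] at hk; linarith⟩

end Chart

end RevolutionSurface

/-! ### Circular orbits, their stability and small oscillations in the coordinate `|θ|` -/

namespace RevolutionSurface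

variable {S : RevolutionSurface} {V : ℝ → ℝ} {K : ℝ}

theorem IsSolutionOn.deriv_φ {J : Set ℝ} {r φ : ℝ → ℝ} (h : S.IsSolutionOn V J r φ)
    (hK : S.HasMomentumOn J r φ K) {t : ℝ} (ht : t ∈ J) : deriv φ t = K / S.f (r t) ^ 2 := by
  have := (f_pos' (h.mem t ht)).ne'
  rw [← hK t ht]
  field_simp

theorem orbit_const_linear {r₀ k : ℝ} (hk : k ≠ 0) (φ₀ : ℝ) :
    orbit (fun _ => r₀) (fun t => φ₀ + k * t) = {r₀} ×ˢ (Set.univ : Set Real.Angle) := by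
  ext ⟨a, b⟩
  simp only [orbit, Set.mem_range, Set.mem_prod, Set.mem_singleton_iff, Set.mem_univ, and_true,
    Prod.mk.injEq]
  constructor
  · rintro ⟨t, h, -⟩; exact h.symm
  · rintro rfl
    induction b using Real.Angle.induction_on with
    | _ x =>
      refine ⟨(x - φ₀) / k, rfl, ?_⟩
      congr 1
      field_simp
      ring

namespace Chart

variable {C : Chart S}

/-- For `K = 0` the angle is constant and the orbit at fixed `r` is a point, not a circle. For `K ≠
0` the radial equation at constant `r` says that the force vanishes, and the force is a nonzero
multiple of `P'`. -/
theorem isCircularOrbit_iff (C : Chart S) (hV : S.IsPotential V) {r₀ : ℝ} :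
    S.IsCircularOrbit V r₀ K ↔ r₀ ∈ S.I ∧ K ≠ 0 ∧ deriv (C.P V K) (C.u r₀) = 0 := by
  have nz : ∀ {r : ℝ}, r ∈ S.I → K ≠ 0 →
      C.s * (C.u r ^ 2 + C.c) * K ^ 2 / C.ξ ^ 4 ≠ 0 := fun hr hK =>
    div_ne_zero (mul_ne_zero (mul_ne_zero s_ne (u_sq_add_pos hr).ne') (pow_ne_zero _ hK))
      (pow_ne_zero _ C.ξ_pos.ne')
  constructor
  · rintro ⟨r, φ, sol, mom, orb⟩
    have hr : r = fun _ => r₀ := by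
      funext t
      have : (r t, (φ t : Real.Angle)) ∈ orbit r φ := ⟨t, rfl⟩
      rw [orb] at this
      exact this.1
    have hr₀ : r₀ ∈ S.I := by have := sol.mem 0 trivial; rwa [hr] at this
    have hK : K ≠ 0 := by
      rintro rfl
      have hφ : ∀ t, deriv φ t = 0 := fun t => by
        rw [sol.deriv_φ mom trivial, zero_div]
      have hφc : ∀ t, φ t = φ 0 := fun t =>
        is_const_of_deriv_eq_zero (fun t => sol.diff_φ t trivial) hφ t 0
      have key : ∀ a : Real.Angle, a = (φ 0 : Real.Angle) := by
        intro a
        have : (r₀, a) ∈ orbit r φ := by rw [orb]; exact ⟨rfl, trivial⟩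
        obtain ⟨t, ht⟩ := this
        rw [← (Prod.mk.inj ht).2, hφc t]
      exact Real.Angle.pi_ne_zero ((key _).trans (key 0).symm)
    refine ⟨hr₀, hK, ?_⟩
    have h1 := sol.radial 0 trivial
    rw [sol.deriv_φ mom trivial, hr] at h1
    have h2 : HasDerivAt (deriv fun _ : ℝ => r₀) 0 0 := by
      simpa using hasDerivAt_const (0:ℝ) (0:ℝ)
    have h3 := h1.unique h2
    rw [force_eq (C := C) hV hr₀ hK, neg_eq_zero] at h3
    exact (mul_eq_zero.1 h3).resolve_left (nz hr₀ hK)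
  · rintro ⟨hr₀, hK, hP⟩
    have hf := (f_pos' hr₀).ne'
    have hd : ∀ t, HasDerivAt (fun t => 0 + K / S.f r₀ ^ 2 * t) (K / S.f r₀ ^ 2) t := fun t => by
      simpa using (hasDerivAt_id t).const_mul (K / S.f r₀ ^ 2)
    refine ⟨fun _ => r₀, fun t => 0 + K / S.f r₀ ^ 2 * t, ⟨fun _ _ => hr₀,
      fun _ _ => differentiableAt_const _, fun t _ => (hd t).differentiableAt, fun t _ => ?_,
      fun t _ => ?_⟩, fun t _ => ?_, orbit_const_linear (by positivity) 0⟩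
    · rw [(hd t).deriv, force_eq (C := C) hV hr₀ hK, hP]
      simpa using hasDerivAt_const t (0:ℝ)
    · simp only [fun s => (hd s).deriv]
      exact hasDerivAt_const _ _
    · rw [(hd t).deriv]; field_simp

/-- Because `1 / f² = (u² + c) / ξ²`, the centrifugal term supplies the quadratic part of `P` and a
constant. -/
theorem effPotential_eq {r : ℝ} (hr : r ∈ S.I) (hK : K ≠ 0) :
    S.effPotential V K r =
      K ^ 2 / C.ξ ^ 4 * C.P V K (C.u r) + K ^ 2 * C.c / (2 * C.ξ ^ 2) := by
  have h1 := div_f_sq (C := C) (K := K ^ 2 / 2) hr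
  have hξ := C.ξ_pos.ne'
  rw [effPotential, P, W_u hr, show K ^ 2 / (2 * S.f r ^ 2) = K ^ 2 / 2 / S.f r ^ 2 by ring, h1]
  field_simp
  ring

theorem hasDerivAt_effPotential (hV : S.IsPotential V) {r : ℝ} (hr : r ∈ S.I) (hK : K ≠ 0) :
    HasDerivAt (S.effPotential V K)
      (K ^ 2 / C.ξ ^ 4 * (deriv (C.P V K) (C.u r) * (C.s * (C.u r ^ 2 + C.c)))) r := by
  have h := (((hasDerivAt_P (K := K) hV (u_mem (C := C) hr)).comp r
    (hasDerivAt_u hr)).const_mul (K ^ 2 / C.ξ ^ 4)).add_const (K ^ 2 * C.c / (2 * C.ξ ^ 2))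
  refine h.congr_of_eventuallyEq ?_
  filter_upwards [S.isOpen_I.mem_nhds hr] with x hx using effPotential_eq hx hK

/-- At a critical point the second derivative of the coordinate change is multiplied by `P' = 0`, so
nondegeneracy does not depend on the coordinate. -/
theorem deriv_deriv_effPotential (C : Chart S) (hV : S.IsPotential V) {r : ℝ} (hr : r ∈ S.I)
    (hK : K ≠ 0) (h0 : deriv (C.P V K) (C.u r) = 0) :
    deriv (deriv (S.effPotential V K)) r =
      K ^ 2 / C.ξ ^ 4 * (deriv (deriv (C.P V K)) (C.u r) * (C.u r ^ 2 + C.c) ^ 2) := by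
  have e : deriv (S.effPotential V K) =ᶠ[𝓝 r] fun r =>
      K ^ 2 / C.ξ ^ 4 * (deriv (C.P V K) (C.u r) * (C.s * (C.u r ^ 2 + C.c))) := by
    filter_upwards [S.isOpen_I.mem_nhds hr] with x hx using (hasDerivAt_effPotential hV hx hK).deriv
  rw [e.deriv_eq]
  have h1 := (hasDerivAt_deriv_P (K := K) hV (u_mem (C := C) hr)).comp r (hasDerivAt_u hr)
  have h2 := (((hasDerivAt_u (C := C) hr).pow 2).add_const C.c).const_mul C.s
  refine (((h1.mul h2).const_mul (K ^ 2 / C.ξ ^ 4)).congr_deriv ?_).deriv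
  simp only [Function.comp_apply, h0, zero_mul, add_zero]
  have := C.s_mul_s
  simp only [Pi.pow_apply]
  linear_combination (K ^ 2 / C.ξ ^ 4 * (deriv (deriv (C.P V K)) (C.u r) * (C.u r ^ 2 + C.c) ^ 2))
    * this

theorem isStronglyStable_iff (C : Chart S) (hV : S.IsPotential V) {r₀ : ℝ} :
    S.IsStronglyStable V r₀ K ↔ r₀ ∈ S.I ∧ K ≠ 0 ∧ deriv (C.P V K) (C.u r₀) = 0 ∧
      0 < deriv (deriv (C.P V K)) (C.u r₀) := by
  rw [IsStronglyStable, C.isCircularOrbit_iff hV]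
  have hξ := C.ξ_pos
  constructor
  · rintro ⟨hK, ⟨hr, -, h0⟩, hmin, hne⟩
    refine ⟨hr, hK, h0, ?_⟩
    by_contra! hneg
    have hdd := C.deriv_deriv_effPotential hV hr hK h0
    have hd := hasDerivAt_effPotential (C := C) hV hr hK
    rw [h0, zero_mul, mul_zero] at hd
    have hlt : deriv (deriv (S.effPotential V K)) r₀ < 0 := by
      refine lt_of_le_of_ne ?_ hne
      rw [hdd]
      have h1 : 0 ≤ K ^ 2 / C.ξ ^ 4 := by positivity
      exact mul_nonpos_of_nonneg_of_nonpos h1 (mul_nonpos_of_nonpos_of_nonneg hneg (by positivity))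
    -- A point that is both a local maximum and a local minimum lies where the function is locally
    -- constant, which contradicts the nonzero second derivative.
    have hmax : IsLocalMax (S.effPotential V K) r₀ :=
      isLocalMax_of_deriv_deriv_neg hlt hd.deriv hd.continuousAt
    have hc : S.effPotential V K =ᶠ[𝓝 r₀] fun _ => S.effPotential V K r₀ := by
      filter_upwards [hmax, hmin] with x h1 h2 using le_antisymm h1 h2
    apply hne
    rw [hc.deriv.deriv_eq]
    simp
  · rintro ⟨hr, hK, h0, h2⟩
    have hdd := C.deriv_deriv_effPotential hV hr hK h0
    have hd := hasDerivAt_effPotential (C := C) hV hr hK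
    rw [h0, zero_mul, mul_zero] at hd
    have hpos : 0 < deriv (deriv (S.effPotential V K)) r₀ := by
      rw [hdd]
      have := u_sq_add_pos (C := C) hr
      positivity
    exact ⟨hK, ⟨hr, hK, h0⟩, isLocalMin_of_deriv_deriv_pos hpos hd.deriv hd.continuousAt, hpos.ne'⟩

/-- Small oscillations about a strongly stable circular orbit. -/
theorem exists_small_oscillations (hV : S.IsPotential V) (hK : K ≠ 0) {x₀ : ℝ} (hx₀ : x₀ ∈ C.J)
    (h1 : deriv (C.P V K) x₀ = 0) (h2 : 0 < deriv (deriv (C.P V K)) x₀) {N : Set ℝ}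
    (hN : N ∈ 𝓝 x₀) :
    ∃ (g g₁ : ℝ → ℝ) (g₂ h₀ : ℝ), 0 < h₀ ∧ (∀ x, |x| < h₀ → HasDerivAt g (g₁ x) x) ∧
      HasDerivAt g₁ g₂ 0 ∧ 0 < g 0 ∧ g 0 ^ 2 * deriv (deriv (C.P V K)) x₀ = 1 ∧
      (g₂ = 0 → 3 * deriv (deriv (C.P V K)) x₀ *
        deriv (deriv (deriv (deriv (C.P V K)))) x₀ = 5 * deriv (deriv (deriv (C.P V K))) x₀ ^ 2) ∧
      ∀ h, 0 < h → h < h₀ → ∃ r φ : ℝ → ℝ, S.IsBoundedTrajectory V r φ K ∧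
        (∀ t, C.u (r t) ∈ N) ∧ (∃ t t', r t ≠ r t') ∧
        (IsClosedOrbit r φ → ∫ x in (0:ℝ)..2 * Real.pi, g (h * Real.sin x) ∈ piRational) := by
  obtain ⟨ε, hε, hεN⟩ := Metric.nhds_basis_closedBall.mem_iff.1
    (inter_mem hN (C.isOpen_J.mem_nhds hx₀))
  rw [Real.closedBall_eq_Icc] at hεN
  obtain ⟨y, g, g₁, g₂, h₀, hh₀, hy0, hy, hg₂, hg0, hrel⟩ :=
    exists_morse_inverse C.isOpen_J (P_contDiffOn hV) hx₀ h1 h2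
      (N := Set.Icc (x₀ - ε) (x₀ + ε)) (Icc_mem_nhds (by linarith) (by linarith))
  refine ⟨g, g₁, g₂, h₀, hh₀, fun x hx => (hy x hx).2.2.2.1, hg₂,
    (hy 0 (by simpa using hh₀)).2.2.1, hg0, hrel, fun h h0 hh => ?_⟩
  have hsin : ∀ x, |h * Real.sin x| < h₀ := fun x => by
    rw [abs_mul, abs_of_pos h0]
    exact (mul_le_of_le_one_right h0.le (Real.abs_sin_le_one x)).trans_lt hh
  have hdsin : ∀ x, HasDerivAt (fun x => h * Real.sin x) (h * Real.cos x) x := fun x =>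
    (Real.hasDerivAt_sin x).const_mul h
  have hυd : ∀ x, HasDerivAt (fun x => y (h * Real.sin x))
      (g (h * Real.sin x) * (h * Real.cos x)) x := fun x =>
    (hy _ (hsin x)).2.1.comp x (hdsin x)
  -- In the Morse coordinate the energy is `P(x₀) + (s² + v²) / 2`, so an orbit is the circle `s = h
  -- sin x`, `v = h cos x`. Since `du = g ds = g v dx` while `du = v dφ`, the density of the angle
  -- is `g`.
  obtain ⟨r, φ, bd, m1, m2, cl⟩ := exists_periodic_solution (C := C) (K := K)
    (υ := fun x => y (h * Real.sin x)) (v := fun x => h * Real.cos x)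
    (G := fun x => g (h * Real.sin x)) (α := x₀ - ε) (β := x₀ + ε) hV hK
    (hεN ⟨le_rfl, by linarith⟩).2 (hεN ⟨by linarith, le_rfl⟩).2
    (continuous_iff_continuousAt.2 fun x => (hυd x).continuousAt)
    (continuous_iff_continuousAt.2 fun x =>
      ((hy _ (hsin x)).2.2.2.1.comp x (hdsin x)).continuousAt)
    (fun x => (hy _ (hsin x)).1) (fun x => (hy _ (hsin x)).2.2.1)
    (fun x => (hυd x).congr_deriv (by ring))
    (fun x => ((Real.hasDerivAt_cos x).const_mul h).congr_deriv (by
      linear_combination (hy _ (hsin x)).2.2.2.2.2))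
    (fun x => by simp only [Real.sin_add_two_pi])
    (fun x => by simp only [Real.sin_add_two_pi])
    (fun x _ hv => by
      simp only [Real.cos_zero] at hv
      obtain ⟨n, hn⟩ := (Real.cos_eq_one_iff x).1 (mul_left_cancel₀ h0.ne' hv)
      exact ⟨n, hn.symm⟩)
  have hmemJ : ∀ x, y (h * Real.sin x) ∈ C.J := fun x => (hεN (hy _ (hsin x)).1).2
  refine ⟨r, φ, bd, fun t => ?_, ?_, cl⟩
  · obtain ⟨x, hx⟩ := m1 t
    rw [hx, u_R (hmemJ x)]
    exact (hεN (hy _ (hsin x)).1).1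
  · obtain ⟨t, ht⟩ := m2 0
    obtain ⟨t', ht'⟩ := m2 (Real.pi / 2)
    refine ⟨t, t', fun heq => ?_⟩
    rw [ht, ht'] at heq
    have h3 := congrArg C.u heq
    rw [u_R (hmemJ _), u_R (hmemJ _)] at h3
    have h4 := (hy _ (hsin 0)).2.2.2.2.1
    rw [h3, (hy _ (hsin _)).2.2.2.2.1] at h4
    simp at h4
    exact h0.ne' h4

end Chart

end RevolutionSurface

/-! ### Isochronicity and the local power law -/

theorem integral_comp_mul_sin_eq_of_countable {g g₁ : ℝ → ℝ} {h₀ : ℝ} {D : Set ℝ}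
    (hg : ∀ x, |x| < h₀ → HasDerivAt g (g₁ x) x) (hD : D.Countable)
    (hgD : ∀ h, 0 < h → h < h₀ → ∫ x in (0:ℝ)..2 * Real.pi, g (h * Real.sin x) ∈ D)
    {h h' : ℝ} (h1 : 0 < h) (h2 : h ≤ h') (h3 : h' < h₀) :
    ∫ x in (0:ℝ)..2 * Real.pi, g (h * Real.sin x) =
      ∫ x in (0:ℝ)..2 * Real.pi, g (h' * Real.sin x) := by
  have h'0 : 0 < h' := h1.trans_le h2
  -- Continuity of `g` is known only near `0`. Clamping the argument gives a function continuous on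
  -- the line with the same integrals for amplitudes up to `h'`.
  let G : ℝ → ℝ := fun x => g (max (-h') (min h' x))
  have hG : Continuous G := by
    rw [continuous_iff_continuousAt]
    intro x
    have hx : |max (-h') (min h' x)| < h₀ := by
      rw [abs_lt]
      exact ⟨lt_of_lt_of_le (by linarith) (le_max_left _ _),
        max_lt (by linarith) ((min_le_left _ _).trans_lt h3)⟩
    exact ContinuousAt.comp (f := fun x => max (-h') (min h' x)) (hg _ hx).continuousAt
      (Continuous.continuousAt (by fun_prop))
  have hGg : ∀ k ∈ Set.Icc h h', ∫ x in (0:ℝ)..2 * Real.pi, G (k * Real.sin x) =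
      ∫ x in (0:ℝ)..2 * Real.pi, g (k * Real.sin x) := by
    intro k hk
    have hk0 : 0 < k := h1.trans_le hk.1
    congr 1
    funext x
    have hs : |k * Real.sin x| ≤ h' := by
      rw [abs_mul, abs_of_pos hk0]
      exact (mul_le_of_le_one_right hk0.le (Real.abs_sin_le_one x)).trans hk.2
    rw [abs_le] at hs
    simp only [G]
    rw [min_eq_right hs.2, max_eq_right hs.1]
  have hcont : Continuous fun k => ∫ x in (0:ℝ)..2 * Real.pi, G (k * Real.sin x) := by
    apply intervalIntegral.continuous_parametric_intervalIntegral_of_continuous'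
    fun_prop
  have := (isPreconnected_Icc (a := h) (b := h')).eq_of_countable_image hcont.continuousOn hD
    (fun k hk => by rw [hGg k hk]; exact hgD k (h1.trans_le hk.1) (hk.2.trans_lt h3))
    ⟨le_rfl, h2⟩ ⟨h2, le_rfl⟩
  rwa [hGg h ⟨le_rfl, h2⟩, hGg h' ⟨h2, le_rfl⟩] at this

namespace RevolutionSurface

namespace Chart

variable {S : RevolutionSurface} {V : ℝ → ℝ} {K : ℝ} {C : Chart S}

/-- Closed orbits have commensurable periods, so the period is constant in the amplitude. Its limit
at amplitude zero is `2π / √P''`, and the vanishing of its second-order coefficient is the relation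
between the higher derivatives. -/
theorem isochronous_relations (hV : S.IsPotential V) (hK : K ≠ 0) {x₀ : ℝ} (hx₀ : x₀ ∈ C.J)
    (h1 : deriv (C.P V K) x₀ = 0) (h2 : 0 < deriv (deriv (C.P V K)) x₀) {N : Set ℝ}
    (hN : N ∈ 𝓝 x₀)
    (hcl : ∀ r φ : ℝ → ℝ, S.IsBoundedTrajectory V r φ K → (∀ t, C.u (r t) ∈ N) →
      IsClosedOrbit r φ) :
    2 * Real.pi / √(deriv (deriv (C.P V K)) x₀) ∈ piRational ∧
      3 * deriv (deriv (C.P V K)) x₀ * deriv (deriv (deriv (deriv (C.P V K)))) x₀ =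
        5 * deriv (deriv (deriv (C.P V K))) x₀ ^ 2 := by
  obtain ⟨g, g₁, g₂, h₀, hh₀, hg, hg₂, hg0, hgP, hrel, hor⟩ :=
    exists_small_oscillations hV hK hx₀ h1 h2 hN
  have hgD : ∀ h, 0 < h → h < h₀ →
      ∫ x in (0:ℝ)..2 * Real.pi, g (h * Real.sin x) ∈ piRational := by
    intro h h3 h4
    obtain ⟨r, φ, bd, hu, -, cl⟩ := hor h h3 h4
    exact cl (hcl r φ bd hu)
  have hconst : ∀ h, 0 < h → h < h₀ → ∫ x in (0:ℝ)..2 * Real.pi, g (h * Real.sin x) =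
      ∫ x in (0:ℝ)..2 * Real.pi, g (h₀ / 2 * Real.sin x) := by
    intro h h3 h4
    rcases le_total h (h₀ / 2) with h5 | h5
    · exact integral_comp_mul_sin_eq_of_countable hg countable_piRational hgD h3 h5 (by linarith)
    · exact (integral_comp_mul_sin_eq_of_countable hg countable_piRational hgD
        (by linarith) h5 h4).symm
  obtain ⟨hc, hg₂0⟩ := hasDerivAt_quadratic_integral_sin hh₀ hg hg₂ hconst
  refine ⟨?_, hrel hg₂0⟩
  have h6 := hgD (h₀ / 2) (by linarith) (by linarith)
  rw [hc] at h6
  convert h6 using 1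
  rw [div_eq_mul_inv]
  congr 1
  rw [← Real.sqrt_inv, eq_inv_of_mul_eq_one_right hgP, inv_inv, Real.sqrt_sq hg0.le]

theorem deriv_W_eq (hV : S.IsPotential V) (hK : K ≠ 0) {x : ℝ} (hx : x ∈ C.J)
    (h1 : deriv (C.P V K) x = 0) : K ^ 2 * x = -(C.ξ ^ 2 * deriv (C.W V) x) := by
  rw [deriv_P hV hx] at h1
  have := C.ξ_pos.ne'
  field_simp at h1
  have h2 : C.ξ ^ 2 * (K ^ 2 * x + C.ξ ^ 2 * deriv (C.W V) x) = 0 := by linear_combination h1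
  have := (mul_eq_zero.1 h2).resolve_left (pow_ne_zero _ C.ξ_pos.ne')
  linarith

theorem deriv_P_eq_zero (hV : S.IsPotential V) (hK : K ≠ 0) {x : ℝ} (hx : x ∈ C.J)
    (h1 : K ^ 2 * x = -(C.ξ ^ 2 * deriv (C.W V) x)) : deriv (C.P V K) x = 0 := by
  rw [deriv_P hV hx]
  field_simp
  linear_combination C.ξ ^ 2 * h1

/-- The condition `K² x = -ξ² W'` eliminates `K`, so the frequency of small oscillations becomes a
function of the circle alone. -/
theorem deriv_deriv_P_of_deriv_eq_zero (hV : S.IsPotential V) (hK : K ≠ 0) {x : ℝ} (hx : x ∈ C.J)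
    (h1 : deriv (C.P V K) x = 0) :
    deriv (deriv (C.P V K)) x =
      C.ξ ^ 2 * (1 - x * deriv (deriv (C.W V)) x / deriv (C.W V) x) := by
  have h2 := deriv_W_eq hV hK hx h1
  have hx0 := (J_pos hx).ne'
  have hξ := C.ξ_pos.ne'
  have hW : deriv (C.W V) x ≠ 0 := fun h => by
    rw [h] at h2
    simp [hK, hx0] at h2
  rw [deriv_deriv_P hV hx]
  have h3 : C.ξ ^ 4 / K ^ 2 = -(C.ξ ^ 2 * x / deriv (C.W V) x) := by
    field_simp
    linear_combination h2
  rw [h3]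
  ring

/-- The momentum of the circular orbits close to a given one. -/
theorem tendsto_momentum (hV : S.IsPotential V) (hK : K ≠ 0) {x₀ : ℝ} (hx₀ : x₀ ∈ C.J)
    (h1 : deriv (C.P V K) x₀ = 0) :
    ∃ k : ℝ → ℝ, Tendsto k (𝓝 x₀) (𝓝 K) ∧
      ∀ᶠ x in 𝓝 x₀, k x ≠ 0 ∧ deriv (C.P V (k x)) x = 0 := by
  have h2 := deriv_W_eq hV hK hx₀ h1
  have hx0 := (J_pos hx₀).ne'
  have hξ := C.ξ_pos
  have hc : ContinuousAt (deriv (C.W V)) x₀ := (hasDerivAt_deriv_W hV hx₀).continuousAt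
  have hQ : ContinuousAt (fun x => -(C.ξ ^ 2 * deriv (C.W V) x) / x) x₀ :=
    ContinuousAt.div (by fun_prop) continuousAt_id hx0
  have hQ0 : -(C.ξ ^ 2 * deriv (C.W V) x₀) / x₀ = K ^ 2 := by rw [← h2]; field_simp
  have hpos : ∀ᶠ x in 𝓝 x₀, 0 < -(C.ξ ^ 2 * deriv (C.W V) x) / x :=
    hQ.eventually (lt_mem_nhds (by beta_reduce; rw [hQ0]; positivity))
  -- The circular-orbit condition determines only `k²`; the factor `K / |K|` selects the branch
  -- passing through `K`.
  refine ⟨fun x => K / |K| * √(-(C.ξ ^ 2 * deriv (C.W V) x) / x), ?_, ?_⟩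
  · have := (hQ.sqrt.const_mul (K / |K|))
    unfold ContinuousAt at this
    beta_reduce at this
    rw [hQ0, Real.sqrt_sq_eq_abs] at this
    have h3 : K / |K| * |K| = K := by
      have := abs_ne_zero.2 hK; field_simp
    rwa [h3] at this
  · filter_upwards [hpos, C.isOpen_J.mem_nhds hx₀] with x hx hxJ
    have hk : K / |K| * √(-(C.ξ ^ 2 * deriv (C.W V) x) / x) ≠ 0 :=
      mul_ne_zero (div_ne_zero hK (abs_ne_zero.2 hK)) (Real.sqrt_ne_zero'.2 hx)
    refine ⟨hk, deriv_P_eq_zero hV hk hxJ ?_⟩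
    have hx0 := (J_pos hxJ).ne'
    rw [mul_pow, div_pow, sq_abs, Real.sq_sqrt hx.le, div_self (pow_ne_zero _ hK)]
    field_simp

/-- Comparing different circular orbits gives a power law for `W'` with unknown exponent `1 - q`;
comparing amplitudes around the single orbit at `r₀` restricts `q` to `1` or `4`. -/
theorem exists_local_power_law (hV : S.IsPotential V) {r₀ : ℝ}
    (hst : S.IsStronglyStable V r₀ K) (hcl : S.ClosedNear V r₀ K) :
    ∃ i : ℕ, (i = 1 ∨ i = 2) ∧ ∀ᶠ x in 𝓝 (C.u r₀), deriv (C.W V) x < 0 ∧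
      x * deriv (deriv (C.W V)) x = (1 - (i : ℝ) ^ 2) * deriv (C.W V) x := by
  obtain ⟨hr₀, hK, h1, h2⟩ := (C.isStronglyStable_iff hV).1 hst
  obtain ⟨ε, hε, hcl⟩ := hcl
  have hx₀ : C.u r₀ ∈ C.J := u_mem hr₀
  have hR₀ : C.R (C.u r₀) = r₀ := R_u hr₀
  set x₀ := C.u r₀
  have hξ := C.ξ_pos
  have hxpos := J_pos hx₀
  obtain ⟨k, hk, hkP⟩ := tendsto_momentum hV hK hx₀ h1
  have hWneg : deriv (C.W V) x₀ < 0 := by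
    have h3 := deriv_W_eq hV hK hx₀ h1
    have h4 : 0 < K ^ 2 * x₀ := by positivity
    have h5 : 0 < C.ξ ^ 2 := by positivity
    nlinarith
  have hWc : ContinuousAt (deriv (C.W V)) x₀ := (hasDerivAt_deriv_W hV hx₀).continuousAt
  have hWev : ∀ᶠ x in 𝓝 x₀, deriv (C.W V) x < 0 := hWc.eventually (gt_mem_nhds hWneg)
  -- The squared frequency of small oscillations about the circular orbit at `x`, to be shown
  -- constant near `x₀`.
  let Φ : ℝ → ℝ := fun x => C.ξ ^ 2 * (1 - x * deriv (deriv (C.W V)) x / deriv (C.W V) x)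
  have hΦat : ∀ x ∈ C.J, deriv (C.W V) x < 0 → ContinuousAt Φ x := by
    intro x hx hW
    have c1 := (hasDerivAt_deriv_W hV hx).continuousAt
    have c2 := ((W_contDiffAt hV hx).deriv_infty.deriv_infty).continuousAt
    exact continuousAt_const.mul (continuousAt_const.sub
      ((continuousAt_id.mul c2).div c1 hW.ne))
  have hΦ0 : 0 < Φ x₀ := by rwa [deriv_deriv_P_of_deriv_eq_zero hV hK hx₀ h1] at h2
  have hΦev : ∀ᶠ x in 𝓝 x₀, 0 < Φ x := (hΦat x₀ hx₀ hWneg).eventually (lt_mem_nhds hΦ0)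
  have hRev : ∀ᶠ x in 𝓝 x₀, C.R x ∈ Metric.ball r₀ ε :=
    (continuousAt_R hx₀).eventually (by rw [hR₀]; exact Metric.ball_mem_nhds r₀ hε)
  have hkev : ∀ᶠ x in 𝓝 x₀, k x ∈ Set.Ioo (K - ε) (K + ε) :=
    hk.eventually (Ioo_mem_nhds (by linarith) (by linarith))
  have closed : ∀ x ∈ C.J, C.R x ∈ Metric.ball r₀ ε → ∀ K' ∈ Set.Ioo (K - ε) (K + ε), K' ≠ 0 →
      ∃ N ∈ 𝓝 x, ∀ r φ : ℝ → ℝ, S.IsBoundedTrajectory V r φ K' → (∀ t, C.u (r t) ∈ N) →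
      IsClosedOrbit r φ := by
    intro x hx hRx K' hK' hK'0
    refine ⟨_, (continuousAt_R hx).preimage_mem_nhds (Metric.isOpen_ball.mem_nhds hRx), ?_⟩
    intro r φ bd hu
    refine hcl r φ K' hK'0 bd (fun t => ?_) hK'.1 hK'.2
    have h3 := hu t
    rw [Set.mem_preimage, R_u (bd.sol.mem t trivial), Metric.mem_ball, Real.dist_eq,
      abs_lt] at h3
    constructor <;> linarith
  have all : ∀ᶠ x in 𝓝 x₀, x ∈ C.J ∧ deriv (C.W V) x < 0 ∧
      2 * Real.pi / √(Φ x) ∈ piRational ∧ 0 < Φ x := by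
    filter_upwards [C.isOpen_J.mem_nhds hx₀, hWev, hΦev, hRev, hkev, hkP] with x a b c d e f
    refine ⟨a, b, ?_, c⟩
    obtain ⟨N, hN, hcl⟩ := closed x a d (k x) e f.1
    have h3 := deriv_deriv_P_of_deriv_eq_zero hV f.1 a f.2
    have h4 := (isochronous_relations hV f.1 a f.2 (by rw [h3]; exact c) hN hcl).1
    rwa [h3] at h4
  obtain ⟨δ, hδ, hball⟩ := Metric.eventually_nhds_iff_ball.1 all
  have hΦc : ∀ x ∈ Metric.ball x₀ δ, Φ x = Φ x₀ := by
    intro x hx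
    have h3 := (convex_ball x₀ δ).isPreconnected.eq_of_countable_image
      (g := fun x => 2 * Real.pi / √(Φ x)) (fun y hy => ?_) countable_piRational
      (fun y hy => (hball y hy).2.2.1) hx (Metric.mem_ball_self hδ)
    · have p1 := (hball x hx).2.2.2
      have p2 : √(Φ x) = √(Φ x₀) := by
        have q1 := Real.sqrt_pos.2 p1
        have q2 := Real.sqrt_pos.2 hΦ0
        have q3 := Real.pi_pos
        beta_reduce at h3
        rw [div_eq_div_iff q1.ne' q2.ne'] at h3
        exact (mul_left_cancel₀ (by positivity) h3).symm
      exact (Real.sqrt_inj p1.le hΦ0.le).1 p2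
    · obtain ⟨a, b, -, d⟩ := hball y hy
      exact ((continuousAt_const).div (hΦat y a b).sqrt
        (Real.sqrt_pos.2 d).ne').continuousWithinAt
  set q := Φ x₀ / C.ξ ^ 2 with hq
  have hqpos : 0 < q := by positivity
  have eq1 : ∀ᶠ x in 𝓝 x₀, x * deriv (deriv (C.W V)) x = (1 - q) * deriv (C.W V) x := by
    filter_upwards [Metric.ball_mem_nhds x₀ hδ] with x hx
    have hW := (hball x hx).2.1.ne
    rw [hq, ← hΦc x hx]
    simp only [Φ]
    field_simp
    ring
  have sm := W_contDiffAt hV hx₀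
  have d1 := sm.deriv_infty.eventually_hasDerivAt
  have d2 := sm.deriv_infty.deriv_infty.eventually_hasDerivAt
  have d3 := sm.deriv_infty.deriv_infty.deriv_infty.eventually_hasDerivAt
  have eq2 : ∀ᶠ x in 𝓝 x₀, x * deriv (deriv (deriv (C.W V))) x =
      -q * deriv (deriv (C.W V)) x := by
    filter_upwards [eq1.eventually_nhds, d1, d2] with x e e1 e2
    have h3 : HasDerivAt (fun x => x * deriv (deriv (C.W V)) x) _ x := (hasDerivAt_id x).mul e2
    have h4 := h3.unique ((e1.const_mul (1 - q)).congr_of_eventuallyEq e)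
    simp only [id] at h4
    linarith
  have eq3 : x₀ * deriv (deriv (deriv (deriv (C.W V)))) x₀ =
      -(q + 1) * deriv (deriv (deriv (C.W V))) x₀ := by
    have h3 : HasDerivAt (fun x => x * deriv (deriv (deriv (C.W V))) x) _ x₀ :=
      (hasDerivAt_id x₀).mul d3.self_of_nhds
    have h4 := h3.unique ((d2.self_of_nhds.const_mul (-q)).congr_of_eventuallyEq eq2)
    simp only [id] at h4
    linarith
  -- higher derivatives of the reduced potential
  have P2 : deriv (deriv (C.P V K)) =ᶠ[𝓝 x₀] fun x =>
      C.ξ ^ 2 + C.ξ ^ 4 / K ^ 2 * deriv (deriv (C.W V)) x := by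
    filter_upwards [C.isOpen_J.mem_nhds hx₀] with y hy using deriv_deriv_P hV hy
  have P3 : deriv (deriv (deriv (C.P V K))) =ᶠ[𝓝 x₀] fun x =>
      C.ξ ^ 4 / K ^ 2 * deriv (deriv (deriv (C.W V))) x := by
    filter_upwards [P2.deriv, d2] with x e e2
    rw [e]
    exact ((e2.const_mul _).const_add _).deriv
  have P4 : deriv (deriv (deriv (deriv (C.P V K)))) x₀ =
      C.ξ ^ 4 / K ^ 2 * deriv (deriv (deriv (deriv (C.W V)))) x₀ := by
    rw [P3.deriv_eq]
    exact (d3.self_of_nhds.const_mul _).deriv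
  obtain ⟨N, hN, hcl'⟩ := closed x₀ hx₀ (by rw [hR₀]; exact Metric.mem_ball_self hε) K
    ⟨by linarith, by linarith⟩ hK
  have hrel := (isochronous_relations hV hK hx₀ h1 h2 hN hcl').2
  have hP2 : deriv (deriv (C.P V K)) x₀ = C.ξ ^ 2 * q := by
    rw [deriv_deriv_P_of_deriv_eq_zero hV hK hx₀ h1, hq]
    simp only [Φ]
    field_simp
  have hq14 : q = 1 ∨ q = 4 := by
    rw [hP2, P3.eq_of_nhds, P4] at hrel
    have f1 : C.ξ ^ 4 / K ^ 2 * deriv (C.W V) x₀ = -(C.ξ ^ 2 * x₀) := by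
      have := deriv_W_eq hV hK hx₀ h1
      field_simp
      linear_combination this
    have f2 : C.ξ ^ 4 / K ^ 2 * deriv (deriv (C.W V)) x₀ = -((1 - q) * C.ξ ^ 2) := by
      have h3 := eq1.self_of_nhds
      apply mul_left_cancel₀ hxpos.ne'
      linear_combination C.ξ ^ 4 / K ^ 2 * h3 + (1 - q) * f1
    have f3 : x₀ * (C.ξ ^ 4 / K ^ 2 * deriv (deriv (deriv (C.W V))) x₀) =
        q * (1 - q) * C.ξ ^ 2 := by
      linear_combination C.ξ ^ 4 / K ^ 2 * eq2.self_of_nhds - q * f2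
    have f4 : x₀ ^ 2 * (C.ξ ^ 4 / K ^ 2 * deriv (deriv (deriv (deriv (C.W V)))) x₀) =
        -(q + 1) * (q * (1 - q) * C.ξ ^ 2) := by
      linear_combination C.ξ ^ 4 / K ^ 2 * x₀ * eq3 - (q + 1) * f3
    generalize C.ξ ^ 4 / K ^ 2 * deriv (deriv (deriv (C.W V))) x₀ = A₃ at *
    generalize C.ξ ^ 4 / K ^ 2 * deriv (deriv (deriv (deriv (C.W V)))) x₀ = A₄ at *
    -- Under the power law the relation times `x₀²` reads `-3 q² (q + 1)(1 - q) = 5 q² (1 - q)²`, up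
    -- to the factor `ξ⁴`; the difference of the two sides is `2 q² (1 - q)(q - 4)`.
    have f5 : C.ξ ^ 4 * q ^ 2 * ((1 - q) * (q - 4)) = 0 := by
      linear_combination (x₀ ^ 2 / 2) * hrel - (3 * C.ξ ^ 2 * q / 2) * f4 +
        (5 / 2 * (x₀ * A₃ + q * (1 - q) * C.ξ ^ 2)) * f3
    have f6 := (mul_eq_zero.1 f5).resolve_left (by positivity)
    rcases mul_eq_zero.1 f6 with h | h
    · left; linarith
    · right; linarith
  rcases hq14 with h | h
  · refine ⟨1, Or.inl rfl, ?_⟩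
    filter_upwards [eq1, hWev] with x a b
    exact ⟨b, by rw [a, h]; norm_num⟩
  · refine ⟨2, Or.inr rfl, ?_⟩
    filter_upwards [eq1, hWev] with x a b
    exact ⟨b, by rw [a, h]; norm_num⟩

end Chart

end RevolutionSurface

/-! ### From the local power law to the potentials `V_i` -/

namespace RevolutionSurface

variable {S : RevolutionSurface} {V : ℝ → ℝ} {K : ℝ}

/-- The potentials `V₁`, `V₂` on `(a, b)`. -/
def HasClosingForm (S : RevolutionSurface) (V : ℝ → ℝ) : Prop :=
  ∃ i : ℕ, (i = 1 ∨ i = 2) ∧ ∃ A B : ℝ, 0 < A ∧ ∀ r ∈ S.I, V r = S.Vpot i A B r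

/-- The generalized gravitational and oscillator potentials as functions of `|θ|`. -/
noncomputable def powerPotential (i : ℕ) (A B x : ℝ) : ℝ :=
  (-1) ^ i * A * x ^ (2 - (i : ℤ) ^ 2) / i + B

theorem Vpot_eq (C : Chart S) (i : ℕ) (A B r : ℝ) :
    S.Vpot i A B r = powerPotential i A B (C.u r) := rfl

theorem powerPotential_one (A B x : ℝ) : powerPotential 1 A B x = -A * x + B := by
  simp [powerPotential]

theorem powerPotential_two (A B x : ℝ) : powerPotential 2 A B x = A / 2 * (x ^ 2)⁻¹ + B := by
  have : (2:ℤ) - ((2:ℕ) : ℤ) ^ 2 = -2 := by norm_num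
  rw [powerPotential, this, zpow_neg]
  norm_num
  ring

theorem hasDerivAt_powerPotential {i : ℕ} (hi : i = 1 ∨ i = 2) (A B : ℝ) {x : ℝ} (hx : 0 < x) :
    HasDerivAt (powerPotential i A B) (-A / x ^ (i ^ 2 - 1)) x := by
  rcases hi with rfl | rfl
  · rw [show powerPotential 1 A B = fun x => -A * x + B from funext (powerPotential_one A B)]
    exact (((hasDerivAt_id x).const_mul (-A)).add_const B).congr_deriv (by simp)
  · rw [show powerPotential 2 A B = fun x => A / 2 * (x ^ 2)⁻¹ + B from
      funext (powerPotential_two A B)]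
    refine ((((hasDerivAt_pow 2 x).inv (by positivity)).const_mul (A / 2)).add_const B).congr_deriv ?_
    have := hx.ne'
    norm_num
    field_simp

theorem hasDerivAt_deriv_powerPotential {i : ℕ} (hi : i = 1 ∨ i = 2) (A : ℝ) {x : ℝ}
    (hx : 0 < x) :
    HasDerivAt (fun x => -A / x ^ (i ^ 2 - 1)) ((1 - (i : ℝ) ^ 2) * (-A / x ^ (i ^ 2 - 1)) / x) x := by
  rcases hi with rfl | rfl
  · simpa using hasDerivAt_const x (-A)
  · have := hx.ne'
    refine ((hasDerivAt_const x (-A)).div (hasDerivAt_pow 3 x) (by positivity)).congr_deriv ?_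
    norm_num
    field_simp

namespace Chart

variable {C : Chart S}

/-- Continuation along the connected interval `J`: wherever the power law holds at a point, that
point carries a strongly stable circular orbit, so the local result applies there again. -/
theorem hasClosingForm_of_locallyClosing (C : Chart S) (hV : S.IsPotential V)
    (h : S.IsLocallyClosing V) : S.HasClosingForm V := by
  obtain ⟨⟨r₀, K₀, hst⟩, hloc⟩ := h
  obtain ⟨i, hi, hev⟩ := exists_local_power_law (C := C) hV hst (hloc _ _ hst)
  have hr₀ := ((C.isStronglyStable_iff hV).1 hst).1
  have hx₀ : C.u r₀ ∈ C.J := u_mem hr₀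
  set x₀ := C.u r₀
  obtain ⟨hW₀, hWW₀⟩ := hev.self_of_nhds
  have hx₀pos := J_pos hx₀
  -- The truncated subtraction is harmless because `i ≥ 1`; `W'` is to be `-A / x ^ n`.
  set n := i ^ 2 - 1 with hn
  have hin : (n : ℝ) = (i : ℝ) ^ 2 - 1 := by rcases hi with rfl | rfl <;> norm_num [hn]
  set A := -(deriv (C.W V) x₀ * x₀ ^ n) with hA
  have hApos : 0 < A := by
    have : 0 < x₀ ^ n := by positivity
    have := mul_neg_of_neg_of_pos hW₀ this
    linarith
  -- Both conditions are closed in `J`. The first keeps `W'` away from zero in the limit, and the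
  -- second makes the limit point strongly stable.
  let Z : Set ℝ := {x | x ∈ C.J ∧ deriv (C.W V) x * x ^ n = -A ∧
    x * deriv (deriv (C.W V)) x - (1 - (i : ℝ) ^ 2) * deriv (C.W V) x = 0}
  have hstab : ∀ x ∈ Z, ∀ᶠ y in 𝓝 x, deriv (C.W V) y < 0 ∧
      y * deriv (deriv (C.W V)) y = (1 - (i : ℝ) ^ 2) * deriv (C.W V) y := by
    rintro x ⟨hx, h1, h2⟩
    have hxpos := J_pos hx
    have hW : deriv (C.W V) x < 0 := by
      have : 0 < x ^ n := by positivity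
      by_contra! hge
      have := mul_nonneg hge this.le
      linarith
    have hξ := C.ξ_pos
    have hQ : 0 < -(C.ξ ^ 2 * deriv (C.W V) x) / x := by
      have := mul_neg_of_pos_of_neg (pow_pos hξ 2) hW
      exact div_pos (by linarith) hxpos
    have hK : √(-(C.ξ ^ 2 * deriv (C.W V) x) / x) ≠ 0 := Real.sqrt_ne_zero'.2 hQ
    have hP1 : deriv (C.P V √(-(C.ξ ^ 2 * deriv (C.W V) x) / x)) x = 0 := by
      apply deriv_P_eq_zero hV hK hx
      rw [Real.sq_sqrt hQ.le]
      field_simp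
    have hst : S.IsStronglyStable V (C.R x) √(-(C.ξ ^ 2 * deriv (C.W V) x) / x) := by
      rw [C.isStronglyStable_iff hV, u_R hx]
      refine ⟨R_mem hx, hK, hP1, ?_⟩
      rw [deriv_deriv_P_of_deriv_eq_zero hV hK hx hP1]
      have : x * deriv (deriv (C.W V)) x / deriv (C.W V) x = 1 - (i:ℝ) ^ 2 := by
        rw [div_eq_iff hW.ne]; linarith
      rw [this]
      have : 0 < (i : ℝ) := by rcases hi with rfl | rfl <;> norm_num
      ring_nf
      positivity
    -- The index found here might differ from `i`, but at `x` itself both laws give `x W'' / W'`,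
    -- whence `i'² = i²`.
    obtain ⟨i', hi', hev'⟩ := exists_local_power_law (C := C) hV hst (hloc _ _ hst)
    rw [u_R hx] at hev'
    have h3 := hev'.self_of_nhds.2
    have h4 : (i' : ℝ) ^ 2 = (i : ℝ) ^ 2 := by
      have := mul_right_cancel₀ hW.ne (h3.symm.trans (sub_eq_zero.1 h2))
      linarith
    rw [h4] at hev'
    exact hev'
  have hdn : ∀ x ∈ C.J, HasDerivAt (fun x => deriv (C.W V) x * x ^ n)
      (deriv (deriv (C.W V)) x * x ^ n + deriv (C.W V) x * (n * x ^ (n - 1))) x := fun x hx =>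
    (hasDerivAt_deriv_W hV hx).mul (hasDerivAt_pow n x)
  have hZopen : IsOpen Z := by
    rw [isOpen_iff_mem_nhds]
    intro x hxZ
    obtain ⟨ε, hε, hball⟩ := Metric.eventually_nhds_iff_ball.1
      ((hstab x hxZ).and (C.isOpen_J.mem_nhds hxZ.1))
    filter_upwards [Metric.ball_mem_nhds x hε] with y hy
    refine ⟨(hball y hy).2, ?_, sub_eq_zero.2 (hball y hy).1.2⟩
    rw [← hxZ.2.1]
    refine Metric.isOpen_ball.is_const_of_deriv_eq_zero (f := fun x => deriv (C.W V) x * x ^ n)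
      (convex_ball x ε).isPreconnected
      (fun z hz => (hdn z (hball z hz).2).differentiableAt.differentiableWithinAt)
      (fun z hz => ?_) hy (Metric.mem_ball_self hε)
    rw [(hdn z (hball z hz).2).deriv]
    have hz0 := (J_pos (hball z hz).2).ne'
    have h5 := (hball z hz).1.2
    apply mul_left_cancel₀ hz0
    have h6 : (n : ℝ) * z ^ (n - 1) * z = n * z ^ n := by
      rcases hi with rfl | rfl
      · simp [hn]
      · norm_num [hn]; ring
    simp only [Pi.zero_apply, mul_zero]
    rw [hin] at h6
    rw [hin]
    linear_combination z ^ n * h5 + deriv (C.W V) z * h6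
  have hJZ : C.J ⊆ Z := by
    refine C.isPreconnected_J.subset_of_closure_inter_subset hZopen
      ⟨x₀, hx₀, hx₀, by rw [hA, neg_neg], sub_eq_zero.2 hWW₀⟩ ?_
    rintro x ⟨hxc, hxJ⟩
    have c1 := (hasDerivAt_deriv_W hV hxJ).continuousAt
    have c2 := ((W_contDiffAt hV hxJ).deriv_infty.deriv_infty).continuousAt
    refine ⟨hxJ, ?_, ?_⟩
    · have := ContinuousWithinAt.mem_closure (s := Z) (t := {-A})
        (hdn x hxJ).continuousAt.continuousWithinAt hxc (fun y hy => hy.2.1)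
      simpa using this
    · have := ContinuousWithinAt.mem_closure (s := Z) (t := {0})
        (f := fun x => x * deriv (deriv (C.W V)) x - (1 - (i : ℝ) ^ 2) * deriv (C.W V) x)
        ((continuousAt_id.mul c2).sub (continuousAt_const.mul c1)).continuousWithinAt hxc
        (fun y hy => hy.2.2)
      simpa using this
  refine ⟨i, hi, A, C.W V x₀ - powerPotential i A 0 x₀, hApos, fun r hr => ?_⟩
  have hd : ∀ x ∈ C.J, HasDerivAt (fun x => C.W V x - powerPotential i A 0 x) 0 x := by
    intro x hx
    refine ((hasDerivAt_W hV hx).sub (hasDerivAt_powerPotential hi A 0 (J_pos hx))).congr_deriv ?_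
    have h7 := (hJZ hx).2.1
    have := (J_pos hx).ne'
    rw [sub_eq_zero, eq_div_iff (by positivity)]
    exact h7
  have hcst := C.isOpen_J.is_const_of_deriv_eq_zero C.isPreconnected_J
    (fun x hx => (hd x hx).differentiableAt.differentiableWithinAt)
    (fun x hx => (hd x hx).deriv) (u_mem (C := C) hr) hx₀
  beta_reduce at hcst
  rw [Vpot_eq C, ← W_u (C := C) (V := V) hr, ← hcst]
  simp only [powerPotential]
  ring

end Chart

end RevolutionSurface

/-! ### Potential wells -/

/-- At a zero of `f` the product rule needs only continuity of `g`. It serves at turning points,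
where the divided difference is known only to be continuous. -/
theorem HasDerivAt.mul_of_eq_zero {f g : ℝ → ℝ} {f' x : ℝ} (hf : HasDerivAt f f' x)
    (hg : ContinuousAt g x) (h0 : f x = 0) : HasDerivAt (fun y => f y * g y) (f' * g x) x := by
  rw [hasDerivAt_iff_tendsto_slope] at hf ⊢
  have h1 : Tendsto g (𝓝[≠] x) (𝓝 (g x)) := hg.mono_left nhdsWithin_le_nhds
  refine (hf.mul h1).congr fun y => ?_
  simp only [slope_def_field, h0]
  ring

theorem StrictMonoOn.exists_continuousOn_inverse {f : ℝ → ℝ} {c d : ℝ} (hcd : c < d)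
    (hf : ContinuousOn f (Set.Icc c d)) (hm : StrictMonoOn f (Set.Icc c d)) :
    ∃ g : ℝ → ℝ, ContinuousOn g (Set.Ioo (f c) (f d)) ∧
      ∀ y ∈ Set.Ioo (f c) (f d), g y ∈ Set.Ioo c d ∧ f (g y) = y := by
  have hsurj : Set.SurjOn f (Set.Ioo c d) (Set.Ioo (f c) (f d)) :=
    intermediate_value_Ioo hcd.le hf
  have hg : ∀ y ∈ Set.Ioo (f c) (f d), Function.invFunOn f (Set.Ioo c d) y ∈ Set.Ioo c d ∧
      f (Function.invFunOn f (Set.Ioo c d) y) = y := fun y hy =>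
    ⟨Function.invFunOn_mem (hsurj hy), Function.invFunOn_eq (hsurj hy)⟩
  refine ⟨_, fun y hy => ContinuousAt.continuousWithinAt ?_, hg⟩
  refine continuousAt_of_monotoneOn_of_image_mem_nhds (s := Set.Ioo (f c) (f d)) ?_
    (isOpen_Ioo.mem_nhds hy) ?_
  · intro y₁ h1 y₂ h2 h12
    by_contra! hlt
    have := hm (Set.Ioo_subset_Icc_self (hg y₂ h2).1) (Set.Ioo_subset_Icc_self (hg y₁ h1).1) hlt
    rw [(hg y₁ h1).2, (hg y₂ h2).2] at this
    exact absurd h12 (not_le.2 this)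
  · refine mem_of_superset (isOpen_Ioo.mem_nhds (hg y hy).1) fun x hx => ?_
    have hfx : f x ∈ Set.Ioo (f c) (f d) :=
      ⟨hm ⟨le_rfl, hcd.le⟩ (Set.Ioo_subset_Icc_self hx) hx.1,
        hm (Set.Ioo_subset_Icc_self hx) ⟨hcd.le, le_rfl⟩ hx.2⟩
    exact ⟨f x, hfx, hm.injOn (Set.Ioo_subset_Icc_self (hg _ hfx).1)
      (Set.Ioo_subset_Icc_self hx) (hg _ hfx).2⟩

/-- The data of a function on `[α, β]` with two derivatives, the second one being extended
continuously to the line. -/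
structure IsC2On (P P₁ p : ℝ → ℝ) (α β : ℝ) : Prop where
  cont : Continuous p
  d1 : ∀ x ∈ Set.Icc α β, HasDerivAt P (P₁ x) x
  d2 : ∀ x ∈ Set.Icc α β, HasDerivAt P₁ (p x) x

/-- `(a, b)` is a component of a sublevel set of `P`, at a level with nonzero derivatives at the
ends. -/
structure IsWell (P P₁ : ℝ → ℝ) (a b : ℝ) : Prop where
  lt : a < b
  eq : P a = P b
  below : ∀ x ∈ Set.Ioo a b, P x < P a
  neg : P₁ a < 0
  pos : 0 < P₁ b

/-- The parametrization of a well by an angle. -/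
noncomputable def wellAngle (a b x : ℝ) : ℝ := (a + b) / 2 + (b - a) / 2 * Real.sin x

/-- The density of time with respect to the angle in a well. -/
noncomputable def wellDensity (p : ℝ → ℝ) (a b x : ℝ) : ℝ :=
  (√(2 * dividedDiff p a b (wellAngle a b x)))⁻¹

theorem wellAngle_mem {a b : ℝ} (hab : a < b) (x : ℝ) : wellAngle a b x ∈ Set.Icc a b := by
  have h1 := Real.sin_le_one x
  have h2 := Real.neg_one_le_sin x
  unfold wellAngle
  constructor <;> nlinarith

theorem hasDerivAt_wellAngle (a b x : ℝ) :
    HasDerivAt (wellAngle a b) ((b - a) / 2 * Real.cos x) x :=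
  ((Real.hasDerivAt_sin x).const_mul ((b - a) / 2)).const_add ((a + b) / 2)

theorem wellAngle_mul (a b x : ℝ) :
    (wellAngle a b x - a) * (b - wellAngle a b x) = ((b - a) / 2 * Real.cos x) ^ 2 := by
  have := Real.sin_sq_add_cos_sq x
  unfold wellAngle
  linear_combination ((b - a) / 2) ^ 2 * (-this)

namespace IsWell

variable {P P₁ p : ℝ → ℝ} {α β a b : ℝ}

/-- Divide the interpolation formula by `x - a` and let `x` tend to `a` from inside the well. -/
theorem dividedDiff_left (hP : IsC2On P P₁ p α β) (hw : IsWell P P₁ a b)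
    (ha : a ∈ Set.Icc α β) (hb : b ∈ Set.Icc α β) : P₁ a = -((b - a) * dividedDiff p a b a) := by
  have hab := hw.lt
  have hsub : Set.Icc a b ⊆ Set.Icc α β := Set.Icc_subset_Icc ha.1 hb.2
  have hc : Continuous fun x => (b - x) * dividedDiff p a b x := by
    have := (continuous_dividedDiff hP.cont).comp
      (f := fun x : ℝ => (a, b, x)) (by fun_prop)
    exact (continuous_const.sub continuous_id).mul this
  have h1 : Tendsto (slope P a) (𝓝[>] a) (𝓝 (P₁ a)) :=
    (hasDerivAt_iff_tendsto_slope.1 (hP.d1 a ha)).mono_left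
      (nhdsWithin_mono _ fun x hx => ne_of_gt hx)
  have h2 : Tendsto (fun x => -((b - x) * dividedDiff p a b x)) (𝓝[>] a)
      (𝓝 (-((b - a) * dividedDiff p a b a))) :=
    (hc.neg.tendsto a).mono_left nhdsWithin_le_nhds
  refine tendsto_nhds_unique (h1.congr' ?_) h2
  filter_upwards [Ioo_mem_nhdsGT hab] with x hx
  have := dividedDiff_spec hP.cont ha hb (hsub (Set.Ioo_subset_Icc_self hx)) hab.ne
    hP.d1 hP.d2 hw.eq
  have hne : x - a ≠ 0 := sub_ne_zero.2 hx.1.ne'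
  rw [slope_def_field, div_eq_iff hne]
  linear_combination -this

theorem dividedDiff_right (hP : IsC2On P P₁ p α β) (hw : IsWell P P₁ a b)
    (ha : a ∈ Set.Icc α β) (hb : b ∈ Set.Icc α β) : P₁ b = (b - a) * dividedDiff p a b b := by
  have hab := hw.lt
  have hsub : Set.Icc a b ⊆ Set.Icc α β := Set.Icc_subset_Icc ha.1 hb.2
  have hc : Continuous fun x => (x - a) * dividedDiff p a b x := by
    have := (continuous_dividedDiff hP.cont).comp
      (f := fun x : ℝ => (a, b, x)) (by fun_prop)
    exact (continuous_id.sub continuous_const).mul this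
  have h1 : Tendsto (slope P b) (𝓝[<] b) (𝓝 (P₁ b)) :=
    (hasDerivAt_iff_tendsto_slope.1 (hP.d1 b hb)).mono_left
      (nhdsWithin_mono _ fun x hx => ne_of_lt hx)
  have h2 : Tendsto (fun x => (x - a) * dividedDiff p a b x) (𝓝[<] b)
      (𝓝 ((b - a) * dividedDiff p a b b)) :=
    (hc.tendsto b).mono_left nhdsWithin_le_nhds
  refine tendsto_nhds_unique (h1.congr' ?_) h2
  filter_upwards [Ioo_mem_nhdsLT hab] with x hx
  have := dividedDiff_spec hP.cont ha hb (hsub (Set.Ioo_subset_Icc_self hx)) hab.ne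
    hP.d1 hP.d2 hw.eq
  have hne : x - b ≠ 0 := sub_ne_zero.2 hx.2.ne
  rw [slope_def_field, div_eq_iff hne, ← hw.eq]
  linear_combination -this

/-- Inside, positivity comes from `P x < P a`; at the ends, from the nonzero derivatives. The
density is thus regular at the turning points too. -/
theorem dividedDiff_pos (hP : IsC2On P P₁ p α β) (hw : IsWell P P₁ a b)
    (ha : a ∈ Set.Icc α β) (hb : b ∈ Set.Icc α β) {x : ℝ} (hx : x ∈ Set.Icc a b) :
    0 < dividedDiff p a b x := by
  have hab := hw.lt
  have hba : 0 < b - a := sub_pos.2 hab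
  have hsub : Set.Icc a b ⊆ Set.Icc α β := Set.Icc_subset_Icc ha.1 hb.2
  rcases eq_or_lt_of_le hx.1 with rfl | h1
  · have := hw.dividedDiff_left hP ha hb
    have h3 := hw.neg
    rw [this] at h3
    exact (pos_iff_pos_of_mul_pos (neg_lt_zero.1 h3)).1 hba
  rcases eq_or_lt_of_le hx.2 with rfl | h2
  · have := hw.dividedDiff_right hP ha hb
    have h3 := hw.pos
    rw [this] at h3
    exact (pos_iff_pos_of_mul_pos h3).1 hba
  · have h3 := dividedDiff_spec hP.cont ha hb (hsub hx) hab.ne hP.d1 hP.d2 hw.eq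
    have h4 : 0 < P a - P x := sub_pos.2 (hw.below x ⟨h1, h2⟩)
    rw [h3] at h4
    exact (pos_iff_pos_of_mul_pos h4).1 (mul_pos (sub_pos.2 h1) (sub_pos.2 h2))

theorem energy (hP : IsC2On P P₁ p α β) (hw : IsWell P P₁ a b)
    (ha : a ∈ Set.Icc α β) (hb : b ∈ Set.Icc α β) (x : ℝ) :
    P a - P (wellAngle a b x) =
      ((b - a) / 2 * Real.cos x) ^ 2 * dividedDiff p a b (wellAngle a b x) := by
  rw [← wellAngle_mul]
  exact dividedDiff_spec hP.cont ha hb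
    (Set.Icc_subset_Icc ha.1 hb.2 (wellAngle_mem hw.lt x)) hw.lt.ne hP.d1 hP.d2 hw.eq

theorem wellDensity_pos (hP : IsC2On P P₁ p α β) (hw : IsWell P P₁ a b)
    (ha : a ∈ Set.Icc α β) (hb : b ∈ Set.Icc α β) (x : ℝ) : 0 < wellDensity p a b x := by
  have := hw.dividedDiff_pos hP ha hb (wellAngle_mem hw.lt x)
  unfold wellDensity
  positivity

theorem continuous_wellDensity (hP : IsC2On P P₁ p α β) (hw : IsWell P P₁ a b)
    (ha : a ∈ Set.Icc α β) (hb : b ∈ Set.Icc α β) : Continuous (wellDensity p a b) := by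
  have h1 := (continuous_dividedDiff hP.cont).comp
    (f := fun x : ℝ => (a, b, wellAngle a b x)) (by unfold wellAngle; fun_prop)
  refine Continuous.inv₀ (Continuous.sqrt (continuous_const.mul h1)) fun x => ?_
  have := hw.dividedDiff_pos hP ha hb (wellAngle_mem hw.lt x)
  exact (Real.sqrt_pos.2 (by positivity)).ne'

/-- The velocity is `±√(2 (P a - P))` with the sign of `cos`, so away from the turning points the
energy relation can be differentiated. Where `cos x = 0` only the factor `cos` need be
differentiable, and the end derivatives of `P` supply the value. -/
theorem hasDerivAt_velocity (hP : IsC2On P P₁ p α β) (hw : IsWell P P₁ a b)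
    (ha : a ∈ Set.Icc α β) (hb : b ∈ Set.Icc α β) (x : ℝ) :
    HasDerivAt (fun x => (b - a) / 2 * Real.cos x * √(2 * dividedDiff p a b (wellAngle a b x)))
      (-P₁ (wellAngle a b x) * wellDensity p a b x) x := by
  have hba : 0 < (b - a) / 2 := by have := hw.lt; linarith
  have hq : ∀ x, 0 < dividedDiff p a b (wellAngle a b x) := fun x =>
    hw.dividedDiff_pos hP ha hb (wellAngle_mem hw.lt x)
  have hmem : ∀ x, wellAngle a b x ∈ Set.Icc α β := fun x =>
    Set.Icc_subset_Icc ha.1 hb.2 (wellAngle_mem hw.lt x)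
  have hc1 : Continuous fun x => √(2 * dividedDiff p a b (wellAngle a b x)) :=
    Continuous.sqrt (continuous_const.mul ((continuous_dividedDiff hP.cont).comp
      (f := fun x : ℝ => (a, b, wellAngle a b x)) (by unfold wellAngle; fun_prop)))
  have hen : ∀ x, √(2 * (P a - P (wellAngle a b x))) =
      (b - a) / 2 * |Real.cos x| * √(2 * dividedDiff p a b (wellAngle a b x)) := fun x => by
    rw [hw.energy hP ha hb, show ∀ A B : ℝ, 2 * (A ^ 2 * B) = A ^ 2 * (2 * B) by intros; ring,
      Real.sqrt_mul (sq_nonneg _), Real.sqrt_sq_eq_abs, abs_mul, abs_of_pos hba]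
  have hdE : HasDerivAt (fun x => 2 * (P a - P (wellAngle a b x)))
      (2 * -(P₁ (wellAngle a b x) * ((b - a) / 2 * Real.cos x))) x :=
    ((((hP.d1 _ (hmem x)).comp x (hasDerivAt_wellAngle a b x)).const_sub (P a)).const_mul 2)
  have hs := Real.sqrt_pos.2 (mul_pos two_pos (hq x))
  rcases lt_trichotomy (Real.cos x) 0 with hcos | hcos | hcos
  · have hpos : 0 < 2 * (P a - P (wellAngle a b x)) := by
      rw [hw.energy hP ha hb]
      have h1 : (b - a) / 2 * Real.cos x ≠ 0 := mul_ne_zero hba.ne' hcos.ne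
      have := hq x
      positivity
    refine ((hdE.sqrt hpos.ne').neg.congr_of_eventuallyEq ?_).congr_deriv ?_
    · filter_upwards [Real.continuous_cos.continuousAt.eventually (gt_mem_nhds hcos)] with y hy
      rw [Pi.neg_apply, hen, abs_of_neg hy]
      ring
    · rw [hen, abs_of_neg hcos, wellDensity]
      have := hcos.ne
      have := hba.ne'
      have : b - a ≠ 0 := (sub_pos.2 hw.lt).ne'
      field_simp
  · have h0 : (fun x => (b - a) / 2 * Real.cos x) x = 0 := by simp [hcos]
    refine (((Real.hasDerivAt_cos x).const_mul ((b - a) / 2)).mul_of_eq_zero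
      hc1.continuousAt h0).congr_deriv ?_
    rw [wellDensity, eq_comm, ← div_eq_mul_inv, div_eq_iff hs.ne', mul_assoc,
      Real.mul_self_sqrt (mul_pos two_pos (hq x)).le]
    have hsin := Real.sin_sq_add_cos_sq x
    rw [hcos] at hsin
    have hsin2 : (Real.sin x - 1) * (Real.sin x + 1) = 0 := by linarith
    rcases mul_eq_zero.1 hsin2 with h | h
    · have e1 : Real.sin x = 1 := by linarith
      have e2 : wellAngle a b x = b := by rw [wellAngle, e1]; ring
      rw [e2, hw.dividedDiff_right hP ha hb, e1]
      ring
    · have e1 : Real.sin x = -1 := by linarith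
      have e2 : wellAngle a b x = a := by rw [wellAngle, e1]; ring
      rw [e2, hw.dividedDiff_left hP ha hb, e1]
      ring
  · have hpos : 0 < 2 * (P a - P (wellAngle a b x)) := by
      rw [hw.energy hP ha hb]
      have h1 : (b - a) / 2 * Real.cos x ≠ 0 := mul_ne_zero hba.ne' hcos.ne'
      have := hq x
      positivity
    refine ((hdE.sqrt hpos.ne').congr_of_eventuallyEq ?_).congr_deriv ?_
    · filter_upwards [Real.continuous_cos.continuousAt.eventually (lt_mem_nhds hcos)] with y hy
      rw [hen, abs_of_pos hy]
    · rw [hen, abs_of_pos hcos, wellDensity]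
      have := hcos.ne'
      have := hba.ne'
      have : b - a ≠ 0 := (sub_pos.2 hw.lt).ne'
      field_simp

theorem periodic_wellAngle (a b : ℝ) : Function.Periodic (wellAngle a b) (2 * Real.pi) :=
  fun x => by simp only [wellAngle, Real.sin_add_two_pi]

theorem periodic_wellDensity (p : ℝ → ℝ) (a b : ℝ) :
    Function.Periodic (wellDensity p a b) (2 * Real.pi) :=
  fun x => by simp only [wellDensity, periodic_wellAngle a b x]

/-- A lower bound for the period of the oscillations in a well. -/
theorem le_integral_wellDensity (hP : IsC2On P P₁ p α β) (hw : IsWell P P₁ a b)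
    (ha : a ∈ Set.Icc α β) (hb : b ∈ Set.Icc α β) {A k z : ℝ} (hA : 0 < A) (hk : 0 ≤ k)
    (hbd : ∀ x ∈ Set.Icc a b, 2 * (P a - P x) ≤ (A + k * |x - z|) ^ 2) :
    ∫ x in a..b, (A + k * |x - z|)⁻¹ ≤ ∫ x in (0:ℝ)..2 * Real.pi, wellDensity p a b x := by
  have hba : 0 < (b - a) / 2 := by have := hw.lt; linarith
  have hpos : ∀ x, 0 < A + k * |x - z| := fun x => by positivity
  have hGc := hw.continuous_wellDensity hP ha hb
  have hπ := Real.pi_pos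
  have hFc : Continuous fun x => (A + k * |x - z|)⁻¹ :=
    Continuous.inv₀ (by fun_prop) fun x => (hpos x).ne'
  -- The half period from `-π/2` to `π/2` is the passage from `a` to `b`, and a single passage is
  -- enough for the lower bound.
  have hsubst : ∫ x in (-(Real.pi / 2))..(Real.pi / 2),
      (A + k * |wellAngle a b x - z|)⁻¹ * ((b - a) / 2 * Real.cos x) =
      ∫ x in a..b, (A + k * |x - z|)⁻¹ := by
    have := intervalIntegral.integral_comp_mul_deriv (a := -(Real.pi / 2)) (b := Real.pi / 2)
      (f := wellAngle a b) (f' := fun x => (b - a) / 2 * Real.cos x)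
      (g := fun x => (A + k * |x - z|)⁻¹) (fun x _ => hasDerivAt_wellAngle a b x)
      (by fun_prop) hFc
    simp only [Function.comp_apply] at this
    rw [this]
    congr 1 <;> simp [wellAngle] <;> ring
  have hper : ∫ x in (0:ℝ)..2 * Real.pi, wellDensity p a b x =
      ∫ x in (-Real.pi)..Real.pi, wellDensity p a b x := by
    have := (periodic_wellDensity p a b).intervalIntegral_add_eq 0 (-Real.pi)
    rw [zero_add] at this
    rw [this]
    congr 1
    ring
  rw [← hsubst, hper]
  calc _ ≤ ∫ x in (-(Real.pi / 2))..(Real.pi / 2), wellDensity p a b x := by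
        refine intervalIntegral.integral_mono_on (by linarith) ?_ (hGc.intervalIntegrable _ _) ?_
        · refine Continuous.intervalIntegrable ?_ _ _
          have : Continuous (wellAngle a b) := by unfold wellAngle; fun_prop
          exact (hFc.comp this).mul (by fun_prop)
        · intro x hx
          have hcos := Real.cos_nonneg_of_mem_Icc hx
          have hq := hw.dividedDiff_pos hP ha hb (wellAngle_mem hw.lt x)
          have h1 := hbd _ (wellAngle_mem hw.lt x)
          rw [hw.energy hP ha hb] at h1
          have hs : 0 < √(2 * dividedDiff p a b (wellAngle a b x)) :=
            Real.sqrt_pos.2 (by positivity)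
          have hs2 := Real.sq_sqrt (show 0 ≤ 2 * dividedDiff p a b (wellAngle a b x) by positivity)
          rw [wellDensity, inv_mul_le_iff₀ (hpos _), ← div_eq_mul_inv, le_div_iff₀ hs]
          refine le_of_sq_le_sq ?_ (hpos _).le
          rw [mul_pow, hs2]
          linarith
    _ ≤ _ := by
        refine intervalIntegral.integral_mono_interval (by linarith) (by linarith) (by linarith)
          ?_ (hGc.intervalIntegrable _ _)
        exact Eventually.of_forall fun x => (hw.wellDensity_pos hP ha hb x).le

end IsWell

/-- The logarithmic divergence as `A → 0` expresses the slow passage near a critical point `z`. -/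
theorem integral_inv_add_mul_abs {A k z d : ℝ} (hA : 0 < A) (hk : 0 < k) (hd : 0 ≤ d) :
    ∫ x in z..z + d, (A + k * |x - z|)⁻¹ = Real.log (1 + k * d / A) / k := by
  have hpos : ∀ x ∈ Set.uIcc z (z + d), 0 < A + k * (x - z) := fun x hx => by
    rw [Set.uIcc_of_le (by linarith)] at hx
    have := mul_nonneg hk.le (sub_nonneg.2 hx.1)
    linarith
  have h1 : ∫ x in z..z + d, (A + k * |x - z|)⁻¹ = ∫ x in z..z + d, (A + k * (x - z))⁻¹ := by
    refine intervalIntegral.integral_congr fun x hx => ?_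
    rw [Set.uIcc_of_le (by linarith)] at hx
    simp only [abs_of_nonneg (sub_nonneg.2 hx.1)]
  have hd : ∀ x ∈ Set.uIcc z (z + d),
      HasDerivAt (fun x => Real.log (A + k * (x - z)) / k) (A + k * (x - z))⁻¹ x := by
    intro x hx
    have h2 : HasDerivAt (fun x => A + k * (x - z)) k x := by
      simpa using (((hasDerivAt_id x).sub_const z).const_mul k).const_add A
    refine ((h2.log (hpos x hx).ne').div_const k).congr_deriv ?_
    field_simp
  have hint : IntervalIntegrable (fun x => (A + k * (x - z))⁻¹) MeasureTheory.volume z (z + d) :=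
    (ContinuousOn.inv₀ (by fun_prop) fun x hx => (hpos x hx).ne').intervalIntegrable
  rw [h1, intervalIntegral.integral_eq_sub_of_hasDerivAt hd hint]
  simp only [add_sub_cancel_left, sub_self, mul_zero, add_zero]
  rw [← sub_div, ← Real.log_div (by positivity) hA.ne', add_div, div_self hA.ne']

theorem integral_inv_add_mul_abs' {A k z d : ℝ} (hA : 0 < A) (hk : 0 < k) (hd : 0 ≤ d) :
    ∫ x in z - d..z, (A + k * |x - z|)⁻¹ = Real.log (1 + k * d / A) / k := by
  rw [← integral_inv_add_mul_abs (z := z) hA hk hd]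
  have := intervalIntegral.integral_comp_sub_left (a := z - d) (b := z)
    (fun x => (A + k * |x - z|)⁻¹) (2 * z)
  rw [show 2 * z - (z - d) = z + d by ring, show 2 * z - z = z by ring] at this
  rw [← this]
  congr 1
  funext x
  rw [← abs_neg (x - z)]
  congr 4
  ring

/-- Second-order Taylor estimate at a critical point. -/
theorem abs_sub_le_of_abs_deriv_deriv_le {P P₁ p : ℝ → ℝ} {M x z : ℝ}
    (h0 : P₁ z = 0)
    (d1 : ∀ y ∈ Set.uIcc z x, HasDerivAt P (P₁ y) y)
    (d2 : ∀ y ∈ Set.uIcc z x, HasDerivAt P₁ (p y) y)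
    (hM : ∀ y ∈ Set.uIcc z x, |p y| ≤ M) : |P x - P z| ≤ M * (x - z) ^ 2 := by
  have hM0 : 0 ≤ M := (abs_nonneg _).trans (hM z Set.left_mem_uIcc)
  have e1 : ∀ y ∈ Set.uIcc z x, |P₁ y| ≤ M * |x - z| := by
    intro y hy
    have hsub : Set.uIcc z y ⊆ Set.uIcc z x := Set.uIcc_subset_uIcc Set.left_mem_uIcc hy
    have := (convex_uIcc z y).norm_image_sub_le_of_norm_hasDerivWithin_le (C := M)
      (fun w hw => (d2 w (hsub hw)).hasDerivWithinAt) (fun w hw => hM w (hsub hw))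
      Set.left_mem_uIcc Set.right_mem_uIcc
    rw [h0, sub_zero, Real.norm_eq_abs, Real.norm_eq_abs] at this
    exact this.trans (mul_le_mul_of_nonneg_left (Set.abs_sub_left_of_mem_uIcc hy) hM0)
  have := (convex_uIcc z x).norm_image_sub_le_of_norm_hasDerivWithin_le (C := M * |x - z|)
    (fun w hw => (d1 w hw).hasDerivWithinAt) e1 Set.left_mem_uIcc Set.right_mem_uIcc
  rwa [Real.norm_eq_abs, Real.norm_eq_abs, mul_assoc, abs_mul_abs_self, ← sq] at this

namespace IsWell

variable {P P₁ p : ℝ → ℝ} {α β : ℝ}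

/-- The highest critical level inside a well, together with the part of the well below it. -/
theorem exists_critical_level (hP : IsC2On P P₁ p α β) (hw : IsWell P P₁ α β) :
    ∃ a z b : ℝ, α < a ∧ a ≤ z ∧ z ≤ b ∧ b < β ∧ P a = P z ∧ P b = P z ∧ P₁ z = 0 ∧
      (∀ x ∈ Set.Ico α a, P₁ x < 0) ∧ (∀ x ∈ Set.Ioc b β, 0 < P₁ x) ∧
      (∀ x ∈ Set.Icc a b, P x ≤ P z) := by
  have hαβ := hw.lt
  have hPc : ContinuousOn P (Set.Icc α β) := fun x hx => (hP.d1 x hx).continuousAt.continuousWithinAt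
  have hP₁c : ContinuousOn P₁ (Set.Icc α β) := fun x hx =>
    (hP.d2 x hx).continuousAt.continuousWithinAt
  obtain ⟨z, ⟨hz, hz0⟩, hzmax⟩ : ∃ z ∈ Set.Icc α β ∩ P₁ ⁻¹' {0},
      IsMaxOn P (Set.Icc α β ∩ P₁ ⁻¹' {0}) z := by
    have hcl : IsClosed (Set.Icc α β ∩ P₁ ⁻¹' {0}) :=
      hP₁c.preimage_isClosed_of_isClosed isClosed_Icc isClosed_singleton
    refine (isCompact_Icc.of_isClosed_subset hcl Set.inter_subset_left).exists_isMaxOn ?_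
      (hPc.mono Set.inter_subset_left)
    obtain ⟨x, hx, hx0⟩ := intermediate_value_Icc hαβ.le hP₁c ⟨hw.neg.le, hw.pos.le⟩
    exact ⟨x, hx, hx0⟩
  have hz0 : P₁ z = 0 := hz0
  have hcrit : ∀ x ∈ Set.Icc α β, P₁ x = 0 → P x ≤ P z := fun x hx h => hzmax ⟨hx, h⟩
  have hzα : α < z := lt_of_le_of_ne hz.1 (by rintro rfl; exact hw.neg.ne hz0)
  have hzβ : z < β := lt_of_le_of_ne hz.2 (by rintro rfl; exact hw.pos.ne' hz0)
  have hlow : P z < P α := hw.below z ⟨hzα, hzβ⟩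
  have hcl : IsClosed (Set.Icc α β ∩ P ⁻¹' Set.Iic (P z)) :=
    hPc.preimage_isClosed_of_isClosed isClosed_Icc isClosed_Iic
  have hcpt := isCompact_Icc.of_isClosed_subset hcl Set.inter_subset_left
  have hzmem : z ∈ Set.Icc α β ∩ P ⁻¹' Set.Iic (P z) := ⟨hz, le_refl (P z)⟩
  -- `a` and `b` are the extreme points of `{P ≤ P z}`. Beyond them `P` exceeds the highest critical
  -- level, so `P₁` has no zero there and keeps its sign from the ends.
  obtain ⟨a, ⟨ha, haz⟩, hamin⟩ := hcpt.exists_isLeast ⟨z, hzmem⟩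
  obtain ⟨b, ⟨hb, hbz⟩, hbmax⟩ := hcpt.exists_isGreatest ⟨z, hzmem⟩
  have haz' : a ≤ z := hamin hzmem
  have hzb : z ≤ b := hbmax hzmem
  simp only [Set.mem_preimage, Set.mem_Iic] at haz hbz
  have hαa : α < a := lt_of_le_of_ne ha.1 (by rintro rfl; linarith)
  have hbβ : b < β := lt_of_le_of_ne hb.2 (by rintro rfl; have := hw.eq; linarith)
  have hgtl : ∀ x ∈ Set.Ico α a, P z < P x := fun x hx => by
    by_contra! h
    exact absurd (hamin ⟨⟨hx.1, hx.2.le.trans ha.2⟩, h⟩) (not_le.2 hx.2)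
  have hgtr : ∀ x ∈ Set.Ioc b β, P z < P x := fun x hx => by
    by_contra! h
    exact absurd (hbmax ⟨⟨hb.1.trans hx.1.le, hx.2⟩, h⟩) (not_le.2 hx.1)
  have hPa : P a = P z := by
    refine le_antisymm haz ?_
    refine le_of_tendsto_of_tendsto (b := 𝓝[<] a) tendsto_const_nhds
      ((hP.d1 a ha).continuousAt.tendsto.mono_left nhdsWithin_le_nhds) ?_
    filter_upwards [Ioo_mem_nhdsLT hαa] with x hx using (hgtl x ⟨hx.1.le, hx.2⟩).le
  have hPb : P b = P z := by
    refine le_antisymm hbz ?_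
    refine le_of_tendsto_of_tendsto (b := 𝓝[>] b) tendsto_const_nhds
      ((hP.d1 b hb).continuousAt.tendsto.mono_left nhdsWithin_le_nhds) ?_
    filter_upwards [Ioo_mem_nhdsGT hbβ] with x hx using (hgtr x ⟨hx.1, hx.2.le⟩).le
  refine ⟨a, z, b, hαa, haz', hzb, hbβ, hPa, hPb, hz0, fun x hx => ?_, fun x hx => ?_,
    fun x hx => ?_⟩
  · by_contra! h
    have hsub : Set.Icc α x ⊆ Set.Icc α β := Set.Icc_subset_Icc le_rfl (hx.2.le.trans ha.2)
    obtain ⟨y, hy, hy0⟩ := intermediate_value_Icc hx.1 (hP₁c.mono hsub) ⟨hw.neg.le, h⟩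
    exact absurd (hcrit y (hsub hy) hy0) (not_le.2 (hgtl y ⟨hy.1, hy.2.trans_lt hx.2⟩))
  · by_contra! h
    have hsub : Set.Icc x β ⊆ Set.Icc α β := Set.Icc_subset_Icc (hb.1.trans hx.1.le) le_rfl
    obtain ⟨y, hy, hy0⟩ := intermediate_value_Icc hx.2 (hP₁c.mono hsub) ⟨h, hw.pos.le⟩
    exact absurd (hcrit y (hsub hy) hy0) (not_le.2 (hgtr y ⟨hx.1.trans_le hy.1, hy.2⟩))
  · have hsub : Set.Icc a b ⊆ Set.Icc α β := Set.Icc_subset_Icc ha.1 hb.2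
    obtain ⟨y, hy, hymax⟩ := isCompact_Icc.exists_isMaxOn ⟨z, haz', hzb⟩ (hPc.mono hsub)
    refine (hymax hx).trans ?_
    rcases eq_or_lt_of_le hy.1 with h | h
    · exact (h ▸ hPa).le
    rcases eq_or_lt_of_le hy.2 with h' | h'
    · exact (h' ▸ hPb).le
    · refine hcrit y (hsub hy) ?_
      have hloc : IsLocalMax P y := by
        filter_upwards [Icc_mem_nhds h h'] with w hw using hymax hw
      exact hloc.hasDerivAt_eq_zero (hP.d1 y (hsub hy))

/-- If the periods of the oscillations in all wells inside a given one are commensurable with `2π`,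
then the well contains a nondegenerate critical point. -/
theorem exists_nondegenerate (hP : IsC2On P P₁ p α β) (hw : IsWell P P₁ α β) {D : Set ℝ}
    (hD : D.Countable)
    (hper : ∀ a b, a ∈ Set.Icc α β → b ∈ Set.Icc α β → IsWell P P₁ a b →
      ∫ x in (0:ℝ)..2 * Real.pi, wellDensity p a b x ∈ D) :
    ∃ z ∈ Set.Icc α β, P₁ z = 0 ∧ 0 < p z := by
  obtain ⟨a₀, z, b₀, hαa, haz, hzb, hbβ, hPa, hPb, hz0, hneg, hpos, hle⟩ :=
    hw.exists_critical_level hP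
  have hPc : ContinuousOn P (Set.Icc α β) := fun x hx => (hP.d1 x hx).continuousAt.continuousWithinAt
  have hzmem : z ∈ Set.Icc α β := ⟨hαa.le.trans haz, hzb.trans hbβ.le⟩
  have hsubl : Set.Icc α a₀ ⊆ Set.Icc α β := Set.Icc_subset_Icc le_rfl (haz.trans hzmem.2)
  have hsubr : Set.Icc b₀ β ⊆ Set.Icc α β := Set.Icc_subset_Icc (hzmem.1.trans hzb) le_rfl
  have hanti : StrictAntiOn P (Set.Icc α a₀) := by
    refine strictAntiOn_of_deriv_neg (convex_Icc _ _) (hPc.mono hsubl) fun x hx => ?_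
    rw [interior_Icc] at hx
    rw [(hP.d1 x (hsubl (Set.Ioo_subset_Icc_self hx))).deriv]
    exact hneg x ⟨hx.1.le, hx.2⟩
  have hmono : StrictMonoOn P (Set.Icc b₀ β) := by
    refine strictMonoOn_of_deriv_pos (convex_Icc _ _) (hPc.mono hsubr) fun x hx => ?_
    rw [interior_Icc] at hx
    rw [(hP.d1 x (hsubr (Set.Ioo_subset_Icc_self hx))).deriv]
    exact hpos x ⟨hx.1, hx.2.le⟩
  -- `g (P a)` is the right end of the smaller well whose left end is `a`.
  obtain ⟨g, hgc, hg⟩ := hmono.exists_continuousOn_inverse hbβ (hPc.mono hsubr)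
  have hPX : ∀ a ∈ Set.Ioo α a₀, P a ∈ Set.Ioo (P b₀) (P β) := fun a ha => by
    rw [hPb, ← hPa, ← hw.eq]
    exact ⟨hanti (Set.Ioo_subset_Icc_self ha) ⟨hαa.le, le_rfl⟩ ha.2,
      hanti ⟨le_rfl, hαa.le⟩ (Set.Ioo_subset_Icc_self ha) ha.1⟩
  have hmemα : ∀ a ∈ Set.Ioo α a₀, a ∈ Set.Icc α β := fun a ha =>
    hsubl (Set.Ioo_subset_Icc_self ha)
  have hmemβ : ∀ a ∈ Set.Ioo α a₀, g (P a) ∈ Set.Icc α β := fun a ha =>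
    hsubr (Set.Ioo_subset_Icc_self (hg _ (hPX a ha)).1)
  have hwell : ∀ a ∈ Set.Ioo α a₀, IsWell P P₁ a (g (P a)) := by
    intro a ha
    obtain ⟨hga, hPg⟩ := hg _ (hPX a ha)
    refine ⟨by linarith [ha.2, hga.1], hPg.symm, fun x hx => ?_, hneg a ⟨ha.1.le, ha.2⟩,
      hpos _ ⟨hga.1, hga.2.le⟩⟩
    rcases le_or_gt x a₀ with h1 | h1
    · exact hanti (Set.Ioo_subset_Icc_self ha) ⟨ha.1.le.trans hx.1.le, h1⟩ hx.1
    rcases le_or_gt x b₀ with h2 | h2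
    · refine (hle x ⟨h1.le, h2⟩).trans_lt ?_
      rw [← hPb]; exact (hPX a ha).1
    · rw [← hPg]
      exact hmono ⟨h2.le, hx.2.le.trans hga.2.le⟩ (Set.Ioo_subset_Icc_self hga) hx.2
  -- the period does not depend on the well
  have hconst : ∀ a ∈ Set.Ioo α a₀, ∀ a' ∈ Set.Ioo α a₀,
      ∫ x in (0:ℝ)..2 * Real.pi, wellDensity p a (g (P a)) x =
        ∫ x in (0:ℝ)..2 * Real.pi, wellDensity p a' (g (P a')) x := by
    intro a ha a' ha'
    have hgP : ContinuousOn (fun a => g (P a)) (Set.Ioo α a₀) :=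
      hgc.comp (hPc.mono hmemα) hPX
    have hgP' : Continuous fun a : Set.Ioo α a₀ => g (P a) := hgP.domRestrict
    have hT : Continuous fun a : Set.Ioo α a₀ =>
        ∫ x in (0:ℝ)..2 * Real.pi, wellDensity p a (g (P a)) x := by
      apply intervalIntegral.continuous_parametric_intervalIntegral_of_continuous'
      have c1 : Continuous fun y : Set.Ioo α a₀ × ℝ => (y.1 : ℝ) :=
        continuous_subtype_val.comp continuous_fst
      have c2 : Continuous fun y : Set.Ioo α a₀ × ℝ => g (P y.1) := hgP'.comp continuous_fst
      have h1 := (continuous_dividedDiff hP.cont).comp (f := fun y : Set.Ioo α a₀ × ℝ =>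
        ((y.1 : ℝ), g (P y.1), wellAngle y.1 (g (P y.1)) y.2)) 
        (c1.prodMk (c2.prodMk (((c1.add c2).div_const 2).add
          (((c2.sub c1).div_const 2).mul (Real.continuous_sin.comp continuous_snd)))))
      refine Continuous.inv₀ (Continuous.sqrt (continuous_const.mul h1)) fun y => ?_
      have := (hwell y.1 y.1.2).dividedDiff_pos hP (hmemα _ y.1.2) (hmemβ _ y.1.2)
        (wellAngle_mem (hwell y.1 y.1.2).lt y.2)
      exact (Real.sqrt_pos.2 (mul_pos two_pos this)).ne'
    have : PreconnectedSpace (Set.Ioo α a₀) := Subtype.preconnectedSpace isPreconnected_Ioo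
    exact isPreconnected_univ.eq_of_countable_image hT.continuousOn hD
      (fun a _ => hper _ _ (hmemα _ a.2) (hmemβ _ a.2) (hwell _ a.2))
      (Set.mem_univ ⟨a, ha⟩) (Set.mem_univ ⟨a', ha'⟩)
  obtain ⟨T, hT⟩ : ∃ T, ∀ a ∈ Set.Ioo α a₀,
      ∫ x in (0:ℝ)..2 * Real.pi, wellDensity p a (g (P a)) x = T :=
    ⟨_, fun a ha => hconst a ha ((α + a₀) / 2) ⟨by linarith, by linarith⟩⟩
  have hev : ∀ᶠ a in 𝓝[<] a₀, a ∈ Set.Ioo α a₀ := Ioo_mem_nhdsLT hαa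
  have hPlim : Tendsto P (𝓝[<] a₀) (𝓝 (P z)) := by
    rw [← hPa]
    exact (hP.d1 a₀ (hsubl ⟨hαa.le, le_rfl⟩)).continuousAt.tendsto.mono_left nhdsWithin_le_nhds
  by_cases hdeg : a₀ = b₀ ∧ 0 < p z
  · exact ⟨z, hzmem, hz0, hdeg.2⟩
  exfalso
  rcases eq_or_lt_of_le (haz.trans hzb) with hab | hab
  · -- a degenerate minimum
    have hza : z = a₀ := le_antisymm (hab ▸ hzb) haz
    have hp0 : p z ≤ 0 := not_lt.1 fun h => hdeg ⟨hab, h⟩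
    have hp0' : 0 ≤ p z := by
      have h1 : Tendsto (slope P₁ z) (𝓝[<] z) (𝓝 (p z)) :=
        (hasDerivAt_iff_tendsto_slope.1 (hP.d2 z hzmem)).mono_left
          (nhdsWithin_mono _ fun x hx => ne_of_lt hx)
      refine ge_of_tendsto h1 ?_
      rw [hza]
      filter_upwards [hev] with x hx
      rw [slope_def_field, ← hza, hz0, sub_zero]
      exact div_nonneg_of_nonpos (hneg x ⟨hx.1.le, hx.2⟩).le (by linarith [hx.2])
    have hpz : p z = 0 := le_antisymm hp0 hp0'
    -- Chosen so that the speed on the well is at most `(z - a) / (|T| + 1)`: going from `a` to `z`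
    -- alone then takes at least `|T| + 1`, more than the period `T`.
    have hδ : 0 < 1 / (2 * (|T| + 1) ^ 2) := by positivity
    obtain ⟨ε, hε, hball⟩ := Metric.continuousAt_iff.1 (hP.cont.continuousAt (x := z)) _ hδ
    have hev2 : ∀ᶠ a in 𝓝[<] a₀, a ∈ Set.Ioo (z - ε) a₀ := Ioo_mem_nhdsLT (by linarith)
    obtain ⟨a, ha, ha'⟩ := (hev.and hev2).exists
    have hga := (hg _ (hPX a ha)).1
    have hza' : 0 < z - a := by linarith [ha.2]
    have hA : 0 < (z - a) / (|T| + 1) := by positivity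
    have hmin : ∀ x ∈ Set.Icc α β, P z ≤ P x := by
      intro x hx
      rcases le_total x z with h | h
      · rw [hza] at h ⊢
        exact hanti.antitoneOn ⟨hx.1, h⟩ ⟨hαa.le, le_rfl⟩ h
      · have hzb' : z = b₀ := hza.trans hab
        rw [hzb'] at h ⊢
        exact hmono.monotoneOn ⟨le_rfl, hbβ.le⟩ ⟨h, hx.2⟩ h
    have hPa' : P a - P z ≤ 1 / (2 * (|T| + 1) ^ 2) * (a - z) ^ 2 := by
      have hsub : Set.uIcc z a ⊆ Set.Icc α β :=
        Set.ordConnected_Icc.uIcc_subset hzmem (hmemα a ha)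
      refine (le_abs_self _).trans (abs_sub_le_of_abs_deriv_deriv_le hz0
        (fun y hy => hP.d1 y (hsub hy)) (fun y hy => hP.d2 y (hsub hy)) fun y hy => ?_)
      have h1 := Set.abs_sub_left_of_mem_uIcc hy
      rw [abs_of_neg (by linarith : a - z < 0)] at h1
      have h2 := hball (x := y) (by rw [Real.dist_eq]; linarith [ha'.1])
      rw [Real.dist_eq, hpz, sub_zero] at h2
      exact h2.le
    have hTa := (hwell a ha).le_integral_wellDensity hP (hmemα a ha) (hmemβ a ha) (z := z)
      hA le_rfl (fun x hx => by
        have hxm := hmin x ⟨(hmemα a ha).1.trans hx.1, hx.2.trans (hmemβ a ha).2⟩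
        have e : ((z - a) / (|T| + 1) + 0 * |x - z|) ^ 2 =
            2 * (1 / (2 * (|T| + 1) ^ 2) * (a - z) ^ 2) := by
          field_simp
          ring
        rw [e]
        linarith)
    rw [hT a ha] at hTa
    simp only [zero_mul, add_zero, intervalIntegral.integral_const, smul_eq_mul] at hTa
    have h3 : (z - a) * ((z - a) / (|T| + 1))⁻¹ ≤ (g (P a) - a) * ((z - a) / (|T| + 1))⁻¹ :=
      mul_le_mul_of_nonneg_right (by linarith [hga.1]) (by positivity)
    have h4 : (z - a) * ((z - a) / (|T| + 1))⁻¹ = |T| + 1 := by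
      field_simp
    have := le_abs_self T
    linarith
  · -- a critical point on the boundary of the limit well
    obtain ⟨M, hM⟩ := (isCompact_Icc (a := α) (b := β)).bddAbove_image
      (f := fun x => |p x|) (hP.cont.abs.continuousOn)
    have hM' : ∀ x ∈ Set.Icc α β, |p x| ≤ M := fun x hx => hM ⟨x, hx, rfl⟩
    have hM0 : 0 ≤ M := (abs_nonneg _).trans (hM' z hzmem)
    -- `k² ≥ 2M` bounds the speed by `A + k |x - z|`; the summand `1` keeps `k` positive when `M =
    -- 0`.
    set k := √(2 * M) + 1 with hkdef
    have hk : 0 < k := by positivity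
    have hkM : 2 * M ≤ k ^ 2 := by
      have := Real.sq_sqrt (show 0 ≤ 2 * M by positivity)
      have := Real.sqrt_nonneg (2 * M)
      nlinarith
    -- On at least one side of `z` every well considered extends by at least this width.
    set w := (b₀ - a₀) / 2 with hw'
    have hw0 : 0 < w := by linarith
    -- This is `log (1 + k w / A) / k ≤ T` solved for `A`. It fails as `a` tends to `a₀`, since then
    -- `A` tends to `0`.
    have key : ∀ a ∈ Set.Ioo α a₀, k * w ≤ √(2 * (P a - P z)) * Real.exp (k * T) := by
      intro a ha
      have hη : 0 < P a - P z := by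
        have := (hPX a ha).1
        rw [hPb] at this
        linarith
      have hA : 0 < √(2 * (P a - P z)) := Real.sqrt_pos.2 (by linarith)
      have hA2 := Real.sq_sqrt (show 0 ≤ 2 * (P a - P z) by linarith)
      set A := √(2 * (P a - P z))
      have hga := (hg _ (hPX a ha)).1
      have hTa := (hwell a ha).le_integral_wellDensity hP (hmemα a ha) (hmemβ a ha) (z := z)
        hA hk.le (fun x hx => by
          have hxm : x ∈ Set.Icc α β :=
            ⟨(hmemα a ha).1.trans hx.1, hx.2.trans (hmemβ a ha).2⟩
          have hsub : Set.uIcc z x ⊆ Set.Icc α β := Set.ordConnected_Icc.uIcc_subset hzmem hxm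
          have h1 := abs_sub_le_of_abs_deriv_deriv_le hz0 (fun y hy => hP.d1 y (hsub hy))
            (fun y hy => hP.d2 y (hsub hy)) (fun y hy => hM' y (hsub hy))
          have h2 := neg_abs_le (P x - P z)
          have h3 : k ^ 2 * |x - z| ^ 2 = k ^ 2 * (x - z) ^ 2 := by rw [sq_abs]
          have h4 : 0 ≤ A * k * |x - z| := by positivity
          have h5 := mul_le_mul_of_nonneg_right hkM (sq_nonneg (x - z))
          nlinarith)
      rw [hT a ha] at hTa
      have hpos : ∀ x, 0 < A + k * |x - z| := fun x => by positivity
      have hc : Continuous fun x => (A + k * |x - z|)⁻¹ :=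
        Continuous.inv₀ (by fun_prop) fun x => (hpos x).ne'
      have hsubint : ∀ c d, a ≤ c → c ≤ d → d ≤ g (P a) →
          ∫ x in c..d, (A + k * |x - z|)⁻¹ ≤ T := fun c d h1 h2 h3 =>
        (intervalIntegral.integral_mono_interval h1 h2 h3
          (Eventually.of_forall fun x => (inv_pos.2 (hpos x)).le)
          (hc.intervalIntegrable _ _)).trans hTa
      have hlog : Real.log (1 + k * w / A) / k ≤ T := by
        rcases le_total z ((a₀ + b₀) / 2) with h | h
        · rw [← integral_inv_add_mul_abs (z := z) hA hk hw0.le]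
          exact hsubint _ _ (by linarith [ha.2]) (by linarith) (by linarith [hga.1])
        · rw [← integral_inv_add_mul_abs' (z := z) hA hk hw0.le]
          exact hsubint _ _ (by linarith [ha.2]) (by linarith) (by linarith [hga.1])
      rw [div_le_iff₀ hk, mul_comm T k, Real.log_le_iff_le_exp (by positivity)] at hlog
      have h6 : k * w / A ≤ Real.exp (k * T) := by linarith
      rw [div_le_iff₀ hA] at h6
      linarith
    have hlim : Tendsto (fun a => √(2 * (P a - P z)) * Real.exp (k * T)) (𝓝[<] a₀)
        (𝓝 (√(2 * (P z - P z)) * Real.exp (k * T))) :=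
      (((hPlim.sub_const (P z)).const_mul 2).sqrt).mul_const _
    have h7 := ge_of_tendsto hlim (hev.mono key)
    simp only [sub_self, mul_zero, Real.sqrt_zero, zero_mul] at h7
    have : 0 < k * w := by positivity
    linarith

end IsWell

/-! ### Semilocally closing potentials have a strongly stable circular orbit -/

namespace RevolutionSurface

variable {S : RevolutionSurface} {V : ℝ → ℝ} {K : ℝ}

namespace Chart

variable {C : Chart S}

theorem radial_acceleration (C : Chart S) (hV : S.IsPotential V) (hK : K ≠ 0) {J : Set ℝ} {r φ : ℝ → ℝ}
    (sol : S.IsSolutionOn V J r φ) (mom : S.HasMomentumOn J r φ K) {t : ℝ} (ht : t ∈ J) :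
    HasDerivAt (deriv r) (-deriv (S.effPotential V K) (r t)) t := by
  have h := sol.radial t ht
  rw [sol.deriv_φ mom ht, force_eq (C := C) hV (sol.mem t ht) hK] at h
  rw [(hasDerivAt_effPotential (C := C) hV (sol.mem t ht) hK).deriv]
  exact h.congr_deriv (by ring)

theorem hasDerivAt_energy (C : Chart S) (hV : S.IsPotential V) (hK : K ≠ 0) {J : Set ℝ} {r φ : ℝ → ℝ}
    (sol : S.IsSolutionOn V J r φ) (mom : S.HasMomentumOn J r φ K) {t : ℝ} (ht : t ∈ J) :
    HasDerivAt (fun t => deriv r t ^ 2 / 2 + S.effPotential V K (r t)) 0 t := by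
  have h1 := C.radial_acceleration hV hK sol mom ht
  have h2 := (hasDerivAt_effPotential (C := C) hV (sol.mem t ht) hK)
  rw [← h2.deriv] at *
  exact (((h1.pow 2).div_const 2).add (h2.differentiableAt.hasDerivAt.comp t
    (sol.diff_r t ht).hasDerivAt)).congr_deriv (by norm_num; ring)

theorem energy_eq (C : Chart S) (hV : S.IsPotential V) (hK : K ≠ 0) {r φ : ℝ → ℝ}
    (bd : S.IsBoundedTrajectory V r φ K) (t t' : ℝ) :
    deriv r t ^ 2 / 2 + S.effPotential V K (r t) =
      deriv r t' ^ 2 / 2 + S.effPotential V K (r t') :=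
  is_const_of_deriv_eq_zero
    (fun t => (C.hasDerivAt_energy hV hK bd.sol bd.momentum (Set.mem_univ t)).differentiableAt)
    (fun t => (C.hasDerivAt_energy hV hK bd.sol bd.momentum (Set.mem_univ t)).deriv) t t'

theorem contDiffOn_effPotential (hV : S.IsPotential V) :
    ContDiffOn ℝ ∞ (S.effPotential V K) S.I := by
  intro r hr
  refine ContDiffAt.contDiffWithinAt ?_
  refine (V_contDiffAt hV hr).add (contDiffAt_const.div (contDiffAt_const.mul
    ((f_contDiffAt hr).pow 2)) ?_)
  have := f_pos' hr
  positivity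

/-- A motion which is at rest radially at a critical point of the effective potential is
circular. -/
theorem eq_of_critical (C : Chart S) (hV : S.IsPotential V) (hK : K ≠ 0) {r φ : ℝ → ℝ}
    (bd : S.IsBoundedTrajectory V r φ K) {t₀ : ℝ} (h0 : deriv r t₀ = 0)
    (h1 : deriv (C.P V K) (C.u (r t₀)) = 0) (t : ℝ) : r t = r t₀ := by
  obtain ⟨r₁, r₂, hr₁, hr₂, hr⟩ := bd.bounded
  have hsub : Set.Icc r₁ r₂ ⊆ S.I := fun x hx =>
    ⟨hr₁.trans_le (EReal.coe_le_coe_iff.2 hx.1), (EReal.coe_le_coe_iff.2 hx.2).trans_lt hr₂⟩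
  have hE := contDiffOn_effPotential (K := K) hV
  have hE' : ContDiffOn ℝ 1 (deriv (S.effPotential V K)) (Set.Icc r₁ r₂) :=
    (((contDiffOn_infty_iff_deriv_of_isOpen S.isOpen_I).1 hE).2.mono hsub).of_le
      (by exact_mod_cast le_top)
  obtain ⟨L, hL⟩ := hE'.exists_lipschitzOnWith (by simp) (convex_Icc _ _) isCompact_Icc
  have hLip : LipschitzOnWith (max 1 L) (fun z : ℝ × ℝ => (z.2, -deriv (S.effPotential V K) z.1))
      (Set.Icc r₁ r₂ ×ˢ Set.univ) := by
    have l1 : LipschitzOnWith 1 (fun z : ℝ × ℝ => z.2) (Set.Icc r₁ r₂ ×ˢ Set.univ) :=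
      LipschitzWith.prod_snd.lipschitzOnWith
    have l2 : LipschitzOnWith L (fun z : ℝ × ℝ => -deriv (S.effPotential V K) z.1)
        (Set.Icc r₁ r₂ ×ˢ Set.univ) := by
      have := hL.comp (LipschitzWith.prod_fst (α := ℝ) (β := ℝ)).lipschitzOnWith
        (s := Set.Icc r₁ r₂ ×ˢ Set.univ) (fun z hz => hz.1)
      rw [mul_one] at this
      exact this.neg
    exact l1.prodMk l2
  have hcrit : deriv (S.effPotential V K) (r t₀) = 0 := by
    rw [(hasDerivAt_effPotential (C := C) hV (bd.sol.mem t₀ trivial) hK).deriv, h1]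
    ring
  -- Uniqueness for the system of `(r, ṙ)` compares the motion with the equilibrium; the field is
  -- Lipschitz over the compact range of `r`.
  have := ODE_solution_unique_univ (v := fun (_ : ℝ) (z : ℝ × ℝ) => (z.2, -deriv (S.effPotential V K) z.1))
    (s := fun _ => Set.Icc r₁ r₂ ×ˢ Set.univ) (K := max 1 L) (t₀ := t₀)
    (f := fun t => (r t, deriv r t)) (g := fun _ => (r t₀, 0)) (fun _ => hLip)
    (fun t => ⟨(bd.sol.diff_r t trivial).hasDerivAt.prodMk
      (C.radial_acceleration hV hK bd.sol bd.momentum trivial), hr t, trivial⟩)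
    (fun t => ⟨(hasDerivAt_const t (r t₀, (0:ℝ))).congr_deriv (by simp [hcrit]; rfl), hr t₀, trivial⟩)
    (by simp [h0])
  exact congrArg Prod.fst (congrFun this t)

theorem isCircular_of_const {r φ : ℝ → ℝ} (hK : K ≠ 0) (bd : S.IsBoundedTrajectory V r φ K)
    {r₀ : ℝ} (hr : ∀ t, r t = r₀) : IsCircular r φ := by
  refine ⟨r₀, ?_⟩
  have hr₀ : r₀ ∈ S.I := by rw [← hr 0]; exact bd.sol.mem 0 trivial
  have hf := (f_pos' hr₀).ne'
  have hk : K / S.f r₀ ^ 2 ≠ 0 := by positivity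
  have hφ : ∀ t, φ t = φ 0 + K / S.f r₀ ^ 2 * t := by
    intro t
    have hd : ∀ t, HasDerivAt (fun t => φ t - K / S.f r₀ ^ 2 * t) 0 t := fun t => by
      have h1 := (bd.sol.diff_φ t trivial).hasDerivAt
      rw [bd.sol.deriv_φ bd.momentum trivial, hr] at h1
      exact (h1.sub ((hasDerivAt_id t).const_mul (K / S.f r₀ ^ 2))).congr_deriv (by simp)
    have := is_const_of_deriv_eq_zero (fun t => (hd t).differentiableAt)
      (fun t => (hd t).deriv) t 0
    simp only [mul_zero, sub_zero] at this
    linarith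
  rw [show r = fun _ => r₀ from funext hr, show φ = fun t => φ 0 + K / S.f r₀ ^ 2 * t from
    funext hφ]
  exact orbit_const_linear hk _

/-- The range of `|θ|` along a noncircular closed orbit is a well of the reduced potential. -/
theorem exists_well (C : Chart S) (hV : S.IsPotential V) (hK : K ≠ 0) {r φ : ℝ → ℝ}
    (bd : S.IsBoundedTrajectory V r φ K) (hnc : ¬ IsCircular r φ) (hcl : IsClosedOrbit r φ) :
    ∃ α ∈ C.J, ∃ β ∈ C.J, IsWell (C.P V K) (deriv (C.P V K)) α β ∧
      ∀ x ∈ Set.Icc α β, ∃ t, r t = C.R x := by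
  have hrI : ∀ t, r t ∈ S.I := fun t => bd.sol.mem t trivial
  have hrd : ∀ t, HasDerivAt r (deriv r t) t := fun t => (bd.sol.diff_r t trivial).hasDerivAt
  have hw : ∀ t, HasDerivAt (fun t => C.u (r t)) (C.s * (C.u (r t) ^ 2 + C.c) * deriv r t) t :=
    fun t => (hasDerivAt_u (hrI t)).comp t (hrd t)
  have hwc : Continuous fun t => C.u (r t) := continuous_iff_continuousAt.2 fun t =>
    (hw t).continuousAt
  obtain ⟨T, hT, hper⟩ := hcl
  have hwp : Function.Periodic (fun t => C.u (r t)) T := fun t => by simp only [(hper t).1]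
  have hne : (Set.Icc 0 T).Nonempty := Set.nonempty_Icc.2 hT.le
  obtain ⟨t₁, -, h1⟩ := isCompact_Icc.exists_isMinOn hne hwc.continuousOn
  obtain ⟨t₂, -, h2⟩ := isCompact_Icc.exists_isMaxOn hne hwc.continuousOn
  have hmin : ∀ t, C.u (r t₁) ≤ C.u (r t) := fun t => by
    obtain ⟨y, hy, hy'⟩ := hwp.exists_mem_Ico₀ hT t
    rw [hy']; exact h1 (Set.Ico_subset_Icc_self hy)
  have hmax : ∀ t, C.u (r t) ≤ C.u (r t₂) := fun t => by
    obtain ⟨y, hy, hy'⟩ := hwp.exists_mem_Ico₀ hT t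
    rw [hy']; exact h2 (Set.Ico_subset_Icc_self hy)
  have hrest : ∀ t, C.s * (C.u (r t) ^ 2 + C.c) * deriv r t = 0 → deriv r t = 0 := fun t h =>
    (mul_eq_zero.1 h).resolve_left (mul_ne_zero s_ne (u_sq_add_pos (hrI t)).ne')
  have hlmin : IsLocalMin (fun t => C.u (r t)) t₁ := Eventually.of_forall hmin
  have hlmax : IsLocalMax (fun t => C.u (r t)) t₂ := Eventually.of_forall hmax
  have hr1 : deriv r t₁ = 0 := hrest _ (hlmin.hasDerivAt_eq_zero (hw t₁))
  have hr2 : deriv r t₂ = 0 := hrest _ (hlmax.hasDerivAt_eq_zero (hw t₂))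
  -- A noncircular motion never rests radially at a critical point. This gives the nonzero
  -- derivatives at the ends of the well and excludes interior points at the top level.
  have noncrit : ∀ t, deriv r t = 0 → deriv (C.P V K) (C.u (r t)) ≠ 0 := fun t h h' =>
    hnc (isCircular_of_const hK bd (C.eq_of_critical hV hK bd h h'))
  have ha : 0 < K ^ 2 / C.ξ ^ 4 := by have := C.ξ_pos; positivity
  have hen : ∀ t, deriv r t ^ 2 / 2 + K ^ 2 / C.ξ ^ 4 * C.P V K (C.u (r t)) =
      K ^ 2 / C.ξ ^ 4 * C.P V K (C.u (r t₁)) := fun t => by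
    have := C.energy_eq hV hK bd t t₁
    rw [effPotential_eq (C := C) (hrI t) hK, effPotential_eq (C := C) (hrI t₁) hK, hr1] at this
    linarith
  set α := C.u (r t₁) with hα
  set β := C.u (r t₂) with hβ
  have hαJ : α ∈ C.J := u_mem (hrI t₁)
  have hβJ : β ∈ C.J := u_mem (hrI t₂)
  have hsub : Set.Icc α β ⊆ C.J := C.ordConnected_J.out hαJ hβJ
  have hsurj : ∀ x ∈ Set.Icc α β, ∃ t, C.u (r t) = x := fun x hx =>
    mem_range_of_exists_le_of_exists_ge hwc ⟨t₁, hx.1⟩ ⟨t₂, hx.2⟩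
  have hle : ∀ x ∈ Set.Icc α β, C.P V K x ≤ C.P V K α := by
    intro x hx
    obtain ⟨t, rfl⟩ := hsurj x hx
    have h3 := hen t
    have h4 := sq_nonneg (deriv r t)
    exact le_of_mul_le_mul_left (by linarith) ha
  have hαβ : α < β := by
    refine lt_of_le_of_ne (hmax t₁) fun h => ?_
    refine hnc (isCircular_of_const hK bd (r₀ := r t₁) fun t => ?_)
    exact C.injOn_u (hrI t) (hrI t₁) (le_antisymm ((hmax t).trans h.ge) (hmin t))
  have hPβ : C.P V K β = C.P V K α := by
    have := hen t₂
    rw [hr2] at this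
    exact mul_left_cancel₀ ha.ne' (by linarith)
  refine ⟨α, hαJ, β, hβJ, ⟨hαβ, hPβ.symm, fun x hx => ?_, ?_, ?_⟩, fun x hx => ?_⟩
  · refine lt_of_le_of_ne (hle x (Set.Ioo_subset_Icc_self hx)) fun h => ?_
    obtain ⟨t, rfl⟩ := hsurj x (Set.Ioo_subset_Icc_self hx)
    have h3 := hen t
    rw [h] at h3
    have h4 : deriv r t = 0 := by
      have : deriv r t ^ 2 = 0 := by linarith
      exact pow_eq_zero_iff two_ne_zero |>.1 this
    refine noncrit t h4 ?_
    have hloc : IsLocalMax (C.P V K) (C.u (r t)) := by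
      filter_upwards [Icc_mem_nhds hx.1 hx.2] with y hy
      rw [h]; exact hle y hy
    exact hloc.deriv_eq_zero
  · refine lt_of_le_of_ne ?_ (noncrit t₁ hr1)
    have h3 : Tendsto (slope (C.P V K) α) (𝓝[>] α) (𝓝 (deriv (C.P V K) α)) :=
      (hasDerivAt_iff_tendsto_slope.1 (hasDerivAt_P hV hαJ)).mono_left
        (nhdsWithin_mono _ fun x hx => ne_of_gt hx)
    refine le_of_tendsto h3 ?_
    filter_upwards [Ioo_mem_nhdsGT hαβ] with x hx
    rw [slope_def_field]
    exact div_nonpos_of_nonpos_of_nonneg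
      (sub_nonpos.2 (hle x (Set.Ioo_subset_Icc_self hx))) (sub_nonneg.2 hx.1.le)
  · refine lt_of_le_of_ne ?_ (noncrit t₂ hr2).symm
    have h3 : Tendsto (slope (C.P V K) β) (𝓝[<] β) (𝓝 (deriv (C.P V K) β)) :=
      (hasDerivAt_iff_tendsto_slope.1 (hasDerivAt_P hV hβJ)).mono_left
        (nhdsWithin_mono _ fun x hx => ne_of_lt hx)
    refine ge_of_tendsto h3 ?_
    filter_upwards [Ioo_mem_nhdsLT hαβ] with x hx
    rw [slope_def_field, hPβ]
    exact div_nonneg_of_nonpos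
      (sub_nonpos.2 (hle x (Set.Ioo_subset_Icc_self hx))) (sub_nonpos.2 hx.2.le)
  · obtain ⟨t, ht⟩ := hsurj x hx
    exact ⟨t, by rw [← ht, R_u (hrI t)]⟩

/-- The oscillations in a well have a period commensurable with `2π` if the orbits in a larger ring
are closed. -/
theorem integral_wellDensity_mem (hV : S.IsPotential V) (hK : K ≠ 0) {p : ℝ → ℝ} {α β a b : ℝ}
    (hP : IsC2On (C.P V K) (deriv (C.P V K)) p α β) (hw : IsWell (C.P V K) (deriv (C.P V K)) a b)
    (hα : α ∈ C.J) (hβ : β ∈ C.J) (ha : a ∈ Set.Icc α β) (hb : b ∈ Set.Icc α β)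
    (hcl : ∀ r φ : ℝ → ℝ, S.IsBoundedTrajectory V r φ K →
      (∀ t, ∃ x ∈ Set.Icc α β, r t = C.R x) → IsClosedOrbit r φ) :
    ∫ x in (0:ℝ)..2 * Real.pi, wellDensity p a b x ∈ piRational := by
  have hq : ∀ x, 0 < dividedDiff p a b (wellAngle a b x) := fun x =>
    hw.dividedDiff_pos hP ha hb (wellAngle_mem hw.lt x)
  have hmem : ∀ x, wellAngle a b x ∈ Set.Icc α β := fun x =>
    Set.Icc_subset_Icc ha.1 hb.2 (wellAngle_mem hw.lt x)
  obtain ⟨r, φ, bd, h1, -, h3⟩ := exists_periodic_solution (C := C) (K := K)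
    (υ := wellAngle a b)
    (v := fun x => (b - a) / 2 * Real.cos x * √(2 * dividedDiff p a b (wellAngle a b x)))
    (G := wellDensity p a b) hV hK hα hβ
    (continuous_iff_continuousAt.2 fun x => (hasDerivAt_wellAngle a b x).continuousAt)
    (hw.continuous_wellDensity hP ha hb) hmem (hw.wellDensity_pos hP ha hb)
    (fun x => (hasDerivAt_wellAngle a b x).congr_deriv (by
      have := (Real.sqrt_pos.2 (mul_pos two_pos (hq x))).ne'
      rw [wellDensity, mul_inv_cancel_right₀ this]))
    (hw.hasDerivAt_velocity hP ha hb) (IsWell.periodic_wellAngle a b)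
    (IsWell.periodic_wellDensity p a b) (fun x e1 e2 => by
      have h0 := (Real.sqrt_pos.2 (mul_pos two_pos (hq 0))).ne'
      rw [e1] at e2
      have h4 : (b - a) / 2 ≠ 0 := by have := hw.lt; exact (by linarith : 0 < (b - a) / 2).ne'
      have h5 := mul_left_cancel₀ h4 (mul_right_cancel₀ h0 e2)
      rw [Real.cos_zero] at h5
      obtain ⟨n, hn⟩ := (Real.cos_eq_one_iff x).1 h5
      exact ⟨n, hn.symm⟩)
  refine h3 (hcl r φ bd fun t => ?_)
  obtain ⟨x, hx⟩ := h1 t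
  exact ⟨_, hmem x, hx⟩

/-- Orbits in the wells inside the one swept by `γ` stay in its ring at the same momentum, so they
are closed and their periods commensurable with `2π`. The nondegenerate critical point thus obtained
is a strongly stable circle. -/
theorem isLocallyClosing_of_semilocallyClosing (C : Chart S) (hV : S.IsPotential V)
    (h : S.IsSemilocallyClosing V) : S.IsLocallyClosing V := by
  obtain ⟨hloc, r, φ, K, hK, bd, hnc, hcl⟩ := h
  refine ⟨?_, hloc⟩
  obtain ⟨r₁, r₂, hr₁, hr₂, hr⟩ := bd.bounded
  have hbelow : BddBelow (Set.range r) := ⟨r₁, by rintro _ ⟨t, rfl⟩; exact (hr t).1⟩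
  have habove : BddAbove (Set.range r) := ⟨r₂, by rintro _ ⟨t, rfl⟩; exact (hr t).2⟩
  have hclγ : IsClosedOrbit r φ := hcl r φ bd fun t =>
    ⟨csInf_le hbelow ⟨t, rfl⟩, le_csSup habove ⟨t, rfl⟩⟩
  obtain ⟨α, hα, β, hβ, hw, hsurj⟩ := C.exists_well hV hK bd hnc hclγ
  have hαβ := hw.lt.le
  have hsub : Set.Icc α β ⊆ C.J := C.ordConnected_J.out hα hβ
  have hclamp : ∀ x, max α (min β x) ∈ Set.Icc α β := fun x =>
    ⟨le_max_left _ _, max_le hαβ (min_le_left _ _)⟩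
  -- Clamping to `[α, β]` extends the second derivative continuously to the line, as the divided
  -- differences require.
  have hP : IsC2On (C.P V K) (deriv (C.P V K))
      (fun x => deriv (deriv (C.P V K)) (max α (min β x))) α β := by
    refine ⟨?_, fun x hx => hasDerivAt_P hV (hsub hx), fun x hx => ?_⟩
    · rw [continuous_iff_continuousAt]
      intro x
      have h1 := (P_contDiffAt (K := K) hV (hsub (hclamp x))).deriv_infty.deriv_infty.continuousAt
      exact ContinuousAt.comp (f := fun x => max α (min β x)) h1
        (Continuous.continuousAt (by fun_prop))
    · simp only [min_eq_right hx.2, max_eq_right hx.1]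
      exact hasDerivAt_deriv_P hV (hsub hx)
  obtain ⟨z, hz, hz0, hpz⟩ := hw.exists_nondegenerate hP countable_piRational
    (fun a b ha hb hab => integral_wellDensity_mem hV hK hP hab hα hβ ha hb fun r' φ' bd' h' =>
      hcl r' φ' bd' fun t => by
        obtain ⟨x, hx, hxt⟩ := h' t
        obtain ⟨t', ht'⟩ := hsurj x hx
        rw [hxt, ← ht']
        exact ⟨csInf_le hbelow ⟨t', rfl⟩, le_csSup habove ⟨t', rfl⟩⟩)
  refine ⟨C.R z, K, (C.isStronglyStable_iff hV).2 ⟨R_mem (hsub hz), hK, ?_, ?_⟩⟩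
  · rw [u_R (hsub hz), hz0]
  · simp only [min_eq_right hz.2, max_eq_right hz.1] at hpz
    rwa [u_R (hsub hz)]

end Chart

end RevolutionSurface

/-! ### Orbital stability and weakly closing potentials -/

namespace RevolutionSurface

variable {S : RevolutionSurface} {V : ℝ → ℝ} {K : ℝ}

namespace Chart

variable {C : Chart S}

/-- The Morse coordinate has a simple zero at `r₀`, so the minimum is strict. -/
theorem eventually_effPotential_lt (C : Chart S) (hV : S.IsPotential V) {r₀ : ℝ}
    (h : S.IsStronglyStable V r₀ K) :
    ∀ᶠ r in 𝓝[≠] r₀, S.effPotential V K r₀ < S.effPotential V K r := by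
  obtain ⟨hr₀, hK, h1, h2⟩ := (C.isStronglyStable_iff hV).1 h
  obtain ⟨s, hs, hs0, hs1, hPs⟩ := exists_morse_coordinate C.isOpen_J (P_contDiffOn hV)
    (u_mem hr₀) h1 h2
  have hd := (hs.differentiableAt (by simp)).hasDerivAt.comp r₀ (hasDerivAt_u (C := C) hr₀)
  have hne := hd.eventually_ne (c := 0)
    (mul_ne_zero hs1.ne' (mul_ne_zero s_ne (u_sq_add_pos hr₀).ne'))
  have hu := (hasDerivAt_u (C := C) hr₀).continuousAt
  filter_upwards [hne, nhdsWithin_le_nhds (hu.eventually hPs),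
    nhdsWithin_le_nhds (S.isOpen_I.mem_nhds hr₀)] with r e1 e2 e3
  have e3 : r ∈ S.I := e3
  rw [effPotential_eq (C := C) hr₀ hK, effPotential_eq (C := C) e3 hK]
  have e2 : C.P V K (C.u r) = C.P V K (C.u r₀) + s (C.u r) ^ 2 / 2 := e2
  have e1 : s (C.u r) ≠ 0 := e1
  rw [e2]
  have : 0 < K ^ 2 / C.ξ ^ 4 * (s (C.u r) ^ 2 / 2) := by
    have := C.ξ_pos
    positivity
  linarith

/-- The Lagrange–Dirichlet argument: a conserved energy below the potential barrier at `r₀ ± ρ`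
confines `r`, and `r` determines the angular velocity at fixed momentum. -/
theorem isOrbitallyStable_of_isStronglyStable (C : Chart S) (hV : S.IsPotential V) {r₀ : ℝ}
    (h : S.IsStronglyStable V r₀ K) : S.IsOrbitallyStable V r₀ K := by
  refine ⟨h.2.1, fun ε hε => ?_⟩
  have hr₀ := ((C.isStronglyStable_iff hV).1 h).1
  have hK := h.1
  have hEd : ∀ r ∈ S.I, ContinuousAt (S.effPotential V K) r := fun r hr =>
    (hasDerivAt_effPotential (C := C) hV hr hK).continuousAt
  have hωc : ContinuousAt (fun r => K / S.f r ^ 2) r₀ :=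
    continuousAt_const.div ((f_contDiffAt hr₀).continuousAt.pow 2)
      (pow_ne_zero _ (f_pos' hr₀).ne')
  have hloc : ∀ᶠ r in 𝓝 r₀, r ∈ S.I ∧ (r ≠ r₀ → S.effPotential V K r₀ < S.effPotential V K r) ∧
      |K / S.f r ^ 2 - K / S.f r₀ ^ 2| < ε := by
    have h1 := eventually_nhdsWithin_iff.1 (C.eventually_effPotential_lt hV h)
    filter_upwards [S.isOpen_I.mem_nhds hr₀, h1, Metric.continuousAt_iff'.1 hωc ε hε]
      with r a b c using ⟨a, b, c⟩
  obtain ⟨ρ₀, hρ₀, hball⟩ := Metric.eventually_nhds_iff.1 hloc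
  set ρ := min (ρ₀ / 2) (ε / 2) with hρdef
  have hρ : 0 < ρ := by positivity
  have hρε : ρ < ε := (min_le_right _ _).trans_lt (by linarith)
  have hin : ∀ r, |r - r₀| ≤ ρ → r ∈ S.I ∧
      (r ≠ r₀ → S.effPotential V K r₀ < S.effPotential V K r) ∧
      |K / S.f r ^ 2 - K / S.f r₀ ^ 2| < ε := fun r hr =>
    hball (by rw [Real.dist_eq]; exact hr.trans_lt ((min_le_left _ _).trans_lt (by linarith)))
  set E := S.effPotential V K
  have hmp : E r₀ < E (r₀ + ρ) := (hin _ (by simp [abs_of_pos hρ])).2.1 (by linarith)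
  have hmm : E r₀ < E (r₀ - ρ) := (hin _ (by simp [abs_of_pos hρ])).2.1 (by linarith)
  -- The first entry is the height of the barrier; the second turns the energy bound into `|ṙ| < ε`.
  set μ := min (min (E (r₀ + ρ)) (E (r₀ - ρ)) - E r₀) (ε ^ 2 / 2) with hμdef
  have hμ : 0 < μ := lt_min (sub_pos.2 (lt_min hmp hmm)) (by positivity)
  obtain ⟨δ₁, hδ₁, hδE⟩ := Metric.continuousAt_iff.1 (hEd r₀ hr₀) (μ / 2) (by positivity)
  -- `δ₁` and `√μ` bound the initial potential and kinetic excess by `μ / 2` each; `ρ` puts the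
  -- start inside the barrier.
  refine ⟨min (min δ₁ (√μ)) ρ, by positivity, ?_⟩
  intro t₀ t₁ r φ ht₀ ht₁ sol mom h1 h2 h3 t ht ht'
  have hmem : ∀ t', 0 ≤ t' → t' ≤ t → t' ∈ Set.Ioo t₀ t₁ := fun t' a b =>
    ⟨ht₀.trans_le a, b.trans_lt ht'⟩
  have hH : ∀ t', 0 ≤ t' → t' ≤ t →
      deriv r t' ^ 2 / 2 + E (r t') = deriv r 0 ^ 2 / 2 + E (r 0) := fun t' a b =>
    isOpen_Ioo.is_const_of_deriv_eq_zero
      (f := fun t => deriv r t ^ 2 / 2 + S.effPotential V K (r t)) isPreconnected_Ioo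
      (fun s hs => (C.hasDerivAt_energy hV hK sol mom hs).differentiableAt.differentiableWithinAt)
      (fun s hs => (C.hasDerivAt_energy hV hK sol mom hs).deriv) (hmem t' a b) ⟨ht₀, ht₁⟩
  have hH0 : deriv r 0 ^ 2 / 2 + E (r 0) < E r₀ + μ := by
    have e1 := hδE (x := r 0) (h1.trans_le ((min_le_left _ _).trans (min_le_left _ _)))
    rw [Real.dist_eq] at e1
    have e2 : |deriv r 0| ^ 2 < √μ ^ 2 := pow_lt_pow_left₀
      (h2.trans_le ((min_le_left _ _).trans (min_le_right _ _))) (abs_nonneg _) two_ne_zero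
    rw [sq_abs, Real.sq_sqrt hμ.le] at e2
    have := (abs_lt.1 e1).2
    linarith
  have hbar : ∀ t', 0 ≤ t' → t' ≤ t → |r t' - r₀| ≠ ρ := by
    intro t' a b hab
    have e1 : E r₀ + μ ≤ E (r t') := by
      have hμ1 : μ ≤ min (E (r₀ + ρ)) (E (r₀ - ρ)) - E r₀ := min_le_left _ _
      rcases (abs_eq hρ.le).1 hab with h | h
      · rw [show r t' = r₀ + ρ by linarith]
        linarith [min_le_left (E (r₀ + ρ)) (E (r₀ - ρ))]
      · rw [show r t' = r₀ - ρ by linarith]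
        linarith [min_le_right (E (r₀ + ρ)) (E (r₀ - ρ))]
    have e2 := hH t' a b
    have e3 := sq_nonneg (deriv r t')
    linarith
  have hrt : |r t - r₀| < ρ := by
    by_contra! hge
    have hc : ContinuousOn (fun t => |r t - r₀|) (Set.Icc 0 t) := fun s hs =>
      ((sol.diff_r s (hmem s hs.1 hs.2)).continuousAt.sub continuousAt_const).abs.continuousWithinAt
    obtain ⟨t', ht'1, ht'2⟩ := intermediate_value_Icc ht hc
      ⟨(h1.trans_le (min_le_right _ _)).le, hge⟩
    exact hbar t' ht'1.1 ht'1.2 ht'2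
  obtain ⟨hI, hE, hω⟩ := hin (r t) hrt.le
  refine ⟨hrt.trans hρε, ?_, ?_⟩
  · have e1 : E r₀ ≤ E (r t) := by
      rcases eq_or_ne (r t) r₀ with h | h
      · rw [h]
      · exact (hE h).le
    have e2 := hH t ht le_rfl
    have e3 : μ ≤ ε ^ 2 / 2 := min_le_right _ _
    exact abs_lt_of_sq_lt_sq (by linarith) hε.le
  · rwa [sol.deriv_φ mom (hmem t ht le_rfl)]

/-- A circular orbit at a maximum of the reduced potential is unstable. -/
theorem not_isOrbitallyStable_of_isMaxOn (hV : S.IsPotential V) (hK : K ≠ 0) {x₀ : ℝ}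
    (hx₀ : x₀ ∈ C.J) (hmax : ∀ x ∈ C.J, C.P V K x ≤ C.P V K x₀) :
    ¬ S.IsOrbitallyStable V (C.R x₀) K := by
  rintro ⟨-, hst⟩
  have hξ := C.ξ_pos
  obtain ⟨ε₀, hε₀, hball⟩ := Metric.nhds_basis_closedBall.mem_iff.1 (C.isOpen_J.mem_nhds hx₀)
  rw [Real.closedBall_eq_Icc] at hball
  set η := ε₀ / 2 with hη
  have hηpos : 0 < η := by positivity
  have hx₁ : x₀ + η ∈ C.J := hball ⟨by linarith, by linarith⟩
  have hne : C.R (x₀ + η) - C.R x₀ ≠ 0 := fun h => by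
    have := congrArg C.u (sub_eq_zero.1 h)
    rw [u_R hx₁, u_R hx₀] at this
    linarith
  obtain ⟨δ, hδ, hst⟩ := hst _ (abs_pos.2 hne)
  obtain ⟨v₀, hv₀, hv₀δ⟩ : ∃ v₀ > 0, |K| / C.ξ ^ 2 * v₀ < δ := by
    have : 0 < |K| / C.ξ ^ 2 := by positivity
    refine ⟨δ / (2 * (|K| / C.ξ ^ 2)), by positivity, ?_⟩
    field_simp
    norm_num
  obtain ⟨σ, hσ, hσabs, hσK⟩ : ∃ σ : ℝ, σ * σ = 1 ∧ |σ| = 1 ∧ σ / K = |K|⁻¹ := by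
    rcases lt_or_gt_of_ne hK with h | h
    · exact ⟨-1, by norm_num, by norm_num, by rw [abs_of_neg h]; field_simp⟩
    · exact ⟨1, by norm_num, by norm_num, by rw [abs_of_pos h]; field_simp⟩
  -- The escaping motion is parametrized by `|θ| - x₀` itself, with velocity `w` given by the
  -- energy. As `P ≤ P(x₀)`, `w ≥ v₀ > 0`: the motion never turns back and reaches `x₀ + η` however
  -- small `v₀` is. Clamping makes the path global; it solves the equations only on the open
  -- interval.
  let υ : ℝ → ℝ := fun x => max (x₀ - ε₀) (min (x₀ + ε₀) (x₀ + x))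
  have hυI : ∀ x, υ x ∈ Set.Icc (x₀ - ε₀) (x₀ + ε₀) := fun x =>
    ⟨le_max_left _ _, max_le (by linarith) (min_le_left _ _)⟩
  have hυJ : ∀ x, υ x ∈ C.J := fun x => hball (hυI x)
  have hυO : ∀ x ∈ Set.Ioo (-ε₀) ε₀, υ x = x₀ + x := fun x hx => by
    simp only [υ]
    rw [min_eq_right (by linarith [hx.2]), max_eq_right (by linarith [hx.1])]
  have hυc : Continuous υ := by fun_prop
  let w : ℝ → ℝ := fun y => √(2 * (C.P V K x₀ - C.P V K y) + v₀ ^ 2)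
  have hw2 : ∀ y ∈ C.J, 0 < 2 * (C.P V K x₀ - C.P V K y) + v₀ ^ 2 := fun y hy => by
    have := hmax y hy
    have : 0 < v₀ ^ 2 := by positivity
    linarith
  have hw : ∀ y ∈ C.J, 0 < w y := fun y hy => Real.sqrt_pos.2 (hw2 y hy)
  have hwd : ∀ y ∈ C.J, HasDerivAt w (-deriv (C.P V K) y / w y) y := fun y hy => by
    refine (((((hasDerivAt_P (K := K) hV hy).const_sub (C.P V K x₀)).const_mul 2).add_const
      (v₀ ^ 2)).sqrt (hw2 y hy).ne').congr_deriv ?_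
    have := (hw y hy).ne'
    simp only [w] at this ⊢
    field_simp
  have hwc : Continuous fun x => w (υ x) := continuous_iff_continuousAt.2 fun x =>
    ContinuousAt.comp (f := υ) (hwd _ (hυJ x)).continuousAt hυc.continuousAt
  have hGc : Continuous fun x => σ * (w (υ x))⁻¹ :=
    continuous_const.mul (hwc.inv₀ fun x => (hw _ (hυJ x)).ne')
  obtain ⟨m, hm, hmG⟩ : ∃ m > 0, ∀ x, m ≤ σ * (w (υ x))⁻¹ * C.ξ ^ 2 / (K * (υ x ^ 2 + C.c)) := by
    have hc : ContinuousOn (fun y => C.ξ ^ 2 / (|K| * w y * (y ^ 2 + C.c)))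
        (Set.Icc (x₀ - ε₀) (x₀ + ε₀)) := by
      intro y hy
      refine ContinuousAt.continuousWithinAt (continuousAt_const.div
        ((continuousAt_const.mul (hwd y (hball hy)).continuousAt).mul (by fun_prop)) ?_)
      exact mul_ne_zero (mul_ne_zero (abs_ne_zero.2 hK) (hw y (hball hy)).ne')
        (sq_add_pos (hball hy)).ne'
    obtain ⟨y, hy, hmin⟩ := isCompact_Icc.exists_isMinOn ⟨_, hυI 0⟩ hc
    refine ⟨_, ?_, fun x => (hmin (hυI x)).trans_eq ?_⟩
    · have := hw y (hball hy)
      have := sq_add_pos (hball hy)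
      positivity
    · have e1 : σ * (w (υ x))⁻¹ * C.ξ ^ 2 / (K * (υ x ^ 2 + C.c)) =
        (σ / K) * (C.ξ ^ 2 / (w (υ x) * (υ x ^ 2 + C.c))) := by
        have := (hw _ (hυJ x)).ne'
        have := (sq_add_pos (hυJ x)).ne'
        field_simp
      rw [e1, hσK]
      have := (hw _ (hυJ x)).ne'
      have := (sq_add_pos (hυJ x)).ne'
      have := abs_ne_zero.2 hK
      field_simp
  have hυd : ∀ x ∈ Set.Ioo (-ε₀) ε₀, HasDerivAt υ 1 x := fun x hx => by
    refine ((hasDerivAt_id x).const_add x₀).congr_of_eventuallyEq ?_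
    filter_upwards [isOpen_Ioo.mem_nhds hx] with y hy using hυO y hy
  obtain ⟨τ, hτm, hτc, hτs, hτ0, sol, mom, dr⟩ := exists_solution (C := C) (υ := υ)
    (v := fun x => σ * w (υ x)) (G := fun x => σ * (w (υ x))⁻¹) (O := Set.Ioo (-ε₀) ε₀) hV hK
    isOpen_Ioo hυc hGc hυJ hm hmG
    (fun x hx => (hυd x hx).congr_deriv (by
      have := (hw _ (hυJ x)).ne'
      field_simp
      linarith))
    (fun x hx => ((((hwd _ (hυJ x)).comp x (hυd x hx)).const_mul σ)).congr_deriv (by ring))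
  obtain ⟨t₀, ht₀⟩ := hτs (-ε₀)
  obtain ⟨t₁, ht₁⟩ := hτs ε₀
  obtain ⟨t, ht⟩ := hτs η
  have hpre : τ ⁻¹' Set.Ioo (-ε₀) ε₀ = Set.Ioo t₀ t₁ := by
    ext y
    rw [Set.mem_preimage, Set.mem_Ioo, Set.mem_Ioo, ← hτm.lt_iff_lt (a := t₀),
      ← hτm.lt_iff_lt (b := t₁), ht₀, ht₁]
  have h0mem : (0:ℝ) ∈ Set.Ioo (-ε₀) ε₀ := ⟨by linarith, hε₀⟩
  have hυ0 : υ 0 = x₀ := by rw [hυO 0 h0mem, add_zero]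
  have hr0 : C.R (υ (τ 0)) = C.R x₀ := by rw [hτ0, hυ0]
  rw [hpre] at sol dr
  have ht₀0 : t₀ < 0 := hτm.lt_iff_lt.1 (by rw [ht₀, hτ0]; linarith)
  have ht₁0 : 0 < t₁ := hτm.lt_iff_lt.1 (by rw [ht₁, hτ0]; linarith)
  have key := hst t₀ t₁ _ _ ht₀0 ht₁0 sol (fun s _ => mom s trivial) ?_ ?_ ?_ t ?_ ?_
  · have := key.1
    rw [ht, hυO η ⟨by linarith, by linarith⟩] at this
    exact lt_irrefl _ this
  · rw [hr0, sub_self, abs_zero]; exact hδ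
  · rw [dr 0 ⟨ht₀0, ht₁0⟩, hτ0, hυ0]
    have e1 : w x₀ = v₀ := by simp [w, Real.sqrt_sq hv₀.le]
    have hs : |C.s| = 1 := by
      have := congrArg (|·|) C.s_mul_s
      simp only [abs_mul, abs_one] at this
      nlinarith [abs_nonneg C.s]
    rw [e1, abs_mul, abs_mul, abs_div, abs_mul, hs, hσabs, abs_of_pos hv₀,
      abs_of_pos (pow_pos hξ 2), one_mul, one_mul]
    exact hv₀δ
  · rw [sol.deriv_φ (fun s _ => mom s trivial) ⟨ht₀0, ht₁0⟩, hr0, sub_self, abs_zero]; exact hδ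
  · exact (hτm.lt_iff_lt.1 (by rw [ht, hτ0]; exact hηpos)).le
  · exact hτm.lt_iff_lt.1 (by rw [ht, ht₁]; linarith)

/-- If no circle is strongly stable, then `P'' ≤ 0` at every circular orbit, and eliminating `K`
gives `(W' / x)' ≤ 0`. For the momentum of the circle at `x₀`, `P'` is a positive multiple of `W'(x)
/ x - W'(x₀) / x₀`, so `x₀` is a global maximum of `P`, contrary to orbital stability. -/
theorem isLocallyClosing_of_weaklyClosing (C : Chart S) (hV : S.IsPotential V)
    (h : S.IsWeaklyClosing V) : S.IsLocallyClosing V := by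
  obtain ⟨hst, hcl⟩ := h
  refine ⟨?_, fun r₀ K₀ h => hcl r₀ K₀ (C.isOrbitallyStable_of_isStronglyStable hV h)⟩
  by_contra! hno
  have hξ := C.ξ_pos
  have hcirc : ∀ x ∈ C.J, ∃ K, K ≠ 0 ∧ deriv (C.P V K) x = 0 ∧
      S.IsOrbitallyStable V (C.R x) K := by
    intro x hx
    obtain ⟨K, hK⟩ := hst _ (R_mem hx)
    have h1 := (C.isCircularOrbit_iff hV).1 hK.1
    rw [u_R hx] at h1
    exact ⟨K, h1.2.1, h1.2.2, hK⟩
  have hQd : ∀ x ∈ C.J, HasDerivAt (fun x => deriv (C.W V) x / x)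
      ((deriv (deriv (C.W V)) x * x - deriv (C.W V) x) / x ^ 2) x := fun x hx =>
    ((hasDerivAt_deriv_W hV hx).div (hasDerivAt_id x) (J_pos hx).ne').congr_deriv (by simp)
  have hQ : AntitoneOn (fun x => deriv (C.W V) x / x) C.J := by
    refine antitoneOn_of_deriv_nonpos C.convex_J
      (fun x hx => (hQd x hx).continuousAt.continuousWithinAt)
      (fun x hx => (hQd x (interior_subset hx)).differentiableAt.differentiableWithinAt) ?_
    intro x hx
    have hx := interior_subset hx
    have hxpos := J_pos hx
    rw [(hQd x hx).deriv]
    obtain ⟨K, hK, h1, -⟩ := hcirc x hx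
    have h2 : ¬ 0 < deriv (deriv (C.P V K)) x := fun h2 => by
      refine hno (C.R x) K ((C.isStronglyStable_iff hV).2 ?_)
      rw [u_R hx]
      exact ⟨R_mem hx, hK, h1, h2⟩
    rw [deriv_deriv_P hV hx] at h2
    have h3 := deriv_W_eq hV hK hx h1
    have h4 : C.ξ ^ 2 * deriv (deriv (C.W V)) x ≤ -K ^ 2 := by
      have hK2 : 0 < K ^ 2 := by positivity
      have h5 : C.ξ ^ 2 * (K ^ 2 + C.ξ ^ 2 * deriv (deriv (C.W V)) x) ≤ 0 := by
        have h6 := mul_nonpos_of_nonneg_of_nonpos hK2.le (not_lt.1 h2)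
        have h7 : K ^ 2 * (C.ξ ^ 2 + C.ξ ^ 4 / K ^ 2 * deriv (deriv (C.W V)) x) =
          C.ξ ^ 2 * (K ^ 2 + C.ξ ^ 2 * deriv (deriv (C.W V)) x) := by field_simp
        rwa [h7] at h6
      have := nonpos_of_mul_nonpos_right h5 (by positivity)
      linarith
    refine div_nonpos_of_nonpos_of_nonneg ?_ (by positivity)
    have h8 := mul_le_mul_of_nonneg_right h4 hxpos.le
    have h9 : C.ξ ^ 2 * (deriv (deriv (C.W V)) x * x - deriv (C.W V) x) ≤ 0 := by linarith
    exact nonpos_of_mul_nonpos_right h9 (by positivity)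
  obtain ⟨r₀, hr₀⟩ := S.nonempty_I
  have hx₀ : C.u r₀ ∈ C.J := u_mem hr₀
  set x₀ := C.u r₀
  obtain ⟨K, hK, h1, hor⟩ := hcirc x₀ hx₀
  have hP' : ∀ x ∈ C.J, deriv (C.P V K) x =
      x * (C.ξ ^ 4 / K ^ 2 * (deriv (C.W V) x / x - deriv (C.W V) x₀ / x₀)) := by
    intro x hx
    have e1 := (J_pos hx).ne'
    have e2 := (J_pos hx₀).ne'
    have e3 := deriv_W_eq hV hK hx₀ h1
    have e4 : deriv (C.W V) x₀ / x₀ = -(K ^ 2 / C.ξ ^ 2) := by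
      field_simp
      linarith
    rw [deriv_P hV hx, e4]
    field_simp
    ring
  have hcoef : 0 < C.ξ ^ 4 / K ^ 2 := by positivity
  refine not_isOrbitallyStable_of_isMaxOn (C := C) hV hK hx₀ (fun x hx => ?_) hor
  rcases le_total x x₀ with hxx | hxx
  · have hsub : Set.Icc x x₀ ⊆ C.J := C.ordConnected_J.out hx hx₀
    refine (monotoneOn_of_deriv_nonneg (convex_Icc x x₀)
      (fun y hy => (hasDerivAt_P hV (hsub hy)).continuousAt.continuousWithinAt)
      (fun y hy => (hasDerivAt_P hV
        (hsub (interior_subset hy))).differentiableAt.differentiableWithinAt)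
      fun y hy => ?_) ⟨le_rfl, hxx⟩ ⟨hxx, le_rfl⟩ hxx
    have hy := interior_subset hy
    rw [hP' y (hsub hy)]
    have := hQ (hsub hy) hx₀ hy.2
    exact mul_nonneg (J_pos (hsub hy)).le (mul_nonneg hcoef.le (sub_nonneg.2 this))
  · have hsub : Set.Icc x₀ x ⊆ C.J := C.ordConnected_J.out hx₀ hx
    refine (antitoneOn_of_deriv_nonpos (convex_Icc x₀ x)
      (fun y hy => (hasDerivAt_P hV (hsub hy)).continuousAt.continuousWithinAt)
      (fun y hy => (hasDerivAt_P hV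
        (hsub (interior_subset hy))).differentiableAt.differentiableWithinAt)
      fun y hy => ?_) ⟨le_rfl, hxx⟩ ⟨hxx, le_rfl⟩ hxx
    have hy := interior_subset hy
    rw [hP' y (hsub hy)]
    have := hQ hx₀ (hsub hy) hy.1
    exact mul_nonpos_of_nonneg_of_nonpos (J_pos (hsub hy)).le
      (mul_nonpos_of_nonneg_of_nonpos hcoef.le (sub_nonpos.2 this))

end Chart

end RevolutionSurface

/-! ### Motion in the fields of `V₁` and `V₂` -/

/-- A harmonic oscillator of frequency `k` with respect to the parameter `φ`. -/
theorem exists_eq_cos_add_sin {X Y φ φ' : ℝ → ℝ} {k : ℝ} (hk : k ≠ 0)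
    (hφ : ∀ t, HasDerivAt φ (φ' t) t) (hX : ∀ t, HasDerivAt X (φ' t * Y t) t)
    (hY : ∀ t, HasDerivAt Y (-(φ' t * k ^ 2 * X t)) t) :
    ∃ a b : ℝ, ∀ t, X t = a * Real.cos (k * φ t) + b * Real.sin (k * φ t) := by
  have hc : ∀ t, HasDerivAt (fun t => Real.cos (k * φ t)) (-Real.sin (k * φ t) * (k * φ' t)) t :=
    fun t => (Real.hasDerivAt_cos _).comp t ((hφ t).const_mul k)
  have hs : ∀ t, HasDerivAt (fun t => Real.sin (k * φ t)) (Real.cos (k * φ t) * (k * φ' t)) t :=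
    fun t => (Real.hasDerivAt_sin _).comp t ((hφ t).const_mul k)
  have h1 : ∀ t, HasDerivAt
      (fun t => k * X t * Real.cos (k * φ t) - Y t * Real.sin (k * φ t)) 0 t := fun t =>
    ((((hX t).const_mul k).mul (hc t)).sub ((hY t).mul (hs t))).congr_deriv (by ring)
  have h2 : ∀ t, HasDerivAt
      (fun t => k * X t * Real.sin (k * φ t) + Y t * Real.cos (k * φ t)) 0 t := fun t =>
    ((((hX t).const_mul k).mul (hs t)).add ((hY t).mul (hc t))).congr_deriv (by ring)
  have e1 := is_const_of_deriv_eq_zero (fun t => (h1 t).differentiableAt) fun t => (h1 t).deriv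
  have e2 := is_const_of_deriv_eq_zero (fun t => (h2 t).differentiableAt) fun t => (h2 t).deriv
  refine ⟨(k * X 0 * Real.cos (k * φ 0) - Y 0 * Real.sin (k * φ 0)) / k,
    (k * X 0 * Real.sin (k * φ 0) + Y 0 * Real.cos (k * φ 0)) / k, fun t => ?_⟩
  rw [e1 0 t, e2 0 t]
  field_simp
  linear_combination (-(k * X t)) * Real.sin_sq_add_cos_sq (k * φ t)

/-- Periodicity tested at `0` and at a quarter period combines to `(a² + b²)(cos kT - 1) = 0`. -/
theorem le_of_periodic_cos_add_sin {a b k T : ℝ} (hk : 0 < k) (hT : 0 < T)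
    (hab : a ≠ 0 ∨ b ≠ 0)
    (h : Function.Periodic (fun x => a * Real.cos (k * x) + b * Real.sin (k * x)) T) :
    2 * Real.pi / k ≤ T := by
  have h0 := h 0
  have h1 := h (Real.pi / 2 / k)
  have e1 : k * (Real.pi / 2 / k + T) = k * T + Real.pi / 2 := by field_simp; ring
  have e2 : k * (Real.pi / 2 / k) = Real.pi / 2 := by field_simp
  simp only [e1, e2, zero_add, mul_zero, Real.cos_zero, Real.sin_zero, Real.cos_add_pi_div_two,
    Real.sin_add_pi_div_two, Real.cos_pi_div_two, Real.sin_pi_div_two] at h0 h1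
  have hpos : 0 < a ^ 2 + b ^ 2 := by
    rcases hab with h | h <;> positivity
  have hcos : Real.cos (k * T) = 1 := by
    have : (a ^ 2 + b ^ 2) * (Real.cos (k * T) - 1) = 0 := by
      linear_combination a * h0 + b * h1
    linarith [(mul_eq_zero.1 this).resolve_left hpos.ne']
  obtain ⟨n, hn⟩ := (Real.cos_eq_one_iff _).1 hcos
  have hn1 : (1:ℝ) ≤ n := by
    have : (0:ℝ) < n := by
      have h1 : 0 < n * (2 * Real.pi) := by rw [hn]; positivity
      exact (pos_iff_pos_of_mul_pos h1).2 (by positivity)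
    exact_mod_cast this
  rw [div_le_iff₀ hk]
  nlinarith [Real.pi_pos]

namespace RevolutionSurface

variable {S : RevolutionSurface} {V : ℝ → ℝ} {K : ℝ}

theorem IsCircular.const {r φ : ℝ → ℝ} (h : IsCircular r φ) (t t' : ℝ) : r t = r t' := by
  obtain ⟨r₀, h⟩ := h
  have key : ∀ t, r t = r₀ := fun t => by
    have : (r t, (φ t : Real.Angle)) ∈ orbit r φ := ⟨t, rfl⟩
    rw [h] at this
    exact this.1
  rw [key, key]

/-- On a nonsingular bounded trajectory, time is a smooth function of the angle. -/
theorem IsBoundedTrajectory.exists_time {r φ : ℝ → ℝ} (bd : S.IsBoundedTrajectory V r φ K)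
    (hK : K ≠ 0) :
    ∃ τ : ℝ → ℝ, (∀ x, φ (τ x) = x) ∧ (∀ t, τ (φ t) = t) ∧
      ∀ x, HasDerivAt τ (S.f (r (τ x)) ^ 2 / K) x := by
  obtain ⟨r₁, r₂, hr₁, hr₂, hr⟩ := bd.bounded
  have hsub : Set.Icc r₁ r₂ ⊆ S.I := fun x hx =>
    ⟨hr₁.trans_le (EReal.coe_le_coe_iff.2 hx.1), (EReal.coe_le_coe_iff.2 hx.2).trans_lt hr₂⟩
  obtain ⟨M, hM⟩ := (isCompact_Icc (a := r₁) (b := r₂)).exists_bound_of_continuousOn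
    (S.f_smooth.continuousOn.mono hsub)
  have hφ : ∀ t, HasDerivAt φ (K / S.f (r t) ^ 2) t := fun t => by
    rw [← bd.sol.deriv_φ bd.momentum (Set.mem_univ t)]
    exact (bd.sol.diff_φ t trivial).hasDerivAt
  have hfr : ∀ t, 0 < S.f (r t) := fun t => f_pos' (hsub (hr t))
  have hfM : ∀ t, S.f (r t) ≤ M := fun t => (le_abs_self _).trans (hM _ (hr t))
  have hM0 : 0 < M := (hfr 0).trans_le (hfM 0)
  obtain ⟨g, -, -, hg1, hg2, hgd⟩ := exists_inverse_of_deriv_ge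
    (f := fun t => φ t / K) (f' := fun t => K / S.f (r t) ^ 2 / K) (m := 1 / M ^ 2)
    (by positivity) (fun t => (hφ t).div_const K) fun t => by
      have := hfr t
      rw [show K / S.f (r t) ^ 2 / K = 1 / S.f (r t) ^ 2 by field_simp]
      exact one_div_le_one_div_of_le (by positivity) (pow_le_pow_left₀ this.le (hfM t) 2)
  refine ⟨fun x => g (x / K), fun x => ?_, fun t => hg2 t, fun x => ?_⟩
  · have := hg1 (x / K)
    field_simp at this
    exact this
  · have := (hgd (x / K)).comp x ((hasDerivAt_id x).div_const K)
    refine this.congr_deriv ?_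
    have := (hfr (g (x / K))).ne'
    field_simp

/-- If `r` is a function of the angle having a period commensurable with `2π`, the orbit is
closed. -/
theorem isClosedOrbit_of_periodic {r φ τ : ℝ → ℝ}
    (h1 : ∀ x, φ (τ x) = x) (h2 : ∀ t, τ (φ t) = t)
    (h3 : ∀ x, HasDerivAt τ (S.f (r (τ x)) ^ 2 / K) x) {n : ℕ} (hn : n ≠ 0)
    (hp : Function.Periodic (fun x => r (τ x)) (n * (2 * Real.pi))) : IsClosedOrbit r φ := by
  set Φ := n * (2 * Real.pi) with hΦ
  have hd : ∀ x, HasDerivAt (fun x => τ (x + Φ) - τ x) 0 x := fun x => by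
    have := ((h3 (x + Φ)).comp_add_const x Φ).sub (h3 x)
    refine this.congr_deriv ?_
    have e : r (τ (x + Φ)) = r (τ x) := hp x
    rw [e, sub_self]
  have hc := is_const_of_deriv_eq_zero (fun x => (hd x).differentiableAt) fun x => (hd x).deriv
  set T := τ (0 + Φ) - τ 0 with hT
  have hτ : ∀ x, τ (x + Φ) = τ x + T := fun x => by
    have := hc x 0
    rw [hT, ← this]; ring
  have hφ : ∀ t, φ (t + T) = φ t + Φ := fun t => by
    rw [← h1 (φ t + Φ), hτ, h2]
  have hr : ∀ t, r (t + T) = r t := fun t => by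
    have := hp (φ t)
    simp only [hτ, h2] at this
    exact this
  have hang : ((Φ : ℝ) : Real.Angle) = 0 := by
    rw [hΦ, ← nsmul_eq_mul, Real.Angle.coe_nsmul, Real.Angle.coe_two_pi, smul_zero]
  have hT0 : T ≠ 0 := fun h => by
    have := hφ 0
    rw [h, add_zero] at this
    have : Φ = 0 := by linarith
    have hn' : (n : ℝ) ≠ 0 := by exact_mod_cast hn
    rw [hΦ] at this
    exact mul_ne_zero hn' (by positivity) this
  -- Time runs against the angle when `K < 0`, so `T` may be negative.
  rcases hT0.lt_or_gt with h | h
  · refine ⟨-T, by linarith, fun t => ⟨?_, ?_⟩⟩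
    · rw [← hr (t + -T), neg_add_cancel_right]
    · have := hφ (t + -T)
      rw [neg_add_cancel_right] at this
      rw [this, Real.Angle.coe_add, hang, add_zero]
  · exact ⟨T, h, fun t => ⟨hr t, by rw [hφ, Real.Angle.coe_add, hang, add_zero]⟩⟩

namespace Chart

variable {C : Chart S} {i : ℕ} {A B : ℝ}

theorem deriv_W_of_form (hi : i = 1 ∨ i = 2) (hVe : ∀ r ∈ S.I, V r = S.Vpot i A B r) {x : ℝ}
    (hx : x ∈ C.J) : deriv (C.W V) x = -A / x ^ (i ^ 2 - 1) := by
  have : C.W V =ᶠ[𝓝 x] powerPotential i A B := by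
    filter_upwards [C.isOpen_J.mem_nhds hx] with y hy
    rw [W, hVe _ (R_mem hy), Vpot_eq C, u_R hy]
  rw [this.deriv_eq, (hasDerivAt_powerPotential hi A B (J_pos hx)).deriv]

theorem deriv_deriv_W_of_form (hi : i = 1 ∨ i = 2) (hVe : ∀ r ∈ S.I, V r = S.Vpot i A B r) {x : ℝ}
    (hx : x ∈ C.J) :
    deriv (deriv (C.W V)) x = (1 - (i : ℝ) ^ 2) * (-A / x ^ (i ^ 2 - 1)) / x := by
  have : deriv (C.W V) =ᶠ[𝓝 x] fun x => -A / x ^ (i ^ 2 - 1) := by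
    filter_upwards [C.isOpen_J.mem_nhds hx] with y hy using deriv_W_of_form hi hVe hy
  rw [this.deriv_eq, (hasDerivAt_deriv_powerPotential hi A (J_pos hx)).deriv]

theorem isPotential_Vpot (C : Chart S) (hi : i = 1 ∨ i = 2) (A B : ℝ) :
    S.IsPotential (S.Vpot i A B) := by
  intro r hr
  refine ContDiffAt.contDiffWithinAt ?_
  have hu := u_contDiffAt (C := C) hr
  have hpos := u_pos (C := C) hr
  rcases hi with rfl | rfl
  · have : S.Vpot 1 A B = fun r => -A * C.u r + B :=
      funext fun r => (Vpot_eq C 1 A B r).trans (powerPotential_one A B _)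
    rw [this]
    exact (contDiffAt_const.mul hu).add contDiffAt_const
  · have : S.Vpot 2 A B = fun r => A / 2 * (C.u r ^ 2)⁻¹ + B :=
      funext fun r => (Vpot_eq C 2 A B r).trans (powerPotential_two A B _)
    rw [this]
    exact (contDiffAt_const.mul ((hu.pow 2).inv (by positivity))).add contDiffAt_const

theorem deriv_P_eq_zero_iff_of_form (hV : S.IsPotential V) (hi : i = 1 ∨ i = 2)
    (hVe : ∀ r ∈ S.I, V r = S.Vpot i A B r) (hK : K ≠ 0) {x : ℝ} (hx : x ∈ C.J) :
    deriv (C.P V K) x = 0 ↔ K ^ 2 = C.ξ ^ 2 * (A / x ^ (i ^ 2)) := by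
  have hx0 := J_pos hx
  have key : K ^ 2 * x = -(C.ξ ^ 2 * deriv (C.W V) x) ↔ K ^ 2 = C.ξ ^ 2 * (A / x ^ (i ^ 2)) := by
    rw [deriv_W_of_form hi hVe hx]
    have e : x ^ (i ^ 2) = x ^ (i ^ 2 - 1) * x := by
      rcases hi with rfl | rfl
      · norm_num
      · norm_num; ring
    rw [e, show -(C.ξ ^ 2 * (-A / x ^ (i ^ 2 - 1))) = C.ξ ^ 2 * (A / (x ^ (i ^ 2 - 1) * x)) * x by
      field_simp]
    exact mul_left_inj' hx0.ne'
  exact ⟨fun h => key.1 (deriv_W_eq hV hK hx h), fun h => deriv_P_eq_zero hV hK hx (key.2 h)⟩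

theorem isCircularOrbit_iff_of_form (C : Chart S) (hV : S.IsPotential V) (hi : i = 1 ∨ i = 2)
    (hA : 0 < A) (hVe : ∀ r ∈ S.I, V r = S.Vpot i A B r) {r₀ : ℝ} (hr₀ : r₀ ∈ S.I) :
    S.IsCircularOrbit V r₀ K ↔
      (K = C.ξ * √(A / C.u r₀ ^ (i ^ 2)) ∨ K = -(C.ξ * √(A / C.u r₀ ^ (i ^ 2)))) := by
  have hu := u_pos (C := C) hr₀
  have hξ := C.ξ_pos
  have hq : 0 < A / C.u r₀ ^ (i ^ 2) := by positivity
  rw [C.isCircularOrbit_iff hV, ← sq_eq_sq_iff_eq_or_eq_neg, mul_pow, Real.sq_sqrt hq.le]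
  constructor
  · rintro ⟨-, hK, h⟩
    exact (deriv_P_eq_zero_iff_of_form hV hi hVe hK (u_mem hr₀)).1 h
  · intro h
    have hK : K ≠ 0 := fun h0 => by
      rw [h0] at h
      have : 0 < C.ξ ^ 2 * (A / C.u r₀ ^ i ^ 2) := by positivity
      rw [← h] at this
      simp at this
    exact ⟨hr₀, hK, (deriv_P_eq_zero_iff_of_form hV hi hVe hK (u_mem hr₀)).2 h⟩

/-- At every circle `P'' = i² ξ²`, whatever the radius. -/
theorem isStronglyStable_of_form (C : Chart S) (hV : S.IsPotential V) (hi : i = 1 ∨ i = 2)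
    (hA : 0 < A) (hVe : ∀ r ∈ S.I, V r = S.Vpot i A B r) {r₀ : ℝ} (hr₀ : r₀ ∈ S.I) :
    S.IsStronglyStable V r₀ (C.ξ * √(A / C.u r₀ ^ (i ^ 2))) := by
  have h := (C.isCircularOrbit_iff hV).1
    ((C.isCircularOrbit_iff_of_form hV hi hA hVe hr₀).2 (Or.inl rfl))
  refine (C.isStronglyStable_iff hV).2 ⟨hr₀, h.2.1, h.2.2, ?_⟩
  have hx := u_mem (C := C) hr₀
  have hx0 := J_pos hx
  have hξ := C.ξ_pos
  rw [deriv_deriv_P_of_deriv_eq_zero hV h.2.1 hx h.2.2, deriv_deriv_W_of_form hi hVe hx,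
    deriv_W_of_form hi hVe hx]
  have : C.u r₀ * ((1 - (i:ℝ) ^ 2) * (-A / C.u r₀ ^ (i ^ 2 - 1)) / C.u r₀) /
      (-A / C.u r₀ ^ (i ^ 2 - 1)) = 1 - (i : ℝ) ^ 2 := by
    field_simp
  rw [this]
  rcases hi with rfl | rfl <;> norm_num <;> positivity

/-- In the field of `V_i` the function `|θ|^i` oscillates harmonically along an orbit with
respect to the angle. -/
theorem exists_harmonic (C : Chart S) (hV : S.IsPotential V) (hi : i = 1 ∨ i = 2)
    (hVe : ∀ r ∈ S.I, V r = S.Vpot i A B r) (hK : K ≠ 0) {r φ : ℝ → ℝ}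
    (sol : S.IsSolutionOn V Set.univ r φ) (mom : S.HasMomentumOn Set.univ r φ K) :
    ∃ w a b : ℝ, ∀ t, C.u (r t) ^ i =
      w + (a * Real.cos (i * C.ξ * φ t) + b * Real.sin (i * C.ξ * φ t)) := by
  have hξ := C.ξ_pos
  have hrI : ∀ t, r t ∈ S.I := fun t => sol.mem t trivial
  set φ' : ℝ → ℝ := fun t => K * (C.u (r t) ^ 2 + C.c) / C.ξ ^ 2 with hφ'
  have hφ : ∀ t, HasDerivAt φ (φ' t) t := fun t => by
    rw [hφ']; simp only
    rw [← div_f_sq (hrI t), ← sol.deriv_φ mom (Set.mem_univ t)]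
    exact (sol.diff_φ t trivial).hasDerivAt
  set x : ℝ → ℝ := fun t => C.u (r t) with hx
  set y : ℝ → ℝ := fun t => C.s * C.ξ ^ 2 / K * deriv r t with hy
  have hxJ : ∀ t, x t ∈ C.J := fun t => u_mem (hrI t)
  have hx0 : ∀ t, 0 < x t := fun t => J_pos (hxJ t)
  have dx : ∀ t, HasDerivAt x (φ' t * y t) t := fun t => by
    refine ((hasDerivAt_u (hrI t)).comp t (sol.diff_r t trivial).hasDerivAt).congr_deriv ?_
    simp only [hφ', hy]
    field_simp
  have dy : ∀ t, HasDerivAt y (-(φ' t * deriv (C.P V K) (x t))) t := fun t => by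
    have h := sol.radial t trivial
    rw [sol.deriv_φ mom (Set.mem_univ t), force_eq (C := C) hV (hrI t) hK] at h
    refine (h.const_mul (C.s * C.ξ ^ 2 / K)).congr_deriv ?_
    simp only [hφ', hx]
    field_simp
    linear_combination (-((C.u (r t) ^ 2 + C.c) * deriv (C.P V K) (C.u (r t)))) * C.s_mul_s
  rcases hi with rfl | rfl
  · obtain ⟨a, b, h⟩ := exists_eq_cos_add_sin (X := fun t => x t - C.ξ ^ 2 * A / K ^ 2) (Y := y)
      hξ.ne' hφ (fun t => (dx t).sub_const _) fun t => (dy t).congr_deriv (by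
        rw [deriv_P hV (hxJ t), deriv_W_of_form (Or.inl rfl) hVe (hxJ t)]
        norm_num
        field_simp
        ring)
    refine ⟨C.ξ ^ 2 * A / K ^ 2, a, b, fun t => ?_⟩
    have := h t
    simp only [pow_one, Nat.cast_one, one_mul]
    linarith
  -- For `i = 1` the reduced equation is already linear. For `i = 2` the energy `E` linearizes the
  -- equation of `u²`: `(u²)'' = 2 u'² - 2 u P' = -4 ξ² (u² - w)`, the terms in `u⁻²` cancelling.
  · have hE : ∀ t, HasDerivAt (fun t => y t ^ 2 / 2 + C.P V K (x t)) 0 t := fun t =>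
      ((((dy t).pow 2).div_const 2).add ((hasDerivAt_P hV (hxJ t)).comp t (dx t))).congr_deriv
        (by norm_num; ring)
    have hEc := is_const_of_deriv_eq_zero (fun t => (hE t).differentiableAt) fun t => (hE t).deriv
    set E := y 0 ^ 2 / 2 + C.P V K (x 0) with hEdef
    have hEt : ∀ t, y t ^ 2 / 2 + (C.ξ ^ 2 / 2 * x t ^ 2 + C.ξ ^ 4 / K ^ 2 *
        (A / 2 * (x t ^ 2)⁻¹ + B)) = E := fun t => by
      rw [hEdef, ← hEc t 0]
      simp only [P, W, R_u (hrI t), hx]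
      rw [hVe _ (hrI t), Vpot_eq C, powerPotential_two]
    set w := (E - C.ξ ^ 4 / K ^ 2 * B) / C.ξ ^ 2 with hw
    obtain ⟨a, b, h⟩ := exists_eq_cos_add_sin (X := fun t => x t ^ 2 - w)
      (Y := fun t => 2 * x t * y t) (k := 2 * C.ξ) (by positivity) hφ
      (fun t => (((dx t).pow 2).sub_const _).congr_deriv (by norm_num; ring)) fun t =>
        ((((dx t).const_mul 2).mul (dy t))).congr_deriv (by
        rw [deriv_P hV (hxJ t), deriv_W_of_form (Or.inr rfl) hVe (hxJ t), hw, ← hEt t]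
        have := (hx0 t).ne'
        norm_num
        field_simp
        ring)
    refine ⟨w, a, b, fun t => ?_⟩
    have := h t
    push_cast
    linarith

/-- Nonsingular bounded orbits in the field of `V_i`. -/
theorem exists_periodic_graph (C : Chart S) (hV : S.IsPotential V) (hi : i = 1 ∨ i = 2)
    (hVe : ∀ r ∈ S.I, V r = S.Vpot i A B r) (hK : K ≠ 0) {r φ τ : ℝ → ℝ}
    (bd : S.IsBoundedTrajectory V r φ K) (h1 : ∀ x, φ (τ x) = x) :
    Function.Periodic (fun x => r (τ x)) (2 * Real.pi / (i * C.ξ)) ∧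
      (¬ IsCircular r φ → ∀ T : ℝ, 0 < T → Function.Periodic (fun x => r (τ x)) T →
        2 * Real.pi / (i * C.ξ) ≤ T) := by
  obtain ⟨w, a, b, h⟩ := C.exists_harmonic hV hi hVe hK bd.sol bd.momentum
  have hi0 : i ≠ 0 := by rcases hi with rfl | rfl <;> norm_num
  have hξ := C.ξ_pos
  have hk : 0 < i * C.ξ := by positivity
  have hrI : ∀ t, r t ∈ S.I := fun t => bd.sol.mem t trivial
  have hinj : ∀ t t', C.u (r t) ^ i = C.u (r t') ^ i → r t = r t' := fun t t' e =>
    C.injOn_u (hrI t) (hrI t')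
      ((pow_left_inj₀ (u_pos (hrI t)).le (u_pos (hrI t')).le hi0).1 e)
  have hx : ∀ x, C.u (r (τ x)) ^ i =
      w + (a * Real.cos (i * C.ξ * x) + b * Real.sin (i * C.ξ * x)) := fun x => by
    rw [h, h1]
  refine ⟨fun x => hinj _ _ ?_, fun hnc T hT hp => le_of_periodic_cos_add_sin (a := a) (b := b)
    hk hT ?_ fun x => ?_⟩
  · rw [hx, hx, show i * C.ξ * (x + 2 * Real.pi / (i * C.ξ)) = i * C.ξ * x + 2 * Real.pi by
      field_simp, Real.cos_add_two_pi, Real.sin_add_two_pi]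
  · by_contra! hab
    refine hnc (isCircular_of_const hK bd (r₀ := r 0) fun t => hinj _ _ ?_)
    rw [h, h, hab.1, hab.2]; simp
  · have e := hx (x + T)
    have e' : r (τ (x + T)) = r (τ x) := hp x
    rw [e', hx] at e
    linarith

theorem isClosedOrbit_of_form (C : Chart S) {q : ℚ} (hq : C.ξ = q) (hV : S.IsPotential V)
    (hi : i = 1 ∨ i = 2) (hVe : ∀ r ∈ S.I, V r = S.Vpot i A B r) (hK : K ≠ 0) {r φ : ℝ → ℝ}
    (bd : S.IsBoundedTrajectory V r φ K) : IsClosedOrbit r φ := by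
  obtain ⟨τ, h1, h2, h3⟩ := bd.exists_time hK
  have hp := (C.exists_periodic_graph hV hi hVe hK bd h1).1
  refine isClosedOrbit_of_periodic (S := S) (K := K) h1 h2 h3 q.den_ne_zero ?_
  have hi0 : (i : ℝ) ≠ 0 := by rcases hi with rfl | rfl <;> norm_num
  have hξ := C.ξ_pos
  have hden : (q.den : ℝ) ≠ 0 := by exact_mod_cast q.den_ne_zero
  -- Here rationality of `ξ` enters: after as many turns as its denominator, `r` has completed a
  -- whole number of periods.
  have e : (q.den : ℝ) * (2 * Real.pi) = ((i * q.num : ℤ) : ℝ) * (2 * Real.pi / (i * C.ξ)) := by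
    have : C.ξ * q.den = q.num := by rw [hq]; exact_mod_cast Rat.mul_den_eq_num q
    push_cast
    field_simp
    linear_combination this
  rw [e]
  exact hp.int_mul _

theorem exists_noncircular_of_form (C : Chart S) (hV : S.IsPotential V) (hi : i = 1 ∨ i = 2)
    (hA : 0 < A) (hVe : ∀ r ∈ S.I, V r = S.Vpot i A B r) :
    ∃ (r φ : ℝ → ℝ) (K : ℝ), K ≠ 0 ∧ S.IsBoundedTrajectory V r φ K ∧ ¬ IsCircular r φ := by
  obtain ⟨r₀, hr₀⟩ := S.nonempty_I
  obtain ⟨-, hK, h1, h2⟩ := (C.isStronglyStable_iff hV).1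
    (C.isStronglyStable_of_form hV hi hA hVe hr₀)
  obtain ⟨_, _, _, h₀, hh₀, -, -, -, -, -, h⟩ :=
    exists_small_oscillations hV hK (u_mem hr₀) h1 h2 univ_mem
  obtain ⟨r, φ, bd, -, ⟨t, t', hne⟩, -⟩ := h (h₀ / 2) (by linarith) (by linarith)
  exact ⟨r, φ, _, hK, bd, fun hc => hne (hc.const t t')⟩

/-- The five classes of closing potentials coincide with the potentials `V_i`. -/
theorem closing_classes_iff (C : Chart S) {q : ℚ} (hq : C.ξ = q) (hV : S.IsPotential V) :
    (S.IsClosing V ↔ S.HasClosingForm V) ∧ (S.IsSemilocallyClosing V ↔ S.HasClosingForm V) ∧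
      (S.IsLocallyClosing V ↔ S.HasClosingForm V) ∧
      (S.IsStronglyClosing V ↔ S.HasClosingForm V) ∧
      (S.IsWeaklyClosing V ↔ S.HasClosingForm V) := by
  have hloc : S.IsLocallyClosing V → S.HasClosingForm V := C.hasClosingForm_of_locallyClosing hV
  have hnear : S.HasClosingForm V → ∀ (r φ : ℝ → ℝ) (K : ℝ), K ≠ 0 →
      S.IsBoundedTrajectory V r φ K → IsClosedOrbit r φ := by
    rintro ⟨i, hi, A, B, -, hVe⟩ r φ K hK bd
    exact C.isClosedOrbit_of_form hq hV hi hVe hK bd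
  have hcn : S.HasClosingForm V → ∀ r₀ K₀, S.ClosedNear V r₀ K₀ := fun h r₀ K₀ =>
    ⟨1, one_pos, fun r φ K hK bd _ _ _ => hnear h r φ K hK bd⟩
  have hex : S.HasClosingForm V → ∃ (r φ : ℝ → ℝ) (K : ℝ), K ≠ 0 ∧
      S.IsBoundedTrajectory V r φ K ∧ ¬ IsCircular r φ := by
    rintro ⟨i, hi, A, B, hA, hVe⟩
    exact C.exists_noncircular_of_form hV hi hA hVe
  have hst : S.HasClosingForm V → ∀ r₀ ∈ S.I, ∃ K₀, S.IsStronglyStable V r₀ K₀ := by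
    rintro ⟨i, hi, A, B, hA, hVe⟩ r₀ hr₀
    exact ⟨_, C.isStronglyStable_of_form hV hi hA hVe hr₀⟩
  refine ⟨⟨fun h => ?_, fun h => ⟨hex h, hnear h⟩⟩, ⟨fun h => ?_, fun h => ?_⟩,
    ⟨hloc, fun h => ?_⟩, ⟨fun h => ?_, fun h => ⟨hst h, fun r₀ K₀ _ => hcn h r₀ K₀⟩⟩,
    ⟨fun h => hloc (C.isLocallyClosing_of_weaklyClosing hV h), fun h => ?_⟩⟩
  · obtain ⟨⟨r, φ, K, hK, bd, hnc⟩, hcl⟩ := h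
    exact hloc (C.isLocallyClosing_of_semilocallyClosing hV
      ⟨fun _ _ _ => ⟨1, one_pos, fun r φ K hK bd _ _ _ => hcl r φ K hK bd⟩,
        r, φ, K, hK, bd, hnc, fun r' φ' bd' _ => hcl r' φ' K hK bd'⟩)
  · exact hloc (C.isLocallyClosing_of_semilocallyClosing hV h)
  · obtain ⟨r, φ, K, hK, bd, hnc⟩ := hex h
    exact ⟨fun r₀ K₀ _ => hcn h r₀ K₀, r, φ, K, hK, bd, hnc, fun r' φ' bd' _ =>
      hnear h r' φ' K hK bd'⟩
  · obtain ⟨r₀, hr₀⟩ := S.nonempty_I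
    obtain ⟨K₀, hK₀⟩ := hst h r₀ hr₀
    exact ⟨⟨r₀, K₀, hK₀⟩, fun r₀ K₀ _ => hcn h r₀ K₀⟩
  · obtain ⟨r₀, hr₀⟩ := S.nonempty_I
    obtain ⟨K₀, hK₀⟩ := h.1 r₀ hr₀
    exact hloc ⟨⟨r₀, K₀, hK₀⟩, h.2⟩
  · refine ⟨fun r₀ hr₀ => ?_, fun r₀ K₀ _ => hcn h r₀ K₀⟩
    obtain ⟨K₀, hK₀⟩ := hst h r₀ hr₀
    exact ⟨K₀, C.isOrbitallyStable_of_isStronglyStable hV hK₀⟩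

end Chart

end RevolutionSurface

/-! ### The ends of the interval and the attracting centre -/

namespace RevolutionSurface

variable {S : RevolutionSurface}

theorem endFilter_left_neBot (S : RevolutionSurface) : (S.endFilter S.a).NeBot := by
  refine comap_neBot fun t ht => ?_
  rw [nhdsWithin_Ioo_eq_nhdsGT S.a_lt_b] at ht
  obtain ⟨u, hu, hsub⟩ := (mem_nhdsGT_iff_exists_Ioo_subset' S.a_lt_b).1 ht
  obtain ⟨r, h1, h2⟩ := EReal.lt_iff_exists_real_btwn.1 hu
  exact ⟨r, hsub ⟨h1, h2⟩⟩

theorem endFilter_right_neBot (S : RevolutionSurface) : (S.endFilter S.b).NeBot := by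
  refine comap_neBot fun t ht => ?_
  rw [nhdsWithin_Ioo_eq_nhdsLT S.a_lt_b] at ht
  obtain ⟨u, hu, hsub⟩ := (mem_nhdsLT_iff_exists_Ioo_subset' S.a_lt_b).1 ht
  obtain ⟨r, h1, h2⟩ := EReal.lt_iff_exists_real_btwn.1 hu
  exact ⟨r, hsub ⟨h1, h2⟩⟩

theorem eventually_endFilter_mem (S : RevolutionSurface) (e : EReal) :
    ∀ᶠ r in S.endFilter e, r ∈ S.I :=
  eventually_comap.2 ((eventually_mem_nhdsWithin).mono fun _ hx _ hr => by rw [← hr] at hx; exact hx)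

theorem eventually_endFilter_left {r₁ : ℝ} (h : r₁ ∈ S.I) : ∀ᶠ r in S.endFilter S.a, r < r₁ :=
  eventually_comap.2 ((eventually_of_mem (mem_nhdsWithin_of_mem_nhds (Iio_mem_nhds h.1)) fun _ hx => hx).mono fun _ hx _ hr => by
    rw [← hr] at hx; exact EReal.coe_lt_coe_iff.1 hx)

theorem eventually_endFilter_right {r₁ : ℝ} (h : r₁ ∈ S.I) : ∀ᶠ r in S.endFilter S.b, r₁ < r :=
  eventually_comap.2 ((eventually_of_mem (mem_nhdsWithin_of_mem_nhds (Ioi_mem_nhds h.2)) fun _ hx => hx).mono fun _ hx _ hr => by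
    rw [← hr] at hx; exact EReal.coe_lt_coe_iff.1 hx)

/-- Dominance near the end by every single value replaces any computation of the limit, and covers
an infimum equal to `-∞`. -/
theorem infAtEnd_of_eventually_le {g : ℝ → ℝ} {e : EReal}
    (h : ∀ r₁ ∈ S.I, ∀ᶠ r in S.endFilter e, g r ≤ g r₁) : S.InfAtEnd g e := by
  refine tendsto_order.2 ⟨fun y hy => ?_, fun y hy => ?_⟩
  · filter_upwards [S.eventually_endFilter_mem e] with r hr
    exact hy.trans_le (iInf₂_le r hr)
  · obtain ⟨r₁, hr₁, hy⟩ := by simpa only [iInf_lt_iff, exists_prop] using hy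
    filter_upwards [h r₁ hr₁] with r hr
    exact (EReal.coe_le_coe_iff.2 hr).trans_lt hy

theorem supAtEnd_of_eventually_le {g : ℝ → ℝ} {e : EReal}
    (h : ∀ r₁ ∈ S.I, ∀ᶠ r in S.endFilter e, g r₁ ≤ g r) : S.SupAtEnd g e := by
  refine tendsto_order.2 ⟨fun y hy => ?_, fun y hy => ?_⟩
  · obtain ⟨r₁, hr₁, hy⟩ := by simpa only [lt_iSup_iff, exists_prop] using hy
    filter_upwards [h r₁ hr₁] with r hr
    exact hy.trans_le (EReal.coe_le_coe_iff.2 hr)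
  · filter_upwards [S.eventually_endFilter_mem e] with r hr
    exact (le_iSup₂ (f := fun r (_ : r ∈ S.I) => (g r : EReal)) r hr).trans_lt hy

theorem not_infAtEnd {g : ℝ → ℝ} {e : EReal} [(S.endFilter e).NeBot] {r₁ r₂ : ℝ}
    (hr₂ : r₂ ∈ S.I) (hlt : g r₂ < g r₁) (h : ∀ᶠ r in S.endFilter e, g r₁ ≤ g r) :
    ¬ S.InfAtEnd g e := fun hinf => by
  have h1 : (g r₁ : EReal) ≤ ⨅ r ∈ S.I, (g r : EReal) :=
    ge_of_tendsto hinf (h.mono fun _ hr => EReal.coe_le_coe_iff.2 hr)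
  exact absurd (EReal.coe_le_coe_iff.1 (h1.trans (iInf₂_le r₂ hr₂))) (not_le.2 hlt)

theorem not_supAtEnd {g : ℝ → ℝ} {e : EReal} [(S.endFilter e).NeBot] {r₁ r₂ : ℝ}
    (hr₂ : r₂ ∈ S.I) (hlt : g r₁ < g r₂) (h : ∀ᶠ r in S.endFilter e, g r ≤ g r₁) :
    ¬ S.SupAtEnd g e := fun hsup => by
  have h1 : (⨆ r ∈ S.I, (g r : EReal)) ≤ g r₁ :=
    le_of_tendsto hsup (h.mono fun _ hr => EReal.coe_le_coe_iff.2 hr)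
  exact absurd (EReal.coe_le_coe_iff.1
    ((le_iSup₂ (f := fun r (_ : r ∈ S.I) => (g r : EReal)) r₂ hr₂).trans h1)) (not_le.2 hlt)

theorem powerPotential_antitoneOn {i : ℕ} (hi : i = 1 ∨ i = 2) {A B : ℝ} (hA : 0 < A) {x y : ℝ}
    (hx : 0 < x) (hxy : x < y) : powerPotential i A B y ≤ powerPotential i A B x := by
  rcases hi with rfl | rfl
  · rw [powerPotential_one, powerPotential_one]; nlinarith
  · rw [powerPotential_two, powerPotential_two]
    gcongr

namespace Chart

variable {C : Chart S}

/-- The product `f² (u² + c)` is constant with positive factors. -/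
theorem f_lt_f (hr : r ∈ S.I) (hr₁ : r₁ ∈ S.I) (h : C.u r₁ < C.u r) : S.f r < S.f r₁ := by
  have h1 := f_sq (C := C) hr
  have h2 := f_sq (C := C) hr₁
  have h3 := f_pos' hr
  have h4 := f_pos' hr₁
  have h5 := u_pos (C := C) hr₁
  have h6 := u_sq_add_pos (C := C) hr₁
  by_contra! hle
  have h7 : S.f r₁ ^ 2 ≤ S.f r ^ 2 := pow_le_pow_left₀ h4.le hle 2
  have h8 : C.u r₁ ^ 2 < C.u r ^ 2 := pow_lt_pow_left₀ h h5.le two_ne_zero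
  have h9 : S.f r₁ ^ 2 * (C.u r₁ ^ 2 + C.c) < S.f r ^ 2 * (C.u r ^ 2 + C.c) := by
    have h0 : 0 < S.f r ^ 2 := by positivity
    nlinarith
  rw [h1, h2] at h9
  exact lt_irrefl _ h9

/-- The coordinate `|θ|` grows towards one of the ends and decreases towards the other one. -/
theorem exists_ends (C : Chart S) : ∃ e₀ e₁ : EReal, (e₀ = S.a ∧ e₁ = S.b ∨ e₀ = S.b ∧ e₁ = S.a) ∧
    (∀ r₁ ∈ S.I, ∀ᶠ r in S.endFilter e₀, C.u r₁ < C.u r) ∧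
    (∀ r₁ ∈ S.I, ∀ᶠ r in S.endFilter e₁, C.u r < C.u r₁) := by
  have hm := C.strictMonoOn_s_mul_u
  rcases mul_self_eq_one_iff.1 C.s_mul_s with hs | hs
  · refine ⟨S.b, S.a, Or.inr ⟨rfl, rfl⟩, fun r₁ h₁ => ?_, fun r₁ h₁ => ?_⟩
    · filter_upwards [S.eventually_endFilter_mem _, eventually_endFilter_right h₁] with r hr hlt
      simpa [hs] using hm h₁ hr hlt
    · filter_upwards [S.eventually_endFilter_mem _, eventually_endFilter_left h₁] with r hr hlt
      simpa [hs] using hm hr h₁ hlt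
  · refine ⟨S.a, S.b, Or.inl ⟨rfl, rfl⟩, fun r₁ h₁ => ?_, fun r₁ h₁ => ?_⟩
    · filter_upwards [S.eventually_endFilter_mem _, eventually_endFilter_left h₁] with r hr hlt
      simpa [hs] using hm hr h₁ hlt
    · filter_upwards [S.eventually_endFilter_mem _, eventually_endFilter_right h₁] with r hr hlt
      simpa [hs] using hm h₁ hr hlt

/-- The attracting centre. -/
theorem exists_attracting_end (C : Chart S) : ∃ e₀ e₁ : EReal,
    (e₀ = S.a ∧ e₁ = S.b ∨ e₀ = S.b ∧ e₁ = S.a) ∧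
    S.InfAtEnd S.f e₀ ∧ S.SupAtEnd (fun r => |S.θ r|) e₀ ∧
    (∀ i : ℕ, i = 1 ∨ i = 2 → ∀ A B : ℝ, 0 < A → S.InfAtEnd (S.Vpot i A B) e₀) ∧
    ¬ S.InfAtEnd S.f e₁ ∧ ¬ S.SupAtEnd (fun r => |S.θ r|) e₁ := by
  obtain ⟨e₀, e₁, he, h0, h1⟩ := C.exists_ends
  have := S.endFilter_left_neBot
  have := S.endFilter_right_neBot
  have hne : (S.endFilter e₀).NeBot ∧ (S.endFilter e₁).NeBot := by
    rcases he with ⟨rfl, rfl⟩ | ⟨rfl, rfl⟩ <;> exact ⟨inferInstance, inferInstance⟩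
  obtain ⟨_, _⟩ := hne
  obtain ⟨r₁, hr₁⟩ := S.nonempty_I
  obtain ⟨r₂, hlt, hr₂⟩ := ((h0 r₁ hr₁).and (S.eventually_endFilter_mem e₀)).exists
  refine ⟨e₀, e₁, he, infAtEnd_of_eventually_le fun r hr => ?_,
    supAtEnd_of_eventually_le fun r hr => ?_, fun i hi A B hA =>
    infAtEnd_of_eventually_le fun r hr => ?_, not_infAtEnd hr₂ (f_lt_f hr₂ hr₁ hlt) ?_,
    not_supAtEnd hr₂ hlt ?_⟩
  · filter_upwards [h0 r hr, S.eventually_endFilter_mem e₀] with x hx hxI using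
      (f_lt_f hxI hr hx).le
  · filter_upwards [h0 r hr] with x hx using hx.le
  · filter_upwards [h0 r hr] with x hx
    rw [Vpot_eq C, Vpot_eq C]
    exact powerPotential_antitoneOn hi hA (u_pos hr) hx
  · filter_upwards [h1 r₁ hr₁, S.eventually_endFilter_mem e₁] with x hx hxI using
      (f_lt_f hr₁ hxI hx).le
  · filter_upwards [h1 r₁ hr₁] with x hx using hx.le

/-- An affine relation would make the derivative `-A₂ / u³` of `V₂` with respect to `u` constant on
an open interval. -/
theorem not_affine (C : Chart S) {A₁ B₁ A₂ B₂ : ℝ} (hA₂ : 0 < A₂) :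
    ¬ ∃ α β : ℝ, ∀ r ∈ S.I, S.Vpot 2 A₂ B₂ r = α * S.Vpot 1 A₁ B₁ r + β := by
  rintro ⟨α, β, h⟩
  obtain ⟨r₀, hr₀⟩ := S.nonempty_I
  have h1 : ∀ x ∈ C.J, -A₂ / x ^ (2 ^ 2 - 1) = α * (-A₁) := fun x hx => by
    have e : powerPotential 2 A₂ B₂ =ᶠ[𝓝 x] fun x => α * powerPotential 1 A₁ B₁ x + β := by
      filter_upwards [C.isOpen_J.mem_nhds hx] with y hy
      have := h _ (R_mem hy)
      rwa [Vpot_eq C, Vpot_eq C, u_R hy] at this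
    have d := ((hasDerivAt_powerPotential (Or.inl rfl) A₁ B₁ (J_pos hx)).const_mul α).add_const β
    have := (d.congr_of_eventuallyEq e).unique
      (hasDerivAt_powerPotential (Or.inr rfl) A₂ B₂ (J_pos hx))
    rw [← this]; norm_num
  have hx := u_mem (C := C) hr₀
  have hpos := J_pos hx
  have e : (fun x => -A₂ / x ^ (2 ^ 2 - 1)) =ᶠ[𝓝 (C.u r₀)] fun _ => α * (-A₁) := by
    filter_upwards [C.isOpen_J.mem_nhds hx] with y hy using h1 y hy
  have := ((hasDerivAt_const _ _).congr_of_eventuallyEq e).unique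
    (hasDerivAt_deriv_powerPotential (Or.inr rfl) A₂ hpos)
  have h3 : 0 < 3 * (A₂ / C.u r₀ ^ 3) / C.u r₀ := by positivity
  refine h3.ne' (Eq.trans ?_ this.symm)
  norm_num
  ring

/-! ### The explicit form of `f` -/

theorem deriv_f_sq_add (hr : r ∈ S.I) : deriv S.f r ^ 2 + C.c * S.f r ^ 2 = C.ξ ^ 2 := by
  rw [deriv_f (C := C) hr]
  linear_combination f_sq (C := C) hr + C.u r ^ 2 * S.f r ^ 2 * C.s_mul_s

/-- Uniqueness for `y'' = -c y` by two conserved quantities: the Wronskian `f h₁ - f' h = 0` and the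
polarized energy `f' h₁ + c f h = ξ²`. With `f'² + c f² = ξ² ≠ 0` they determine `h = f`. -/
theorem f_eq_of_oscillator (C : Chart S) {h h₁ : ℝ → ℝ} (hd : ∀ x, HasDerivAt h (h₁ x) x)
    (hd₁ : ∀ x, HasDerivAt h₁ (-(C.c * h x)) x) {r₁ : ℝ} (hr₁ : r₁ ∈ S.I)
    (e : S.f r₁ = h r₁) (e₁ : deriv S.f r₁ = h₁ r₁) {r : ℝ} (hr : r ∈ S.I) : S.f r = h r := by
  have hff : ∀ x ∈ S.I, HasDerivAt (deriv S.f) (-(C.c * S.f x)) x := fun x hx => by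
    have h1 := C.curvature_eq x hx
    rw [curvature, div_eq_iff (f_pos' hx).ne'] at h1
    rw [← h1, neg_neg]
    exact hasDerivAt_deriv_f hx
  have c1 : ∀ x ∈ S.I, HasDerivAt (fun x => S.f x * h₁ x - deriv S.f x * h x) 0 x :=
    fun x hx => (((hasDerivAt_f hx).mul (hd₁ x)).sub ((hff x hx).mul (hd x))).congr_deriv (by ring)
  have c2 : ∀ x ∈ S.I, HasDerivAt (fun x => deriv S.f x * h₁ x + C.c * (S.f x * h x)) 0 x :=
    fun x hx => (((hff x hx).mul (hd₁ x)).add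
      (((hasDerivAt_f hx).mul (hd x)).const_mul C.c)).congr_deriv (by ring)
  have k1 := S.isOpen_I.is_const_of_deriv_eq_zero S.convex_I.isPreconnected
    (fun x hx => (c1 x hx).differentiableAt.differentiableWithinAt) (fun x hx => (c1 x hx).deriv)
    hr hr₁
  have k2 := S.isOpen_I.is_const_of_deriv_eq_zero S.convex_I.isPreconnected
    (fun x hx => (c2 x hx).differentiableAt.differentiableWithinAt) (fun x hx => (c2 x hx).deriv)
    hr hr₁
  simp only [← e, ← e₁] at k1 k2
  have q := deriv_f_sq_add (C := C) hr
  have q₁ := deriv_f_sq_add (C := C) hr₁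
  refine mul_left_cancel₀ (pow_ne_zero 2 C.ξ_pos.ne') ?_
  linear_combination (-S.f r) * q₁ + h r * q - S.f r * k2 + deriv S.f r * k1

/-- The first integral `f'² + c f² = ξ²` puts `(f', √|c| f) / ξ` on a circle or a hyperbola for `c ≠
0`, and gives `f' = ±ξ` for `c = 0`. A phase shift thus matches the value and derivative of the
profile at one point. -/
theorem exists_eq_profile (C : Chart S) : ∃ σ r₀ : ℝ, (σ = 1 ∨ (σ = -1 ∧ C.c ≤ 0)) ∧
    ∀ r ∈ S.I, S.f r = σ * (C.ξ * constCurvProfile C.c (r - r₀)) := by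
  obtain ⟨r₁, hr₁⟩ := S.nonempty_I
  have q := deriv_f_sq_add (C := C) hr₁
  have hξ := C.ξ_pos
  have hf := f_pos' hr₁
  rcases lt_trichotomy C.c 0 with hc | hc | hc
  · set k := √(-C.c) with hk
    have hk0 : 0 < k := Real.sqrt_pos.2 (by linarith)
    have hk2 : C.c = -k ^ 2 := by rw [hk, Real.sq_sqrt (by linarith)]; ring
    -- The hyperbola has two branches and `cosh` covers only the positive one, hence the sign `σ` of
    -- `f'`. On the circle, for `c > 0`, no sign is needed.
    obtain ⟨σ, hσ, hσf⟩ : ∃ σ : ℝ, (σ = 1 ∨ σ = -1) ∧ |deriv S.f r₁| = σ * deriv S.f r₁ := by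
      rcases abs_cases (deriv S.f r₁) with h | h
      · exact ⟨1, Or.inl rfl, by rw [h.1, one_mul]⟩
      · exact ⟨-1, Or.inr rfl, by rw [h.1, neg_one_mul]⟩
    have hσ2 : σ * σ = 1 := by rcases hσ with rfl | rfl <;> norm_num
    set α := Real.arsinh (k * σ * S.f r₁ / C.ξ) with hα
    have hsinh : Real.sinh α = k * σ * S.f r₁ / C.ξ := Real.sinh_arsinh _
    have hcosh : Real.cosh α = σ * deriv S.f r₁ / C.ξ := by
      rw [← hσf, hα, Real.cosh_arsinh, ← Real.sqrt_sq (x := |deriv S.f r₁| / C.ξ) (by positivity),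
        div_pow |deriv S.f r₁|, sq_abs]
      congr 1
      rw [hk2] at q
      field_simp
      linear_combination k ^ 2 * S.f r₁ ^ 2 * hσ2 - q
    refine ⟨σ, r₁ - α / k, hσ.imp id fun h => ⟨h, hc.le⟩, fun r hr => ?_⟩
    have hp : ∀ x, constCurvProfile C.c x = Real.sinh (k * x) / k := fun x => by
      rw [constCurvProfile, if_neg hc.ne, if_neg hc.not_gt]
    simp only [hp]
    have hlin : ∀ x, HasDerivAt (fun x => k * (x - (r₁ - α / k))) k x := fun x =>
      (((hasDerivAt_id x).sub_const _).const_mul k).congr_deriv (by simp)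
    have e0 : k * (r₁ - (r₁ - α / k)) = α := by field_simp; ring
    refine C.f_eq_of_oscillator (h := fun x => σ * (C.ξ * (Real.sinh (k * (x - (r₁ - α / k))) / k)))
      (h₁ := fun x => σ * (C.ξ * Real.cosh (k * (x - (r₁ - α / k)))))
      (fun x => ((((hlin x).sinh.div_const k).const_mul C.ξ).const_mul σ).congr_deriv
        (by field_simp))
      (fun x => (((hlin x).cosh.const_mul C.ξ).const_mul σ).congr_deriv
        (by rw [hk2]; field_simp)) hr₁ ?_ ?_ hr
    · simp only [e0, hsinh]
      field_simp
      linear_combination -hσ2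
    · simp only [e0, hcosh]
      field_simp
      linear_combination (-deriv S.f r₁) * hσ2
  · have hp : ∀ x, constCurvProfile C.c x = x := fun x => by rw [constCurvProfile, if_pos hc]
    rw [hc, zero_mul, add_zero] at q
    obtain ⟨σ, hσ, hσf⟩ : ∃ σ : ℝ, (σ = 1 ∨ σ = -1) ∧ deriv S.f r₁ = σ * C.ξ := by
      rcases sq_eq_sq_iff_eq_or_eq_neg.1 q with h | h
      · exact ⟨1, Or.inl rfl, by rw [h, one_mul]⟩
      · exact ⟨-1, Or.inr rfl, by rw [h, neg_one_mul]⟩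
    have hσ2 : σ * σ = 1 := by rcases hσ with rfl | rfl <;> norm_num
    refine ⟨σ, r₁ - σ * S.f r₁ / C.ξ, hσ.imp id fun h => ⟨h, hc.le⟩, fun r hr => ?_⟩
    simp only [hp]
    refine C.f_eq_of_oscillator (h := fun x => σ * (C.ξ * (x - (r₁ - σ * S.f r₁ / C.ξ))))
      (h₁ := fun _ => σ * C.ξ)
      (fun x => ((((hasDerivAt_id x).sub_const _).const_mul C.ξ).const_mul σ).congr_deriv (by simp))
      (fun x => (hasDerivAt_const x _).congr_deriv (by rw [hc]; ring)) hr₁ ?_ hσf hr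
    simp only [sub_sub_cancel]
    field_simp
    linear_combination -hσ2
  · set k := √C.c with hk
    have hk0 : 0 < k := Real.sqrt_pos.2 hc
    have hk2 : C.c = k ^ 2 := by rw [hk, Real.sq_sqrt hc.le]
    obtain ⟨α, hcos, hsin⟩ : ∃ α : ℝ, Real.cos α = deriv S.f r₁ / C.ξ ∧
        Real.sin α = k * S.f r₁ / C.ξ := by
      set z : ℂ := ⟨deriv S.f r₁ / C.ξ, k * S.f r₁ / C.ξ⟩ with hz
      have hn : ‖z‖ = 1 := by
        rw [← sq_eq_sq₀ (norm_nonneg _) zero_le_one, Complex.sq_norm, Complex.normSq_mk]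
        rw [hk2] at q
        field_simp
        linear_combination q
      have hz0 : z ≠ 0 := fun h => by simp [h] at hn
      refine ⟨Complex.arg z, ?_, ?_⟩
      · rw [Complex.cos_arg hz0, hn, div_one]
      · rw [Complex.sin_arg, hn, div_one]
    refine ⟨1, r₁ - α / k, Or.inl rfl, fun r hr => ?_⟩
    have hp : ∀ x, constCurvProfile C.c x = Real.sin (k * x) / k := fun x => by
      rw [constCurvProfile, if_neg hc.ne', if_pos hc]
    simp only [hp, one_mul]
    have hlin : ∀ x, HasDerivAt (fun x => k * (x - (r₁ - α / k))) k x := fun x =>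
      (((hasDerivAt_id x).sub_const _).const_mul k).congr_deriv (by simp)
    have e0 : k * (r₁ - (r₁ - α / k)) = α := by field_simp; ring
    refine C.f_eq_of_oscillator (h := fun x => C.ξ * (Real.sin (k * (x - (r₁ - α / k))) / k))
      (h₁ := fun x => C.ξ * Real.cos (k * (x - (r₁ - α / k))))
      (fun x => (((hlin x).sin.div_const k).const_mul C.ξ).congr_deriv (by field_simp))
      (fun x => ((hlin x).cos.const_mul C.ξ).congr_deriv (by rw [hk2]; field_simp)) hr₁ ?_ ?_ hr
    · simp only [e0, hsin]
      field_simp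
    · simp only [e0, hcos]
      field_simp

theorem abs_θ_eq_sqrt (hr : r ∈ S.I) : |S.θ r| = √(C.ξ ^ 2 / S.f r ^ 2 - C.c) := by
  have h := f_sq (C := C) hr
  have h1 := (f_pos' hr).ne'
  have e : C.ξ ^ 2 / S.f r ^ 2 - C.c = |S.θ r| ^ 2 := by
    rw [← h]
    have : C.u r = |S.θ r| := rfl
    rw [this]
    field_simp
    ring
  rw [e, Real.sqrt_sq (abs_nonneg _)]

end Chart

end RevolutionSurface

/-! ### The theorem -/

theorem mainTheorem2 (S : RevolutionSurface) (hS : S.NoEquators) (ξ : ℚ) (hξ : 0 < ξ)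
    (hf : ∀ r ∈ S.I, deriv (deriv S.f) r * S.f r - (deriv S.f r) ^ 2 = -(ξ : ℝ) ^ 2) :
    -- the explicit form of `f` and `θ`
    (∃ c : ℝ,
      (∀ r ∈ S.I, S.curvature r = c) ∧
      (∃ σ r₀ : ℝ, (σ = 1 ∨ (σ = -1 ∧ c ≤ 0)) ∧
        ∀ r ∈ S.I, S.f r = σ * (ξ * constCurvProfile c (r - r₀))) ∧
      ((∀ r ∈ S.I, S.θ r = √((ξ : ℝ) ^ 2 / S.f r ^ 2 - c)) ∨
        (∀ r ∈ S.I, S.θ r = -√((ξ : ℝ) ^ 2 / S.f r ^ 2 - c)))) ∧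
    -- the potentials `V₁`, `V₂` are smooth and not affinely related
    (∀ i : ℕ, i = 1 ∨ i = 2 → ∀ A B : ℝ, 0 < A → S.IsPotential (S.Vpot i A B)) ∧
    (∀ A₁ B₁ A₂ B₂ : ℝ, 0 < A₁ → 0 < A₂ →
      ¬ ∃ α β : ℝ, ∀ r ∈ S.I, S.Vpot 2 A₂ B₂ r = α * S.Vpot 1 A₁ B₁ r + β) ∧
    -- each of the five classes of closing potentials consists exactly of the potentials `V₁`, `V₂`
    (∀ V : ℝ → ℝ, S.IsPotential V →
      let HasForm : Prop := ∃ i : ℕ, (i = 1 ∨ i = 2) ∧ ∃ A B : ℝ, 0 < A ∧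
        ∀ r ∈ S.I, V r = S.Vpot i A B r
      (S.IsClosing V ↔ HasForm) ∧
      (S.IsSemilocallyClosing V ↔ HasForm) ∧
      (S.IsLocallyClosing V ↔ HasForm) ∧
      (S.IsStronglyClosing V ↔ HasForm) ∧
      (S.IsWeaklyClosing V ↔ HasForm)) ∧
    -- properties of the motion in the field of `V_i`
    (∀ i : ℕ, i = 1 ∨ i = 2 → ∀ A B : ℝ, 0 < A →
      -- nonsingular noncircular bounded orbits have the form `r = ρ(φ)`, where the minimal
      -- positive period of `ρ` is `2π / (iξ)`
      (∀ (r φ : ℝ → ℝ) (K : ℝ), K ≠ 0 → S.IsBoundedTrajectory (S.Vpot i A B) r φ K →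
        ¬ RevolutionSurface.IsCircular r φ →
        Function.Bijective φ ∧ ∃ ρ : ℝ → ℝ, (∀ t, r t = ρ (φ t)) ∧
          Function.Periodic ρ (2 * Real.pi / (i * ξ)) ∧
          ∀ T : ℝ, 0 < T → Function.Periodic ρ T → 2 * Real.pi / (i * ξ) ≤ T) ∧
      -- the angular momentum on the circular orbits
      (∀ r₀ ∈ S.I, ∀ K : ℝ, S.IsCircularOrbit (S.Vpot i A B) r₀ K ↔
        (K = ξ * √(A / |S.θ r₀| ^ (i ^ 2)) ∨ K = -(ξ * √(A / |S.θ r₀| ^ (i ^ 2))))) ∧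
      -- the attracting centre
      (∃! e : EReal, (e = S.a ∨ e = S.b) ∧ S.InfAtEnd S.f e) ∧
      (∀ e : EReal, e = S.a ∨ e = S.b →
        (S.InfAtEnd S.f e ↔ S.SupAtEnd (fun r => |S.θ r|) e) ∧
        (S.InfAtEnd S.f e → S.InfAtEnd (S.Vpot i A B) e))) := by
  have hξ' : (0 : ℝ) < ξ := by exact_mod_cast hξ
  obtain ⟨C, hC⟩ := RevolutionSurface.exists_chart hS hξ' hf
  refine ⟨⟨C.c, C.curvature_eq, ?_, ?_⟩, fun i hi A B _ => C.isPotential_Vpot hi A B,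
    fun A₁ B₁ A₂ B₂ _ hA₂ => C.not_affine hA₂, fun V hV => C.closing_classes_iff hC hV,
    fun i hi A B hA => ⟨fun r φ K hK bd hnc => ?_, fun r₀ hr₀ K => ?_, ?_, fun e he => ?_⟩⟩
  · rw [← hC]
    exact C.exists_eq_profile
  · rw [← hC]
    refine (RevolutionSurface.θ_pos_or_neg hS).imp (fun h r hr => ?_) fun h r hr => ?_
    · rw [← RevolutionSurface.Chart.abs_θ_eq_sqrt hr, abs_of_pos (h r hr)]
    · rw [← RevolutionSurface.Chart.abs_θ_eq_sqrt hr, abs_of_neg (h r hr), neg_neg]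
  · obtain ⟨τ, h1, h2, -⟩ := bd.exists_time hK
    have h := C.exists_periodic_graph (C.isPotential_Vpot hi A B) hi (fun _ _ => rfl) hK bd h1
    rw [← hC]
    exact ⟨⟨Function.LeftInverse.injective h2, Function.RightInverse.surjective h1⟩,
      fun x => r (τ x), fun t => congrArg r (h2 t).symm, h.1, h.2 hnc⟩
  · rw [← hC]
    exact C.isCircularOrbit_iff_of_form (C.isPotential_Vpot hi A B) hi hA (fun _ _ => rfl) hr₀
  · obtain ⟨e₀, e₁, he, h1, -, -, h2, -⟩ := C.exists_attracting_end
    refine ⟨e₀, ⟨by rcases he with h | h <;> simp [h.1], h1⟩, ?_⟩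
    rintro e ⟨he', hinf⟩
    rcases he with ⟨rfl, rfl⟩ | ⟨rfl, rfl⟩ <;> rcases he' with rfl | rfl <;>
      first | rfl | exact absurd hinf h2
  · obtain ⟨e₀, e₁, he', h1, h2, h3, h4, h5⟩ := C.exists_attracting_end
    have : e = e₀ ∨ e = e₁ := by
      rcases he' with ⟨rfl, rfl⟩ | ⟨rfl, rfl⟩
      exacts [he, he.symm]
    rcases this with rfl | rfl
    · exact ⟨iff_of_true h1 h2, fun _ => h3 i hi A B hA⟩
    · exact ⟨iff_of_false h4 h5, fun h => absurd h h4⟩
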